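/- **Setting.** Let $S^1$ be the half-line $[0,\infty)$ with the topology of the circle obtained from $[0,\infty]$ by gluing $\infty$ to $0$, and with the multiplication of $[0,\infty)$; for $v\in S^1$ and $\alpha\in\mathbb R$, $v^\alpha$ is the usual power, with the convention $0^\alpha=0$ for every $\alpha\in\mathbb R$ (also $0^0=0$). A marked partition is a pair $x=(\pi,\mathbf v)$ of a partition $\pi$ of $\mathbb N=\{1,2,\dots\}$ and $\mathbf v\in (S^1)^{\mathbb N}$ constant on the blocks of $\pi$; write $\mathcal M_\infty$ for the (compact metrizable) space of marked partitions with the product topology, and $(\mathbf 1,1)$ for the single block with mark $1$. For a permutation $\sigma$ of $\mathbb N$ with finite support, $x^\sigma$ is given by $i\sim^{x^\sigma} j\iff\sigma(i)\sim^{\pi}\sigma(j)$ and marks $v_{\sigma(i)}$. $x$ is non-degenerate if all its finite blocks have mark $0$. For maps $\bar x^{(k)}=(\bar\pi^{(k)},\bar{\mathbf v}^{(k)}):[0,\infty)\to\mathcal M_\infty$, $k\ge1$, let $\mathrm{ssFrag}_\alpha(x,\bar x^{(\cdot)})=(\hat\pi,\hat{\mathbf v})$ be given by $$\hat v_i(t)=v_i\,\bar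 v_i^{(k_i)}(v_i^\alpha t),\qquad i\sim^{\hat\pi(t)}j\iff i\sim^\pi j\ \text{ and }\ i\sim j \text{ in } \bar\pi^{(k_i)}(v_i^\alpha t),$$ where $k_i$ is the label of the block of $\pi$ containing $i$ (blocks are labelled in increasing order of their least elements). An $\alpha$-ESSF is a process $X=(\Pi,\mathbf V)=(X(t))_{t\ge0}$ with values in $\mathcal M_\infty$ and càdlàg sample paths, with laws $\mathbb P_x$ ($x\in\mathcal M_\infty$, measurable in $x$) under which $X(0)=x$ a.s., that is strong Markov (with respect to its own filtration) and stochastically continuous, and such that 1. for every $x$ and every permutation $\sigma$ with finite support, $X^\sigma$ under $\mathbb P_x$ has the law of $X$ under $\mathbb P_{x^\sigma}$; 2. for every $x$, $X$ under $\mathbb P_x$ has the law of $\mathrm{ssFrag}_\alpha(x,X^{(\cdot)})$, where $X^{(\cdot)}$ is an i.i.d. sequence of copies of $X$ under $\mathbb P_{(\mathbf 1,1)}$. It is called non-degenerate if for every non-degenerate $x$, $\mathbb P_x$-a.s., $X(t)$ is non-degenerate for all $t\ge 0$. Put $V_i(\infty)=0$ and let $i\sim^{\Pi(\infty)}j$ if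 $i\sim^{\Pi(t)}j$ for all large $t$. With $B_i(t)$ the block of $\Pi(t)$ containing $i$, let $\mathcal G_i(t)=\sigma(B_i(s),V_i(s);\,0\le s\le t)$. A stopping line is a family $L=(L_i)_{i\ge1}$ of $[0,\infty]$-valued random variables such that each $L_i$ is a stopping time of $(\mathcal G_i(t))_{t\ge 0}$ and, $\mathbb P_x$-a.s. for every $x$, for all $i,j$, $i\sim^{\Pi(L_i)}j$ implies $L_i=L_j$. Then $X(L)$ is the marked partition in which $i$ and $j$ are in the same block iff $i\sim^{\Pi(L_i)}j$, and the mark of $i$ is $V_i(L_i)$. **Proposition.** Let $\alpha,\beta\in\mathbb R$, let $X=(\Pi,\mathbf V)$ be an $\alpha$-ESSF, and for $i\ge1$, $t\ge0$ let $$\tau_i^\beta(t)=\inf\Big\{u\ge0:\ \int_0^uV_i(s)^\beta\,ds=t\Big\},\qquad \inf\emptyset=\infty .$$ Then for each $t\ge0$, $\tau^\beta(t)=(\tau^\beta_i(t))_{i\ge1}$ is a stopping line, and the process $X\circ\tau^\beta:=(X(\tau^\beta(t)))_{t\ge0}$ is an $(\alpha-\beta)$-ESSF, up to indistinguishability: there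 is an $(\alpha-\beta)$-ESSF $Y$, defined on the same space with the same laws $(\mathbb P_x)$, such that for every $x$, $\mathbb P_x$-a.s., $Y(t)=X(\tau^\beta(t))$ for all $t\ge0$. Furthermore, if $X$ is non-degenerate, then so is $X\circ\tau^\beta$. -/

import Mathlib

open MeasureTheory ProbabilityTheory Filter Topology
open scoped NNReal ENNReal

noncomputable section

namespace ESSF

/-! ## Marks -/

/-- The space of marks: the half-line `[0, ∞)`, with its multiplication, where the topology is that
of the circle obtained from `[0, ∞]` by gluing `∞` to `0` (see the topology below). -/
@[ext]
structure Mark where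
  val : ℝ≥0

namespace Mark

instance : Zero Mark := ⟨⟨0⟩⟩

instance : One Mark := ⟨⟨1⟩⟩

instance : Mul Mark := ⟨fun v w => ⟨v.val * w.val⟩⟩

open Classical in
/-- The identification of the space of marks with the one-point compactification of `(0, ∞)`,
where the mark `0` is the point at infinity. -/
def toCircle (v : Mark) : OnePoint (Set.Ioi (0 : ℝ≥0)) :=
  if h : 0 < v.val then ((⟨v.val, h⟩ : Set.Ioi (0 : ℝ≥0)) : OnePoint (Set.Ioi (0 : ℝ≥0)))
  else OnePoint.infty

instance : TopologicalSpace Mark := TopologicalSpace.induced toCircle inferInstance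

instance : MeasurableSpace Mark := borel Mark

instance : BorelSpace Mark := ⟨rfl⟩

open Classical in
/-- The power `v ^ a` of a mark, with the convention `0 ^ a = 0` for every real `a`
(also for `a = 0`). -/
def pow (v : Mark) (a : ℝ) : ℝ≥0 := if v = 0 then 0 else v.val ^ a

end Mark

/-! ## Marked partitions -/

/-- A marked partition of the set of positive integers: a partition, given by its equivalence
relation, and a mark for each integer, such that marks are constant on blocks. The positive
integer `k` is represented by the natural number `k - 1`. -/
@[ext]
structure MarkPart where
  part : Setoid ℕ
  mark : ℕ → Mark
  mark_eq : ∀ {i j : ℕ}, part i j → mark i = mark j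

namespace MarkPart

open Classical in
/-- The relation (as a `0`-`1` matrix) and the marks of a marked partition. -/
def coords (x : MarkPart) : (ℕ → ℕ → Bool) × (ℕ → Mark) :=
  (fun i j => decide (x.part i j), x.mark)

/-- The product topology. -/
instance : TopologicalSpace MarkPart := TopologicalSpace.induced coords inferInstance

instance : MeasurableSpace MarkPart := borel MarkPart

instance : BorelSpace MarkPart := ⟨rfl⟩

/-- The block of `x` that contains `i`. -/
def block (x : MarkPart) (i : ℕ) : Set ℕ := {j | x.part i j}

/-- The marked partition with a single block, with mark `1`. -/
def one : MarkPart where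
  part := ⊤
  mark := fun _ => 1
  mark_eq := fun _ => rfl

/-- The action of a permutation of the integers. -/
def perm (x : MarkPart) (σ : Equiv.Perm ℕ) : MarkPart where
  part := Setoid.comap σ x.part
  mark := fun i => x.mark (σ i)
  mark_eq := fun h => x.mark_eq h

/-- A marked partition is non-degenerate if each of its finite blocks has mark `0`. -/
def NonDegenerate (x : MarkPart) : Prop := ∀ i, (x.block i).Finite → x.mark i = 0

/-- The least element of the block that contains `i`. -/
def blockMin (x : MarkPart) (i : ℕ) : ℕ := sInf (x.block i)

/-- The label of the block that contains `i`, when the blocks are listed in increasing order of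
their least elements (labels start from `0`): the number of blocks with a smaller least element. -/
def blockLabel (x : MarkPart) (i : ℕ) : ℕ :=
  {m : ℕ | m < x.blockMin i ∧ x.blockMin m = m}.ncard

theorem block_eq {x : MarkPart} {i j : ℕ} (h : x.part i j) : x.block i = x.block j := by
  ext k
  exact ⟨fun hk => x.part.trans' (x.part.symm' h) hk, fun hk => x.part.trans' h hk⟩

theorem blockLabel_eq {x : MarkPart} {i j : ℕ} (h : x.part i j) :
    x.blockLabel i = x.blockLabel j := by
  simp only [blockLabel, blockMin, block_eq h]

/-- The self-similar fragmentation operator with index `α`: the block of `x` with label `k`, with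
mark `v`, is fragmented by the map `f k` run at speed `v ^ α`, and its marks are multiplied by
`v`. -/
def ssFrag (α : ℝ) (x : MarkPart) (f : ℕ → ℝ≥0 → MarkPart) (t : ℝ≥0) : MarkPart where
  part :=
    { r := fun i j => x.part i j ∧ (f (x.blockLabel i) ((x.mark i).pow α * t)).part i j
      iseqv :=
        { refl := fun i => ⟨x.part.refl' i, Setoid.refl' _ i⟩
          symm := by
            rintro i j ⟨h, h'⟩
            rw [blockLabel_eq h, x.mark_eq h] at h'
            exact ⟨x.part.symm' h, Setoid.symm' _ h'⟩
          trans := by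
            rintro i j k ⟨h, h'⟩ ⟨g, g'⟩
            rw [← blockLabel_eq h, ← x.mark_eq h] at g'
            exact ⟨x.part.trans' h g, Setoid.trans' _ h' g'⟩ } }
  mark := fun i => x.mark i * (f (x.blockLabel i) ((x.mark i).pow α * t)).mark i
  mark_eq := by
    rintro i j ⟨h, h'⟩
    rw [MarkPart.mark_eq _ h', blockLabel_eq h, x.mark_eq h]

theorem isClopen_part (i j : ℕ) : IsClopen {x : MarkPart | x.part i j} := by
  classical
  have hc : Continuous coords := continuous_induced_dom
  have h : Continuous fun x : MarkPart => x.coords.1 i j :=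
    (continuous_apply j).comp ((continuous_apply i).comp (continuous_fst.comp hc))
  have e : {x : MarkPart | x.part i j} = (fun x : MarkPart => x.coords.1 i j) ⁻¹' {true} := by
    ext x
    simp [coords]
  rw [e]
  exact (isClopen_discrete _).preimage h

theorem measurable_block (i : ℕ) : Measurable fun x : MarkPart => x.block i :=
  measurable_set_iff.2 fun j => measurableSet_setOfPred.1 (isClopen_part i j).isOpen.measurableSet

theorem measurable_mark (i : ℕ) : Measurable fun x : MarkPart => x.mark i :=
  Continuous.measurable
    ((continuous_apply i).comp (continuous_snd.comp (continuous_induced_dom (f := coords))))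

/-! ## Paths -/

/-- Right-continuous paths with left limits. -/
def IsCadlag (w : ℝ≥0 → MarkPart) : Prop :=
  ∀ t, Tendsto w (𝓝[>] t) (𝓝 (w t)) ∧ ∃ l, Tendsto w (𝓝[<] t) (𝓝 l)

/-- The value of a path at a time in `[0, ∞]`. At time `∞` all marks are `0`, by convention, and
the partition is the limit of the partitions along the path: `i` and `j` are in the same block if
they are so at all large times. -/
def atTime (w : ℝ≥0 → MarkPart) : ℝ≥0∞ → MarkPart
  | some t => w t
  | none =>
    { part :=
        { r := fun i j => ∀ᶠ t in atTop, (w t).part i j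
          iseqv :=
            { refl := fun i => Eventually.of_forall fun t => (w t).part.refl' i
              symm := fun h => h.mono fun t ht => (w t).part.symm' ht
              trans := fun h g => (h.and g).mono fun t ht => (w t).part.trans' ht.1 ht.2 } }
      mark := fun _ => 0
      mark_eq := fun _ => rfl }

/-- The value `w(l)` of a path along a family of times `l`: the integer `i` is observed at time
`l i`. If `l` is such that `l i = l j` whenever `i` and `j` are in the same block at time `l i`,
then the condition `l i = l j` in the relation is redundant; it makes the definition meaningful for
all families of times. -/
def atLine (w : ℝ≥0 → MarkPart) (l : ℕ → ℝ≥0∞) : MarkPart where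
  part :=
    { r := fun i j => l i = l j ∧ (atTime w (l i)).part i j
      iseqv :=
        { refl := fun i => ⟨rfl, Setoid.refl' _ i⟩
          symm := by
            rintro i j ⟨h, h'⟩
            rw [h] at h'
            exact ⟨h.symm, Setoid.symm' _ h'⟩
          trans := by
            rintro i j k ⟨h, h'⟩ ⟨g, g'⟩
            rw [← h] at g'
            exact ⟨h.trans g, Setoid.trans' _ h' g'⟩ } }
  mark := fun i => (atTime w (l i)).mark i
  mark_eq := by
    rintro i j ⟨h, h'⟩
    rw [MarkPart.mark_eq _ h', h]

/-- The integral over `[0, u]` of the power `β` of the mark of `i` (possibly infinite). -/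
def clock (β : ℝ) (w : ℝ≥0 → MarkPart) (i : ℕ) (u : ℝ≥0) : ℝ≥0∞ :=
  ∫⁻ s in Set.Icc (0 : ℝ) u, (((w s.toNNReal).mark i).pow β : ℝ≥0∞)

/-- The inverse of the clock: the first time at which the clock equals `t`, and `∞` if there is no
such time. -/
def tau (β : ℝ) (w : ℝ≥0 → MarkPart) (t : ℝ≥0) (i : ℕ) : ℝ≥0∞ :=
  sInf {r : ℝ≥0∞ | ∃ u : ℝ≥0, r = u ∧ clock β w i u = t}

/-- The time-changed path `w ∘ τ`. -/
def timeChange (β : ℝ) (w : ℝ≥0 → MarkPart) (t : ℝ≥0) : MarkPart := atLine w (tau β w t)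

end MarkPart

/-! ## Processes

A process with values in the space of marked partitions is a family `X` of random variables on a
measurable space `Ω`; the law on `Ω` under which it starts from `x` is `P x`. -/

open MarkPart

variable {Ω : Type*} [mΩ : MeasurableSpace Ω]

/-- The filtration generated by a process. -/
def history {E : Type*} [mE : MeasurableSpace E] (Z : ℝ≥0 → Ω → E)
    (hZ : ∀ t, Measurable (Z t)) : Filtration ℝ≥0 mΩ where
  seq t := ⨆ s ≤ t, MeasurableSpace.comap (Z s) mE
  mono' _ _ hst := biSup_mono fun _ hr => hr.trans hst
  le' _ := iSup₂_le fun s _ => (hZ s).comap_le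

/-- The filtration generated by the block that contains `i` and its mark. -/
def blockHistory (X : ℝ≥0 → Ω → MarkPart) (hX : ∀ t, Measurable (X t)) (i : ℕ) :
    Filtration ℝ≥0 mΩ :=
  history (fun t ω => ((X t ω).block i, (X t ω).mark i)) fun t =>
    ((measurable_block i).comp (hX t)).prodMk ((measurable_mark i).comp (hX t))

/-- Stopping lines. The second condition is almost sure, whatever the initial state. -/
structure IsStoppingLine (P : Kernel MarkPart Ω) (X : ℝ≥0 → Ω → MarkPart)
    (hX : ∀ t, Measurable (X t)) (L : ℕ → Ω → ℝ≥0∞) : Prop where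
  isStoppingTime : ∀ i, IsStoppingTime (blockHistory X hX i) (L i)
  compatible : ∀ x, ∀ᵐ ω ∂(P x), ∀ i j,
    (atTime (fun t => X t ω) (L i ω)).part i j → L i ω = L j ω

/-- The law of the process started from `x`, on the space of paths with its product
σ-algebra. -/
def pathLaw (P : Kernel MarkPart Ω) (X : ℝ≥0 → Ω → MarkPart) (x : MarkPart) :
    Measure (ℝ≥0 → MarkPart) :=
  (P x).map fun ω t => X t ω

/-- The strong Markov property, with respect to the filtration of the process: for each stopping
time `T`, conditionally on the past of `T` and on the event `T < ∞`, the process shifted by `T` has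
the law of the process started from `X T`. -/
def IsStrongMarkov (P : Kernel MarkPart Ω) (X : ℝ≥0 → Ω → MarkPart)
    (hX : ∀ t, Measurable (X t)) : Prop :=
  ∀ (T : Ω → WithTop ℝ≥0) (hT : IsStoppingTime (history X hX) T) (x : MarkPart) (A : Set Ω)
    (B : Set (ℝ≥0 → MarkPart)), MeasurableSet[hT.measurableSpace] A → (∀ ω ∈ A, T ω ≠ ⊤) →
    MeasurableSet B →
    P x (A ∩ {ω | (fun s => X ((T ω).untopD 0 + s) ω) ∈ B}) =
      ∫⁻ ω in A, pathLaw P X (X ((T ω).untopD 0) ω) B ∂(P x)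

/-- Stochastic continuity: for each `t`, `X s` converges to `X t` in probability as `s → t`. The
space of marked partitions is compact, so its uniformity consists of the neighbourhoods of the
diagonal. -/
def IsStochasticallyContinuous (P : Kernel MarkPart Ω) (X : ℝ≥0 → Ω → MarkPart) : Prop :=
  ∀ x t, ∀ U ∈ 𝓝ˢ (Set.diagonal MarkPart),
    Tendsto (fun s => P x {ω | (X s ω, X t ω) ∉ U}) (𝓝 t) (𝓝 0)

/-- Extended self-similar fragmentation processes with index `α` (`α`-ESSF). -/
structure IsESSF (α : ℝ) (P : Kernel MarkPart Ω) (X : ℝ≥0 → Ω → MarkPart) : Prop where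
  measurable : ∀ t, Measurable (X t)
  cadlag : ∀ ω, IsCadlag fun t => X t ω
  start : ∀ x, ∀ᵐ ω ∂(P x), X 0 ω = x
  strongMarkov : IsStrongMarkov P X measurable
  stochasticallyContinuous : IsStochasticallyContinuous P X
  exchangeable : ∀ σ : Equiv.Perm ℕ, {n | σ n ≠ n}.Finite → ∀ x,
    ((P x).map fun ω t => (X t ω).perm σ) = pathLaw P X (x.perm σ)
  branching : ∀ x,
    pathLaw P X x = (Measure.infinitePi fun _ : ℕ => pathLaw P X one).map (ssFrag α x)

/-- Started from a non-degenerate state, the process almost surely stays in the space of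
non-degenerate marked partitions. -/
def IsNonDegenerate (P : Kernel MarkPart Ω) (X : ℝ≥0 → Ω → MarkPart) : Prop :=
  ∀ x : MarkPart, x.NonDegenerate → ∀ᵐ ω ∂(P x), ∀ t, (X t ω).NonDegenerate

end ESSF

end

/-! The branching property of the time change is a pathwise identity. A block with mark `v` runs at
speed `v ^ α`, so its clock is `v ^ (β - α)` times the clock of the underlying copy, and the time
change turns `ssFrag α` into `ssFrag (α - β)` (`timeChange_ssFrag`). It also commutes with
permutations. The work lies in the sample paths, the Markov property and stochastic continuity.

Sample paths. Almost every path is `Good`: partitions refine, a mark that has come arbitrarily close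
to `0` by some time is `0` at that time and later, blocks with mark `0` do not split, and a mark
whose clock stays bounded tends to `0`. Scaling gives the two delicate facts. A mark that came back
from `0` would require arbitrarily large relative jumps of a copy started from `one`
(`ae_mark_death`). A mark that keeps returning far from `0` with almost no clock left would require
an arbitrarily small total clock for such a copy (`ae_vanish`). On good paths the time change is
explicit (`timeChange_of_live`, `timeChange_of_not_live`) and càdlàg.

Markov property. A fixed time of the time change is not one stopping time of `X`, because each block
has its own clock. Restrict to a finite set `J` of integers and argue by induction on its
cardinality. As long as `J` is not separated its elements share one clock. The strong Markov
property of `X`, at the first time when `J` splits or this clock reaches `t`, therefore reduces the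
question to states that separate `J`. From such a state the separated parts evolve independently,
and each is smaller (`resMarkov_of_split`, `ResMarkov.union`, `resMarkov`).

Stochastic continuity. Marks are continuous at fixed times by the Markov property and scaling
(`ae_tendsto_mark`). For partitions, the time at which `J` splits must have no atom. An atom of
maximal mass forces the mark before it to be a deterministic function of time. Undoing the time
change with the power `-β` then produces a deterministic time at which `X` itself splits with
positive probability, against its stochastic continuity (`timeChange_measure_splitTime`).

Finally, the strong Markov property follows from the Markov property by approximating stopping times
from the right (`strongMarkov_of_markov`). This uses continuity of the law in the initial state,
along sequences in which the marks that vanish in the limit already vanish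
(`BranchLaw.tendsto_lintegral`). -/

noncomputable section

namespace ESSF

/-! ### The circle of marks: algebra, topology and measurability. -/

namespace Mark

@[simp] theorem val_zero : (0 : Mark).val = 0 := rfl

@[simp] theorem val_one : (1 : Mark).val = 1 := rfl

@[simp] theorem val_mul (v w : Mark) : (v * w).val = v.val * w.val := rfl

theorem val_eq_zero {v : Mark} : v.val = 0 ↔ v = 0 :=
  ⟨fun h => Mark.ext h, fun h => h ▸ rfl⟩

theorem val_pos {v : Mark} (h : v ≠ 0) : 0 < v.val :=
  pos_iff_ne_zero.2 fun h' => h (val_eq_zero.1 h')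

theorem mul_eq_zero {v w : Mark} : v * w = 0 ↔ v = 0 ∨ w = 0 := by
  simp [← val_eq_zero]

theorem one_ne_zero : (1 : Mark) ≠ 0 := fun h => _root_.one_ne_zero (val_eq_zero.2 h)

theorem zero_mul (v : Mark) : 0 * v = 0 := mul_eq_zero.2 (Or.inl rfl)

theorem pow_zero_left (a : ℝ) : (0 : Mark).pow a = 0 := if_pos rfl

theorem pow_of_ne {v : Mark} (h : v ≠ 0) (a : ℝ) : v.pow a = v.val ^ a := if_neg h

theorem pow_pos {v : Mark} (h : v ≠ 0) (a : ℝ) : 0 < v.pow a := by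
  rw [pow_of_ne h]
  exact NNReal.rpow_pos (val_pos h)

theorem pow_mul (v w : Mark) (a : ℝ) : (v * w).pow a = v.pow a * w.pow a := by
  by_cases hv : v = 0
  · simp [hv, zero_mul, pow_zero_left]
  by_cases hw : w = 0
  · have : v * w = 0 := mul_eq_zero.2 (Or.inr hw)
    rw [this, hw, pow_zero_left, MulZeroClass.mul_zero]
  have : v * w ≠ 0 := fun h => (mul_eq_zero.1 h).elim hv hw
  rw [pow_of_ne hv, pow_of_ne hw, pow_of_ne this, val_mul, NNReal.mul_rpow]

theorem pow_add {v : Mark} (a b : ℝ) : v.pow (a + b) = v.pow a * v.pow b := by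
  by_cases hv : v = 0
  · simp [hv, pow_zero_left]
  · rw [pow_of_ne hv, pow_of_ne hv, pow_of_ne hv, NNReal.rpow_add (val_pos hv).ne']

/-- The distance of a mark to `0` on the circle: the minimum of the mark and its inverse. -/
def size (v : Mark) : ℝ≥0 := min v.val v.val⁻¹

@[simp] theorem size_zero : (0 : Mark).size = 0 := by simp [size]

theorem size_eq_zero {v : Mark} : v.size = 0 ↔ v = 0 := by
  refine ⟨fun h => ?_, fun h => h ▸ size_zero⟩
  rcases min_choice v.val v.val⁻¹ with h' | h' <;> rw [size, h'] at h
  · exact val_eq_zero.1 h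
  · exact val_eq_zero.1 (inv_eq_zero.1 h)

theorem size_pos {v : Mark} (h : v ≠ 0) : 0 < v.size :=
  pos_iff_ne_zero.2 fun h' => h (size_eq_zero.1 h')

theorem size_le_val (v : Mark) : v.size ≤ v.val := min_le_left _ _

theorem size_le_inv (v : Mark) : v.size ≤ v.val⁻¹ := min_le_right _ _

theorem val_le_inv_size (v : Mark) : v.val ≤ v.size⁻¹ := by
  by_cases h : v = 0
  · simp [h]
  · exact (le_inv_comm₀ (size_pos h) (val_pos h)).1 (size_le_inv v)

theorem size_one : (1 : Mark).size = 1 := by simp [size]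

theorem size_mul_le (v w : Mark) : v.size * w.size ≤ (v * w).size := by
  by_cases hw : w = 0
  · simp [hw]
  refine le_min ?_ ?_
  · exact mul_le_mul' (size_le_val v) (size_le_val w)
  · rw [val_mul, mul_inv]
    exact mul_le_mul' (size_le_inv v) (size_le_inv w)

/-- The size of a factor is controlled by the sizes of the other factor and of the product. -/
theorem size_mul_size_le (v w : Mark) : (v * w).size * w.size ≤ v.size := by
  by_cases hw : w = 0
  · simp [hw]
  refine le_min ?_ ?_
  · calc (v * w).size * w.size ≤ (v * w).val * w.val⁻¹ :=
        mul_le_mul' (size_le_val _) (size_le_inv w)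
      _ = v.val := by rw [val_mul, mul_assoc, mul_inv_cancel₀ (val_pos hw).ne', mul_one]
  · calc (v * w).size * w.size ≤ (v * w).val⁻¹ * w.val :=
        mul_le_mul' (size_le_inv _) (size_le_val w)
      _ = v.val⁻¹ := by
        rw [val_mul, mul_inv, mul_assoc, inv_mul_cancel₀ (val_pos hw).ne', mul_one]

/-- An embedding of the circle of marks into the plane. -/
def planar (v : Mark) : ℝ≥0 × ℝ≥0 := (v.size, v.val * v.size ^ 2)

/-- The second coordinate of `planar` is chosen so that `val` is recovered by a division. This gives
injectivity, and also the measurability of `val`, which is not continuous at the mark `0`. -/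
theorem val_eq_div (v : Mark) : v.val = v.planar.2 / v.planar.1 ^ 2 := by
  by_cases h : v = 0
  · simp [h, planar]
  · have := (size_pos h).ne'
    simp only [planar]
    field_simp

theorem planar_injective : Function.Injective planar := fun v w h =>
  Mark.ext (by rw [val_eq_div, val_eq_div w, h])

theorem planar_snd_le (v : Mark) : v.planar.2 ≤ v.size := by
  by_cases h : v = 0
  · simp [h, planar]
  calc v.val * v.size ^ 2 = (v.val * v.size) * v.size := by ring
    _ ≤ (v.val * v.val⁻¹) * v.size := by gcongr; exact size_le_inv v
    _ = v.size := by rw [mul_inv_cancel₀ (val_pos h).ne', _root_.one_mul]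

theorem toCircle_of_ne {v : Mark} (h : v ≠ 0) :
    v.toCircle = ((⟨v.val, val_pos h⟩ : Set.Ioi (0 : ℝ≥0)) : OnePoint (Set.Ioi (0 : ℝ≥0))) :=
  dif_pos (val_pos h)

theorem toCircle_zero : (0 : Mark).toCircle = OnePoint.infty := dif_neg (lt_irrefl _)

theorem toCircle_bijective : Function.Bijective toCircle := by
  constructor
  · intro v w h
    by_cases hv : v = 0 <;> by_cases hw : w = 0
    · rw [hv, hw]
    · rw [hv, toCircle_zero, toCircle_of_ne hw] at h
      exact absurd h (OnePoint.infty_ne_coe _)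
    · rw [hw, toCircle_zero, toCircle_of_ne hv] at h
      exact absurd h (OnePoint.coe_ne_infty _)
    · rw [toCircle_of_ne hv, toCircle_of_ne hw, OnePoint.coe_eq_coe] at h
      exact Mark.ext (congrArg Subtype.val h)
  · intro c
    induction c using OnePoint.rec with
    | infty => exact ⟨0, toCircle_zero⟩
    | coe r =>
      have : (⟨r.1⟩ : Mark) ≠ 0 := fun h => (ne_of_gt r.2) (congrArg Mark.val h)
      exact ⟨⟨r.1⟩, toCircle_of_ne this⟩

/-- The space of marks is homeomorphic to the one-point compactification of `(0, ∞)`. -/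
def circleHomeo : Mark ≃ₜ OnePoint (Set.Ioi (0 : ℝ≥0)) :=
  (Equiv.ofBijective _ toCircle_bijective).toHomeomorphOfIsInducing ⟨rfl⟩

instance : CompactSpace Mark := circleHomeo.symm.compactSpace

/-- Only the point at infinity needs an argument. The marks with `a ≤ size` form the compact
interval from `a` to `a⁻¹` in `(0, ∞)`, so `size` tends to `0` at infinity, and `planar_snd_le`
makes the other coordinate follow. -/
theorem continuous_planar : Continuous planar := by
  have key : Continuous fun c => planar (circleHomeo.symm c) := by
    have hcoe : ∀ r : Set.Ioi (0 : ℝ≥0), circleHomeo.symm r = ⟨r.1⟩ := fun r => by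
      rw [Homeomorph.symm_apply_eq]
      exact (toCircle_of_ne (v := ⟨r.1⟩) fun h => (ne_of_gt r.2) (congrArg Mark.val h)).symm
    have hinf : circleHomeo.symm OnePoint.infty = 0 := by
      rw [Homeomorph.symm_apply_eq]
      exact toCircle_zero.symm
    have hs : Continuous fun r : Set.Ioi (0 : ℝ≥0) => (⟨r.1⟩ : Mark).size :=
      continuous_subtype_val.min (continuous_subtype_val.inv₀ fun r => (ne_of_gt r.2))
    rw [OnePoint.continuous_iff]
    simp only [hcoe, hinf]
    constructor
    · have h0 : Tendsto (fun r : Set.Ioi (0 : ℝ≥0) => (⟨r.1⟩ : Mark).size)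
          (coclosedCompact _) (𝓝 0) := by
        refine tendsto_order.2 ⟨fun a ha => absurd ha not_lt_zero, fun a ha => ?_⟩
        refine Filter.hasBasis_coclosedCompact.mem_iff.2 ⟨{r | a ≤ (⟨r.1⟩ : Mark).size},
          ⟨isClosed_le continuous_const hs, ?_⟩, fun r hr => by simpa using hr⟩
        rw [Subtype.isCompact_iff]
        refine (isCompact_Icc (a := a) (b := a⁻¹)).of_isClosed_subset ?_ ?_
        · have : (Subtype.val '' {r : Set.Ioi (0 : ℝ≥0) | a ≤ (⟨r.1⟩ : Mark).size}) =
              Set.Icc a a⁻¹ := by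
            ext v
            constructor
            · rintro ⟨r, hr, rfl⟩
              exact ⟨le_trans hr (size_le_val _), (le_inv_comm₀ ha r.2).1
                (le_trans hr (size_le_inv _))⟩
            · rintro ⟨h1, h2⟩
              exact ⟨⟨v, ha.trans_le h1⟩, le_min h1 ((le_inv_comm₀ (ha.trans_le h1) ha).1 h2), rfl⟩
          rw [this]
          exact isClosed_Icc
        · rintro _ ⟨r, hr, rfl⟩
          exact ⟨le_trans hr (size_le_val _), (le_inv_comm₀ ha r.2).1
            (le_trans hr (size_le_inv _))⟩
      have : planar 0 = (0, 0) := by simp [planar]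
      rw [this]
      exact h0.prodMk_nhds (tendsto_of_tendsto_of_tendsto_of_le_of_le tendsto_const_nhds h0
        (fun _ => zero_le) fun r => planar_snd_le _)
    · exact hs.prodMk (continuous_subtype_val.mul (hs.pow 2))
  have := key.comp circleHomeo.continuous
  simpa [Function.comp_def] using this

/-- A continuous injection of a compact space into a Hausdorff one. The Hausdorff property and
second countability of `Mark` are inherited from the plane. -/
theorem isClosedEmbedding_planar : IsClosedEmbedding planar :=
  continuous_planar.isClosedEmbedding planar_injective

instance : T2Space Mark := isClosedEmbedding_planar.isEmbedding.t2Space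

instance : SecondCountableTopology Mark :=
  isClosedEmbedding_planar.isEmbedding.secondCountableTopology

theorem continuous_size : Continuous size := continuous_fst.comp continuous_planar

theorem continuous_mk : Continuous Mark.mk := by
  rw [isClosedEmbedding_planar.isEmbedding.continuous_iff]
  have hs : Continuous fun r : ℝ≥0 => (⟨r⟩ : Mark).size := by
    rw [continuous_iff_continuousAt]
    intro r
    by_cases hr : r = 0
    · subst hr
      have h0 : (⟨0⟩ : Mark).size = 0 := size_zero
      rw [ContinuousAt, h0]
      exact tendsto_of_tendsto_of_tendsto_of_le_of_le tendsto_const_nhds tendsto_id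
        (fun _ => zero_le) fun r => size_le_val ⟨r⟩
    · exact continuousAt_id.min (continuousAt_id.inv₀ hr)
  exact hs.prodMk (continuous_id.mul (hs.pow 2))

theorem measurable_size : Measurable size := continuous_size.measurable

theorem measurable_val : Measurable Mark.val := by
  have : Mark.val = fun v => v.planar.2 / v.planar.1 ^ 2 := funext val_eq_div
  rw [this]
  exact (continuous_planar.measurable.snd).div (continuous_planar.measurable.fst.pow_const 2)

theorem measurable_pow (a : ℝ) : Measurable fun v : Mark => v.pow a := by
  classical
  have : (fun v : Mark => v.pow a) = fun v => if v = 0 then 0 else v.val ^ a := by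
    ext v; simp only [pow]
  rw [this]
  exact Measurable.ite (measurableSet_singleton 0) measurable_const (measurable_val.pow_const a)

/-- Away from `0` the circle has the topology of the half-line. At `0`, where values tending to `0`
and values tending to `∞` are identified, convergence is read off `size` in `tendsto_zero_iff`. -/
theorem tendsto_iff_of_ne {ι : Type*} {l : Filter ι} {u : ι → Mark} {v : Mark} (hv : v ≠ 0) :
    Tendsto u l (𝓝 v) ↔ Tendsto (fun i => (u i).val) l (𝓝 v.val) := by
  constructor
  · intro h
    have h1 := (continuous_planar.tendsto v).comp h
    have h2 : Tendsto (fun i => (planar (u i)).2 / (planar (u i)).1 ^ 2) l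
        (𝓝 (v.planar.2 / v.planar.1 ^ 2)) :=
      ((continuous_snd.tendsto _).comp h1).div (((continuous_fst.tendsto _).comp h1).pow 2)
        (pow_ne_zero 2 (size_pos hv).ne')
    simpa only [← val_eq_div] using h2
  · exact fun h => (continuous_mk.tendsto v.val).comp h

theorem tendsto_zero_iff {ι : Type*} {l : Filter ι} {u : ι → Mark} :
    Tendsto u l (𝓝 0) ↔ Tendsto (fun i => (u i).size) l (𝓝 0) := by
  constructor
  · intro h
    have := (continuous_size.tendsto 0).comp h
    rwa [size_zero] at this
  · intro h
    rw [isClosedEmbedding_planar.isEmbedding.tendsto_nhds_iff]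
    have : planar 0 = (0, 0) := by simp [planar]
    rw [this]
    exact h.prodMk_nhds (tendsto_of_tendsto_of_tendsto_of_le_of_le tendsto_const_nhds h
      (fun _ => zero_le) fun i => planar_snd_le _)

/-- Multiplication is not jointly continuous at `(0, 0)`, since one factor may have values tending
to `∞`. With one factor fixed, `size_mul_size_le` bounds the size of the product by `c.size⁻¹ *
v.size`. -/
theorem continuous_const_mul (c : Mark) : Continuous fun v : Mark => c * v := by
  by_cases hc : c = 0
  · simp only [hc, zero_mul]
    exact continuous_const
  rw [continuous_iff_continuousAt]
  intro v
  by_cases hv : v = 0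
  · subst hv
    have h0 : c * 0 = 0 := mul_eq_zero.2 (Or.inr rfl)
    rw [ContinuousAt, h0, tendsto_zero_iff]
    have h1 : Tendsto (fun v : Mark => c.size⁻¹ * v.size) (𝓝 0) (𝓝 0) := by
      have := (continuous_size.tendsto 0).const_mul c.size⁻¹
      simpa using this
    refine tendsto_of_tendsto_of_tendsto_of_le_of_le tendsto_const_nhds h1
      (fun _ => zero_le) fun v => ?_
    have := size_mul_size_le v c
    have e : v * c = c * v := Mark.ext (mul_comm _ _)
    rw [e] at this
    exact (le_inv_mul_iff₀ (size_pos hc)).2 (by rwa [mul_comm])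
  · have hcv : c * v ≠ 0 := fun h => (mul_eq_zero.1 h).elim hc hv
    rw [ContinuousAt, tendsto_iff_of_ne hcv]
    exact ((tendsto_iff_of_ne hv).1 tendsto_id).const_mul c.val

/-- Multiplication of marks is jointly continuous away from a zero first factor. -/
theorem tendsto_mul {ι : Type*} {l : Filter ι} {u w : ι → Mark} {a b : Mark} (ha : a ≠ 0)
    (hu : Tendsto u l (𝓝 a)) (hw : Tendsto w l (𝓝 b)) :
    Tendsto (fun i => u i * w i) l (𝓝 (a * b)) := by
  have hne : ∀ᶠ i in l, u i ≠ 0 := hu.eventually_ne ha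
  by_cases hb : b = 0
  · subst hb
    rw [mul_eq_zero.2 (Or.inr rfl), tendsto_zero_iff]
    have h1 : Tendsto (fun i => (u i).size⁻¹ * (w i).size) l (𝓝 0) := by
      have := (((continuous_size.tendsto a).comp hu).inv₀ (size_pos ha).ne').mul
        (tendsto_zero_iff.1 hw)
      simpa using this
    refine tendsto_of_tendsto_of_tendsto_of_le_of_le' tendsto_const_nhds h1
      (Eventually.of_forall fun _ => zero_le) (hne.mono fun i hi => ?_)
    have := size_mul_size_le (w i) (u i)
    have e : w i * u i = u i * w i := Mark.ext (mul_comm _ _)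
    rw [e] at this
    exact (le_inv_mul_iff₀ (size_pos hi)).2 (by rwa [mul_comm])
  · have hab : a * b ≠ 0 := fun h => (mul_eq_zero.1 h).elim ha hb
    rw [tendsto_iff_of_ne hab]
    exact ((tendsto_iff_of_ne ha).1 hu).mul ((tendsto_iff_of_ne hb).1 hw)

theorem measurable_const_mul (c : Mark) : Measurable fun v : Mark => c * v :=
  (continuous_const_mul c).measurable

end Mark

/-! ### Convergence and measurability of marked partitions, coordinate by coordinate. -/

namespace MarkPart

theorem coords_injective : Function.Injective coords := by
  intro x y h
  have h1 : ∀ i j, (x.part i j ↔ y.part i j) := fun i j => by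
    have := congrFun (congrFun (congrArg Prod.fst h) i) j
    simpa [coords] using this
  refine MarkPart.ext (Setoid.ext fun i j => h1 i j) (congrArg Prod.snd h)

theorem isEmbedding_coords : IsEmbedding coords := ⟨⟨rfl⟩, coords_injective⟩

instance : T2Space MarkPart := isEmbedding_coords.t2Space

instance : SecondCountableTopology MarkPart := isEmbedding_coords.secondCountableTopology

instance : TopologicalSpace.MetrizableSpace MarkPart := isEmbedding_coords.metrizableSpace

theorem tendsto_iff {ι : Type*} {l : Filter ι} {u : ι → MarkPart} {x : MarkPart} :
    Tendsto u l (𝓝 x) ↔ (∀ i j, ∀ᶠ k in l, ((u k).part i j ↔ x.part i j)) ∧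
      ∀ i, Tendsto (fun k => (u k).mark i) l (𝓝 (x.mark i)) := by
  classical
  rw [isEmbedding_coords.tendsto_nhds_iff, nhds_prod_eq, tendsto_prod_iff']
  simp only [tendsto_pi_nhds, coords, Function.comp_def, nhds_discrete, tendsto_pure,
    decide_eq_decide]

/-- A family of marked partitions converges as soon as its coordinates do. -/
theorem exists_tendsto {ι : Type*} {l : Filter ι} [l.NeBot] {u : ι → MarkPart}
    (h1 : ∀ i j, (∀ᶠ k in l, (u k).part i j) ∨ ∀ᶠ k in l, ¬(u k).part i j)
    (h2 : ∀ i, ∃ v, Tendsto (fun k => (u k).mark i) l (𝓝 v)) : ∃ x, Tendsto u l (𝓝 x) := by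
  choose v hv using h2
  let x : MarkPart :=
    { part :=
        { r := fun i j => ∀ᶠ k in l, (u k).part i j
          iseqv :=
            { refl := fun i => Eventually.of_forall fun k => (u k).part.refl' i
              symm := fun h => h.mono fun k hk => (u k).part.symm' hk
              trans := fun h g => (h.and g).mono fun k hk => (u k).part.trans' hk.1 hk.2 } }
      mark := v
      mark_eq := fun {i j} h => tendsto_nhds_unique_of_eventuallyEq (hv i) (hv j)
        (h.mono fun k hk => (u k).mark_eq hk) }
  refine ⟨x, tendsto_iff.2 ⟨fun i j => ?_, hv⟩⟩
  rcases h1 i j with h | h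
  · have hx : x.part i j := h
    exact h.mono fun k hk => iff_of_true hk hx
  · have hx : ¬x.part i j := fun hx => by
      have hx' : ∀ᶠ k in l, (u k).part i j := hx
      obtain ⟨k, hk⟩ := (h.and hx').exists
      exact hk.1 hk.2
    exact h.mono fun k hk => iff_of_false hk hx

theorem measurableSet_part (i j : ℕ) : MeasurableSet {x : MarkPart | x.part i j} :=
  (isClopen_part i j).isOpen.measurableSet

theorem measurable_iff {S : Type*} [MeasurableSpace S] {f : S → MarkPart} :
    Measurable f ↔ (∀ i j, MeasurableSet {s | (f s).part i j}) ∧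
      ∀ i, Measurable fun s => (f s).mark i := by
  classical
  refine ⟨fun h => ⟨fun i j => h (measurableSet_part i j), fun i => (measurable_mark i).comp h⟩,
    fun ⟨h1, h2⟩ => ?_⟩
  have hc : Measurable fun s => coords (f s) := by
    refine Measurable.prodMk ?_ (measurable_pi_iff.2 h2)
    refine measurable_pi_iff.2 fun i => measurable_pi_iff.2 fun j => ?_
    exact measurable_to_bool (by simpa [Set.preimage, coords] using h1 i j)
  refine measurable_of_isOpen fun s hs => ?_
  obtain ⟨t, ht, rfl⟩ := isOpen_induced_iff.1 hs
  exact hc ht.measurableSet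

end MarkPart

open MarkPart

/-! ## Path space -/

namespace MarkPart

theorem IsCadlag.tendsto_ge {w : ℝ≥0 → MarkPart} (hw : IsCadlag w) (t : ℝ≥0) :
    Tendsto w (𝓝[≥] t) (𝓝 (w t)) := by
  have : 𝓝[≥] t = 𝓝[>] t ⊔ pure t := by
    rw [← Set.Ioi_union_left, nhdsWithin_union, nhdsWithin_singleton]
  rw [this]
  exact (hw t).1.sup (tendsto_pure_nhds w t)

theorem IsCadlag.eventually_part {w : ℝ≥0 → MarkPart} (hw : IsCadlag w) (t : ℝ≥0) (i j : ℕ) :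
    ∀ᶠ s in 𝓝[≥] t, ((w s).part i j ↔ (w t).part i j) :=
  (MarkPart.tendsto_iff.1 (hw.tendsto_ge t)).1 i j

theorem IsCadlag.tendsto_mark {w : ℝ≥0 → MarkPart} (hw : IsCadlag w) (t : ℝ≥0) (i : ℕ) :
    Tendsto (fun s => (w s).mark i) (𝓝[≥] t) (𝓝 ((w t).mark i)) :=
  (MarkPart.tendsto_iff.1 (hw.tendsto_ge t)).2 i

theorem IsCadlag.eventually_left {w : ℝ≥0 → MarkPart} (hw : IsCadlag w) (t : ℝ≥0) (i j : ℕ) :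
    (∀ᶠ s in 𝓝[<] t, (w s).part i j) ∨ ∀ᶠ s in 𝓝[<] t, ¬(w s).part i j := by
  obtain ⟨l, hl⟩ := (hw t).2
  have := (MarkPart.tendsto_iff.1 hl).1 i j
  by_cases h : l.part i j
  · exact Or.inl (this.mono fun s hs => hs.2 h)
  · exact Or.inr (this.mono fun s hs hs' => h (hs.1 hs'))

theorem IsCadlag.exists_left_mark {w : ℝ≥0 → MarkPart} (hw : IsCadlag w) (t : ℝ≥0) (i : ℕ) :
    ∃ v, Tendsto (fun s => (w s).mark i) (𝓝[<] t) (𝓝 v) := by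
  obtain ⟨l, hl⟩ := (hw t).2
  exact ⟨_, (MarkPart.tendsto_iff.1 hl).2 i⟩

theorem isCadlag_of_coords {w : ℝ≥0 → MarkPart}
    (h1 : ∀ t i j, ∀ᶠ s in 𝓝[>] t, ((w s).part i j ↔ (w t).part i j))
    (h2 : ∀ t i, Tendsto (fun s => (w s).mark i) (𝓝[>] t) (𝓝 ((w t).mark i)))
    (h3 : ∀ t i j, (∀ᶠ s in 𝓝[<] t, (w s).part i j) ∨ ∀ᶠ s in 𝓝[<] t, ¬(w s).part i j)
    (h4 : ∀ t i, ∃ v, Tendsto (fun s => (w s).mark i) (𝓝[<] t) (𝓝 v)) : IsCadlag w := by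
  intro t
  refine ⟨MarkPart.tendsto_iff.2 ⟨h1 t, h2 t⟩, ?_⟩
  rcases (𝓝[<] t).eq_or_neBot with h | h
  · exact ⟨w t, by simp [h]⟩
  · exact exists_tendsto (h3 t) (h4 t)

theorem isCadlag_const (x : MarkPart) : IsCadlag fun _ => x := fun _ =>
  ⟨tendsto_const_nhds, x, tendsto_const_nhds⟩

theorem IsCadlag.comp_mono {w : ℝ≥0 → MarkPart} (hw : IsCadlag w) {g : ℝ≥0 → ℝ≥0}
    (hg : Continuous g) (hm : StrictMono g) : IsCadlag fun t => w (g t) := by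
  intro t
  refine ⟨(hw (g t)).1.comp ?_, ?_⟩
  · exact tendsto_nhdsWithin_iff.2 ⟨(hg.tendsto t).mono_left nhdsWithin_le_nhds,
      eventually_nhdsWithin_of_forall fun s hs => hm hs⟩
  · obtain ⟨l, hl⟩ := (hw (g t)).2
    exact ⟨l, hl.comp (tendsto_nhdsWithin_iff.2
      ⟨(hg.tendsto t).mono_left nhdsWithin_le_nhds,
        eventually_nhdsWithin_of_forall fun s hs => hm hs⟩)⟩

theorem IsCadlag.shift {w : ℝ≥0 → MarkPart} (hw : IsCadlag w) (s : ℝ≥0) :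
    IsCadlag fun t => w (s + t) :=
  hw.comp_mono (continuous_const.add continuous_id) fun _ _ h => by simpa using h

theorem IsCadlag.stopAt {w : ℝ≥0 → MarkPart} (hw : IsCadlag w) (s : ℝ≥0) :
    IsCadlag fun t => w (min t s) := by
  intro t
  rcases lt_or_ge t s with h | h
  · constructor
    · have : ∀ᶠ r in 𝓝[>] t, w (min r s) = w r :=
        nhdsWithin_le_nhds ((eventually_lt_nhds h).mono fun r hr => by rw [min_eq_left hr.le])
      simp only [min_eq_left h.le]
      exact (tendsto_congr' this).2 (hw t).1
    · obtain ⟨l, hl⟩ := (hw t).2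
      have : ∀ᶠ r in 𝓝[<] t, w (min r s) = w r :=
        eventually_nhdsWithin_of_forall fun r hr => by rw [min_eq_left (hr.trans h).le]
      exact ⟨l, (tendsto_congr' this).2 hl⟩
  · constructor
    · have : ∀ᶠ r in 𝓝[>] t, w (min r s) = w s :=
        eventually_nhdsWithin_of_forall fun r hr => by rw [min_eq_right (h.trans hr.le)]
      simp only [min_eq_right h]
      exact (tendsto_congr' this).2 tendsto_const_nhds
    · rcases h.eq_or_lt with h | h
      · subst h
        obtain ⟨l, hl⟩ := (hw s).2
        have : ∀ᶠ r in 𝓝[<] s, w (min r s) = w r :=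
          eventually_nhdsWithin_of_forall fun r hr => by rw [min_eq_left (le_of_lt hr)]
        exact ⟨l, (tendsto_congr' this).2 hl⟩
      · have : ∀ᶠ r in 𝓝[<] t, w (min r s) = w s :=
          nhdsWithin_le_nhds ((eventually_gt_nhds h).mono fun r hr => by rw [min_eq_right hr.le])
        exact ⟨w s, (tendsto_congr' this).2 tendsto_const_nhds⟩

/-- The inner time `v ^ α * t` is constant in `t` when `v = 0` and strictly increasing otherwise; in
both cases one-sided limits are preserved. -/
theorem IsCadlag.ssFrag (α : ℝ) (x : MarkPart) {f : ℕ → ℝ≥0 → MarkPart}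
    (hf : ∀ k, IsCadlag (f k)) : IsCadlag (ssFrag α x f) := by
  have key : ∀ k i, IsCadlag fun t => f k ((x.mark i).pow α * t) := by
    intro k i
    by_cases h : x.mark i = 0
    · simp only [h, Mark.pow_zero_left, MulZeroClass.zero_mul]
      exact isCadlag_const _
    · exact (hf k).comp_mono (continuous_const.mul continuous_id) fun a b hab => by
        simpa using (mul_lt_mul_iff_right₀ (Mark.pow_pos h α)).2 hab
  refine isCadlag_of_coords (fun t i j => ?_) (fun t i => ?_) (fun t i j => ?_) (fun t i => ?_)
  · have := (MarkPart.tendsto_iff.1 (key (x.blockLabel i) i t).1).1 i j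
    exact this.mono fun s hs => and_congr_right fun _ => hs
  · have := (MarkPart.tendsto_iff.1 (key (x.blockLabel i) i t).1).2 i
    exact ((Mark.continuous_const_mul (x.mark i)).tendsto _).comp this
  · by_cases hx : x.part i j
    · rcases (key (x.blockLabel i) i).eventually_left t i j with h | h
      · exact Or.inl (h.mono fun s hs => ⟨hx, hs⟩)
      · exact Or.inr (h.mono fun s hs hs' => hs hs'.2)
    · exact Or.inr (Eventually.of_forall fun s hs => hx hs.1)
  · obtain ⟨v, hv⟩ := (key (x.blockLabel i) i).exists_left_mark t i
    exact ⟨_, ((Mark.continuous_const_mul (x.mark i)).tendsto _).comp hv⟩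

end MarkPart

/-- The space of right-continuous paths with left limits, with the σ-algebra generated by the
evaluations. -/
abbrev Path := {w : ℝ≥0 → MarkPart // IsCadlag w}

/-- The canonical process on the path space. -/
def coord (t : ℝ≥0) (w : Path) : MarkPart := w.1 t

theorem measurable_coord (t : ℝ≥0) : Measurable (coord t) :=
  (measurable_pi_apply t).comp measurable_subtype_coe

theorem measurable_toPath {S : Type*} [MeasurableSpace S] {f : S → Path} :
    Measurable f ↔ ∀ t, Measurable fun s => (f s).1 t :=
  ⟨fun h t => (measurable_coord t).comp h, fun h =>
    Measurable.subtype_mk (f := fun s => (f s).1) (measurable_pi_iff.2 h)⟩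

/-- The smallest multiple of `1 / (n + 1)` that is larger than `t`. -/
def gridAbove (n : ℕ) (t : ℝ≥0) : ℝ≥0 := (⌊t * (n + 1)⌋₊ + 1) / (n + 1)

theorem lt_gridAbove (n : ℕ) (t : ℝ≥0) : t < gridAbove n t := by
  rw [gridAbove, lt_div_iff₀ (by positivity)]
  exact Nat.lt_floor_add_one _

theorem gridAbove_le (n : ℕ) (t : ℝ≥0) : gridAbove n t ≤ t + 1 / (n + 1) := by
  rw [gridAbove, add_div]
  gcongr
  rw [div_le_iff₀ (by positivity)]
  exact Nat.floor_le zero_le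

theorem tendsto_gridAbove (t : ℝ≥0) :
    Tendsto (fun n => gridAbove n t) atTop (𝓝[>] t) := by
  refine tendsto_nhdsWithin_iff.2 ⟨?_, Eventually.of_forall fun n => lt_gridAbove n t⟩
  refine tendsto_of_tendsto_of_tendsto_of_le_of_le tendsto_const_nhds ?_
    (fun n => (lt_gridAbove n t).le) (fun n => gridAbove_le n t)
  have : Tendsto (fun n : ℕ => t + 1 / ((n : ℝ≥0) + 1)) atTop (𝓝 (t + 0)) :=
    tendsto_const_nhds.add tendsto_one_div_add_atTop_nhds_zero_nat
  simpa using this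

/-- A right-continuous process is jointly measurable. -/
theorem measurable_uncurry_of_rightContinuous {S E : Type*} [MeasurableSpace S]
    [TopologicalSpace E] [TopologicalSpace.PseudoMetrizableSpace E] [MeasurableSpace E]
    [BorelSpace E] {Z : ℝ≥0 → S → E} (hZ : ∀ t, Measurable (Z t))
    (hc : ∀ s t, Tendsto (fun r => Z r s) (𝓝[>] t) (𝓝 (Z t s))) :
    Measurable fun p : ℝ≥0 × S => Z p.1 p.2 := by
  refine measurable_of_tendsto_metrizable (f := fun n (p : ℝ≥0 × S) => Z (gridAbove n p.1) p.2)
    (fun n => ?_) (tendsto_pi_nhds.2 fun p => (hc p.2 p.1).comp (tendsto_gridAbove p.1))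
  have h1 : Measurable fun p : ℕ × S => Z (((p.1 : ℝ≥0) + 1) / (n + 1)) p.2 :=
    measurable_from_prod_countable_right fun k : ℕ => hZ (((k : ℝ≥0) + 1) / (n + 1))
  have h0 : Measurable fun p : ℝ≥0 × S => ⌊p.1 * (n + 1)⌋₊ :=
    Nat.measurable_floor.comp (measurable_fst.mul_const _)
  have h2 : Measurable fun p : ℝ≥0 × S => (⌊p.1 * (n + 1)⌋₊, p.2) :=
    h0.prodMk measurable_snd
  have e : (fun p : ℝ≥0 × S => Z (gridAbove n p.1) p.2) =
      (fun p : ℕ × S => Z (((p.1 : ℝ≥0) + 1) / (n + 1)) p.2) ∘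
        fun p : ℝ≥0 × S => (⌊p.1 * (n + 1)⌋₊, p.2) := by
    funext p
    rfl
  rw [e]
  exact Measurable.comp (α := ℝ≥0 × S) h1 h2

theorem measurable_eval : Measurable fun p : ℝ≥0 × Path => p.2.1 p.1 :=
  measurable_uncurry_of_rightContinuous (Z := fun t (w : Path) => w.1 t) measurable_coord
    fun w t => (w.2 t).1

theorem measurable_eval_comp {S : Type*} [MeasurableSpace S] {f : S → ℝ≥0} {g : S → Path}
    (hf : Measurable f) (hg : Measurable g) : Measurable fun s => (g s).1 (f s) :=
  measurable_eval.comp (hf.prodMk hg)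

/-- The path after time `s`. -/
def shift (s : ℝ≥0) (w : Path) : Path := ⟨fun t => w.1 (s + t), w.2.shift s⟩

/-- The path stopped at time `s`. -/
def stopAt (s : ℝ≥0) (w : Path) : Path := ⟨fun t => w.1 (min t s), w.2.stopAt s⟩

/-- The fragmentation operator, on the path space. -/
def frag (α : ℝ) (x : MarkPart) (f : ℕ → Path) : Path :=
  ⟨ssFrag α x fun k => (f k).1, IsCadlag.ssFrag α x fun k => (f k).2⟩

/-- The constant path. -/
def constPath (x : MarkPart) : Path := ⟨fun _ => x, isCadlag_const x⟩

theorem measurable_shift_uncurry : Measurable fun p : ℝ≥0 × Path => shift p.1 p.2 :=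
  measurable_toPath.2 fun _ => measurable_eval_comp (g := Prod.snd) (measurable_fst.add_const _) measurable_snd

theorem measurable_shift (s : ℝ≥0) : Measurable (shift s) :=
  measurable_shift_uncurry.comp (measurable_const.prodMk measurable_id)

theorem measurable_stop_uncurry : Measurable fun p : ℝ≥0 × Path => stopAt p.1 p.2 :=
  measurable_toPath.2 fun _ => measurable_eval_comp (g := Prod.snd) (measurable_const.min measurable_fst) measurable_snd

theorem measurable_stop (s : ℝ≥0) : Measurable (stopAt s) :=
  measurable_stop_uncurry.comp (measurable_const.prodMk measurable_id)

theorem measurable_ssFrag {S : Type*} [MeasurableSpace S] (α : ℝ) (x : MarkPart)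
    {f : ℕ → ℝ≥0 → S → MarkPart} (hf : ∀ k t, Measurable (f k t)) (t : ℝ≥0) :
    Measurable fun s => ssFrag α x (fun k r => f k r s) t := by
  refine MarkPart.measurable_iff.2 ⟨fun i j => ?_, fun i => ?_⟩
  · exact (MeasurableSet.const _).inter ((MarkPart.measurable_iff.1 (hf _ _)).1 i j)
  · exact (Mark.measurable_const_mul _).comp ((MarkPart.measurable_iff.1 (hf _ _)).2 i)

theorem measurable_frag (α : ℝ) (x : MarkPart) : Measurable (frag α x) :=
  measurable_toPath.2 fun t =>
    measurable_ssFrag α x (f := fun k r (g : ℕ → Path) => (g k).1 r)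
      (fun k r => (measurable_coord r).comp (measurable_pi_apply k)) t

theorem shift_zero (w : Path) : shift 0 w = w :=
  Subtype.ext (funext fun r => congrArg w.1 (zero_add r))

/-- Measures on the path space are determined by their images on the space of all maps. -/
theorem map_val_injective {μ ν : Measure Path}
    (h : μ.map Subtype.val = ν.map Subtype.val) : μ = ν := by
  ext s hs
  obtain ⟨t, ht, rfl⟩ := hs
  rw [← Measure.map_apply measurable_subtype_coe ht, h,
    Measure.map_apply measurable_subtype_coe ht]

/-- A process with paths in the path space, as a random path. -/
def toPath {S : Type*} (Z : ℝ≥0 → S → MarkPart) (hc : ∀ s, IsCadlag fun t => Z t s) (s : S) :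
    Path := ⟨fun t => Z t s, hc s⟩

theorem measurable_toPath' {S : Type*} [MeasurableSpace S] {Z : ℝ≥0 → S → MarkPart}
    (hZ : ∀ t, Measurable (Z t)) (hc : ∀ s, IsCadlag fun t => Z t s) :
    Measurable (toPath Z hc) := measurable_toPath.2 hZ

/-! ## The clock -/

/-- A lower bound `e` on the size confines the mark to the interval from `e` to `e⁻¹`, so its powers
are bounded above and (in `Mark.le_pow`) below, whatever the sign of the exponent. -/
theorem Mark.pow_le {v : Mark} {e : ℝ≥0} (he : 0 < e) (hv : e ≤ v.size) (b : ℝ) :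
    v.pow b ≤ e⁻¹ ^ |b| := by
  have h0 : v ≠ 0 := fun h => by simp [h] at hv; exact he.ne' hv
  rw [pow_of_ne h0]
  rcases le_total 0 b with hb | hb
  · rw [abs_of_nonneg hb]
    exact NNReal.rpow_le_rpow ((val_le_inv_size v).trans (inv_anti₀ he hv)) hb
  · rw [abs_of_nonpos hb, ← inv_inv v.val, NNReal.inv_rpow, ← NNReal.rpow_neg]
    exact NNReal.rpow_le_rpow (inv_anti₀ he (hv.trans (size_le_val v))) (neg_nonneg.2 hb)

theorem Mark.le_pow {v : Mark} {e : ℝ≥0} (he : 0 < e) (hv : e ≤ v.size) (b : ℝ) :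
    e ^ |b| ≤ v.pow b := by
  have h0 : v ≠ 0 := fun h => by simp [h] at hv; exact he.ne' hv
  rw [pow_of_ne h0]
  rcases le_total 0 b with hb | hb
  · rw [abs_of_nonneg hb]
    exact NNReal.rpow_le_rpow (hv.trans (size_le_val v)) hb
  · rw [abs_of_nonpos hb, ← inv_inv v.val, NNReal.inv_rpow, ← NNReal.rpow_neg]
    exact NNReal.rpow_le_rpow (hv.trans (size_le_inv v)) (neg_nonneg.2 hb)

namespace MarkPart

/-- The measure on the line whose distribution function is the clock. -/
def clockMeasure (β : ℝ) (w : ℝ≥0 → MarkPart) (i : ℕ) : Measure ℝ :=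
  volume.withDensity fun s => (((w s.toNNReal).mark i).pow β : ℝ≥0∞)

variable {β : ℝ} {w w' : ℝ≥0 → MarkPart} {i j : ℕ} {u s t : ℝ≥0}

theorem clock_eq_measure (β : ℝ) (w : ℝ≥0 → MarkPart) (i : ℕ) (u : ℝ≥0) :
    clock β w i u = clockMeasure β w i (Set.Icc 0 u) :=
  (withDensity_apply _ measurableSet_Icc).symm

theorem clockMeasure_singleton (β : ℝ) (w : ℝ≥0 → MarkPart) (i : ℕ) (a : ℝ) :
    clockMeasure β w i {a} = 0 :=
  withDensity_absolutelyContinuous _ _ (Real.volume_singleton)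

theorem clock_zero (β : ℝ) (w : ℝ≥0 → MarkPart) (i : ℕ) : clock β w i 0 = 0 := by
  rw [clock_eq_measure]
  simp [clockMeasure_singleton]

theorem clock_mono (β : ℝ) (w : ℝ≥0 → MarkPart) (i : ℕ) : Monotone (clock β w i) := by
  intro a b h
  rw [clock_eq_measure, clock_eq_measure]
  exact measure_mono (Set.Icc_subset_Icc le_rfl (by exact_mod_cast h))

theorem clock_eq_Ico (β : ℝ) (w : ℝ≥0 → MarkPart) (i : ℕ) (u : ℝ≥0) :
    clock β w i u = ∫⁻ s in Set.Ico (0 : ℝ) u, (((w s.toNNReal).mark i).pow β : ℝ≥0∞) :=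
  setLIntegral_congr Ico_ae_eq_Icc.symm

theorem clock_congr (h : ∀ s < u, (w s).mark i = (w' s).mark j) :
    clock β w i u = clock β w' j u := by
  rw [clock_eq_Ico, clock_eq_Ico]
  refine setLIntegral_congr_fun measurableSet_Ico fun s hs => ?_
  have : s.toNNReal < u := (Real.toNNReal_lt_iff_lt_coe hs.1).2 hs.2
  simp only [h _ this]

theorem clock_le {B : ℝ≥0} (h : ∀ s < u, ((w s).mark i).pow β ≤ B) :
    clock β w i u ≤ B * u := by
  rw [clock_eq_Ico]
  calc _ ≤ ∫⁻ s in Set.Ico (0 : ℝ) u, (B : ℝ≥0∞) := by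
        refine setLIntegral_mono measurable_const fun s hs => ?_
        have : s.toNNReal < u := (Real.toNNReal_lt_iff_lt_coe hs.1).2 hs.2
        exact_mod_cast h _ this
    _ = B * u := by simp

theorem le_clock {b : ℝ≥0} (h : ∀ s < u, b ≤ ((w s).mark i).pow β) :
    b * u ≤ clock β w i u := by
  rw [clock_eq_Ico]
  calc (b * u : ℝ≥0∞) = ∫⁻ s in Set.Ico (0 : ℝ) u, (b : ℝ≥0∞) := by simp
    _ ≤ _ := by
        refine setLIntegral_mono' measurableSet_Ico fun s hs => ?_
        have : s.toNNReal < u := (Real.toNNReal_lt_iff_lt_coe hs.1).2 hs.2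
        exact_mod_cast h _ this

theorem clock_eq_zero (h : ∀ s < u, (w s).mark i = 0) : clock β w i u = 0 := by
  have := clock_le (β := β) (w := w) (i := i) (u := u) (B := 0) fun s hs => by
    rw [h s hs, Mark.pow_zero_left]
  simpa using this

theorem clock_add (β : ℝ) (w : ℝ≥0 → MarkPart) (i : ℕ) (s u : ℝ≥0) :
    clock β w i (s + u) = clock β w i s + clock β (fun t => w (s + t)) i u := by
  have hsu : Set.Ico (0 : ℝ) ((s + u : ℝ≥0) : ℝ) = Set.Ico 0 (s : ℝ) ∪ Set.Ico (s : ℝ) (s + u) := by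
    rw [NNReal.coe_add, Set.Ico_union_Ico_eq_Ico s.coe_nonneg (by simp)]
  rw [clock_eq_Ico, clock_eq_Ico, clock_eq_Ico, hsu,
    lintegral_union measurableSet_Ico (Set.Ico_disjoint_Ico_same)]
  congr 1
  have hmp : MeasurePreserving (fun r : ℝ => (s : ℝ) + r) volume volume :=
    measurePreserving_add_left volume (s : ℝ)
  have hpre : (fun r : ℝ => (s : ℝ) + r) ⁻¹' Set.Ico (s : ℝ) (s + u) = Set.Ico 0 (u : ℝ) := by
    ext r
    simp
  rw [← hmp.setLIntegral_comp_preimage_emb (measurableEmbedding_addLeft (s : ℝ)), hpre]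
  refine setLIntegral_congr_fun measurableSet_Ico fun r hr => ?_
  have : ((s : ℝ) + r).toNNReal = s + r.toNNReal := by
    rw [Real.toNNReal_add s.coe_nonneg hr.1, Real.toNNReal_coe]
  simp only [this]

theorem clock_const_mul {c : ℝ≥0} (hc : 0 < c) (β : ℝ) (w : ℝ≥0 → MarkPart) (i : ℕ) (u : ℝ≥0) :
    clock β (fun t => w (c * t)) i u = (c⁻¹ : ℝ≥0) * clock β w i (c * u) := by
  rw [clock_eq_Ico, clock_eq_Ico]
  have hc' : (c : ℝ) ≠ 0 := by exact_mod_cast hc.ne'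
  have hcp : (0 : ℝ) < c := by exact_mod_cast hc
  have hemb : MeasurableEmbedding fun r : ℝ => (c : ℝ) * r :=
    (Homeomorph.mulLeft₀ (c : ℝ) hc').measurableEmbedding
  have hpre : (fun r : ℝ => (c : ℝ) * r) ⁻¹' Set.Ico 0 ((c * u : ℝ≥0) : ℝ) = Set.Ico 0 (u : ℝ) := by
    ext r
    simp [mul_lt_mul_iff_right₀ hcp, mul_nonneg_iff_of_pos_left hcp]
  have hmap : Measure.map (fun r : ℝ => (c : ℝ) * r) volume = ENNReal.ofReal |(c : ℝ)⁻¹| • volume :=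
    Real.map_volume_mul_left hc'
  have h1 : ∫⁻ r in Set.Ico (0 : ℝ) u, (((w (c * r.toNNReal)).mark i).pow β : ℝ≥0∞) =
      ∫⁻ r in (fun r : ℝ => (c : ℝ) * r) ⁻¹' Set.Ico 0 ((c * u : ℝ≥0) : ℝ),
        (((w (c * r).toNNReal).mark i).pow β : ℝ≥0∞) := by
    rw [hpre]
    refine setLIntegral_congr_fun measurableSet_Ico fun r hr => ?_
    simp only [Real.toNNReal_mul c.coe_nonneg, Real.toNNReal_coe]
  have hmp : MeasurePreserving (fun r : ℝ => (c : ℝ) * r) volume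
    (ENNReal.ofReal |(c : ℝ)⁻¹| • volume) := ⟨hemb.measurable, hmap⟩
  rw [h1, hmp.setLIntegral_comp_preimage_emb hemb
    (fun r : ℝ => (((w r.toNNReal).mark i).pow β : ℝ≥0∞)), Measure.restrict_smul,
    lintegral_smul_measure, abs_of_nonneg (by positivity), smul_eq_mul]
  congr 1
  rw [← NNReal.coe_inv, ENNReal.ofReal_coe_nnreal]

/-- The clock is continuous from the left. -/
theorem clock_le_of_forall_lt {a : ℝ≥0∞} (h : ∀ s < u, clock β w i s ≤ a) :
    clock β w i u ≤ a := by
  have hU : Set.Ico (0 : ℝ) u ⊆ ⋃ n : ℕ, Set.Icc (0 : ℝ) ((u - 1 / ((n : ℝ≥0) + 1) : ℝ≥0) : ℝ) := by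
    intro s hs
    obtain ⟨n, hn⟩ := exists_nat_one_div_lt (sub_pos.2 hs.2)
    refine Set.mem_iUnion.2 ⟨n, hs.1, ?_⟩
    have hle : (1 / ((n : ℝ≥0) + 1)) ≤ u := by
      rw [← NNReal.coe_le_coe]
      push_cast
      linarith [hs.1]
    rw [NNReal.coe_sub hle]
    push_cast
    linarith
  have hmono : Monotone fun n : ℕ => Set.Icc (0 : ℝ) ((u - 1 / ((n : ℝ≥0) + 1) : ℝ≥0) : ℝ) := by
    intro m n hmn
    refine Set.Icc_subset_Icc le_rfl ?_
    rw [NNReal.coe_le_coe]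
    refine tsub_le_tsub_left ?_ u
    gcongr
  rcases eq_or_ne u 0 with rfl | hu
  · rw [clock_zero]; exact zero_le
  have h1 : clock β w i u ≤ clockMeasure β w i
      (⋃ n : ℕ, Set.Icc (0 : ℝ) ((u - 1 / ((n : ℝ≥0) + 1) : ℝ≥0) : ℝ)) := by
    rw [clock_eq_Ico, ← withDensity_apply _ measurableSet_Ico]
    exact measure_mono hU
  refine h1.trans ?_
  rw [hmono.measure_iUnion]
  refine iSup_le fun n => ?_
  rw [← clock_eq_measure]
  refine h _ (tsub_lt_self (pos_iff_ne_zero.2 hu) (by positivity))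

end MarkPart

/-! ### Regular paths and the explicit form of their time change. -/

namespace MarkPart

/-- The properties of typical paths: partitions get finer, marks that vanish (or that have a
vanishing limit) at some time vanish at all later times, and blocks with mark `0` do not split. -/
structure Regular (w : ℝ≥0 → MarkPart) : Prop where
  mono : ∀ {s t : ℝ≥0}, s ≤ t → ∀ {i j : ℕ}, (w t).part i j → (w s).part i j
  away : ∀ {i : ℕ} {t : ℝ≥0}, (w t).mark i ≠ 0 → ∃ e > 0, ∀ s ≤ t, e ≤ ((w s).mark i).size
  frozen : ∀ {i j : ℕ} {s t : ℝ≥0}, s ≤ t → (w s).mark i = 0 → (w s).part i j → (w t).part i j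

/-- At time `u` the mark of `i` is not `0` and the clock of `i` equals `t`. -/
def Live (β : ℝ) (w : ℝ≥0 → MarkPart) (i : ℕ) (u t : ℝ≥0) : Prop :=
  (w u).mark i ≠ 0 ∧ clock β w i u = t

variable {β : ℝ} {w : ℝ≥0 → MarkPart} {i j : ℕ} {s t u v : ℝ≥0}

theorem live_lt (h : Live β w i u t) (h' : Live β w i v s) (hst : s < t) :
    v < u := by
  by_contra hle
  have := clock_mono β w i (not_lt.1 hle)
  rw [h.2, h'.2] at this
  exact absurd hst (not_lt.2 (by exact_mod_cast this))

namespace Regular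

theorem mark_ne_zero (hr : Regular w) (hst : s ≤ t) (ht : (w t).mark i ≠ 0) :
    (w s).mark i ≠ 0 := by
  obtain ⟨e, he, h⟩ := hr.away ht
  intro h0
  have := h s hst
  rw [h0, Mark.size_zero] at this
  exact he.ne' (le_antisymm this zero_le)

theorem mark_eq_zero (hr : Regular w) (hst : s ≤ t) (hs : (w s).mark i = 0) :
    (w t).mark i = 0 := by
  by_contra h
  exact hr.mark_ne_zero hst h hs

/-- A nonzero mark at `u` keeps all earlier marks in a compact part of `(0, ∞)`. Up to `u` the clock
is therefore finite, strictly increasing and continuous, as the next lemmas show. -/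
theorem exists_clock_bound (hr : Regular w) (hu : (w u).mark i ≠ 0) (β : ℝ) :
    ∃ b B : ℝ≥0, 0 < b ∧ ∀ s ≤ u, b ≤ ((w s).mark i).pow β ∧ ((w s).mark i).pow β ≤ B := by
  obtain ⟨e, he, h⟩ := hr.away hu
  exact ⟨e ^ |β|, e⁻¹ ^ |β|, NNReal.rpow_pos he, fun s hs =>
    ⟨Mark.le_pow he (h s hs) β, Mark.pow_le he (h s hs) β⟩⟩

theorem clock_ne_top (hr : Regular w) (hu : (w u).mark i ≠ 0) : clock β w i u ≠ ⊤ := by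
  obtain ⟨b, B, -, h⟩ := hr.exists_clock_bound hu β
  have := clock_le (β := β) (w := w) (i := i) fun s hs => (h s hs.le).2
  exact ne_top_of_le_ne_top (ENNReal.mul_ne_top ENNReal.coe_ne_top ENNReal.coe_ne_top) this

theorem clock_lt (hr : Regular w) (hu : (w u).mark i ≠ 0) (hsu : s < u) :
    clock β w i s < clock β w i u := by
  obtain ⟨b, B, hb, h⟩ := hr.exists_clock_bound hu β
  obtain ⟨d, rfl⟩ := exists_add_of_le hsu.le
  have hd : 0 < d := by simpa using hsu
  have h1 : (b * d : ℝ≥0∞) ≤ clock β (fun t => w (s + t)) i d :=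
    le_clock fun r hr => (h _ (by gcongr)).1
  rw [clock_add]
  refine ENNReal.lt_add_right (hr.clock_ne_top (hr.mark_ne_zero hsu.le hu)) ?_
  have : (0 : ℝ≥0∞) < b * d := by exact_mod_cast mul_pos hb hd
  exact (this.trans_le h1).ne'

theorem clock_injective (hr : Regular w) (hu : (w u).mark i ≠ 0)
    (h : clock β w i s = clock β w i u) : u ≤ s := by
  by_contra hlt
  exact (hr.clock_lt hu (not_le.1 hlt)).ne h

/-- Intermediate values: take the last time at which the clock is at most `a`. Left continuity gives
one inequality, and the upper bound `B` on the density shows that a smaller value there would leave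
room for a later such time. -/
theorem exists_clock_eq (hr : Regular w) (hu : (w u).mark i ≠ 0) {a : ℝ≥0∞}
    (ha : a ≤ clock β w i u) : ∃ v ≤ u, clock β w i v = a := by
  obtain ⟨b, B, -, hB⟩ := hr.exists_clock_bound hu β
  have hatop : a ≠ ⊤ := ne_top_of_le_ne_top (hr.clock_ne_top hu) ha
  set S : Set ℝ≥0 := {s | s ≤ u ∧ clock β w i s ≤ a} with hS
  have hne : S.Nonempty := ⟨0, zero_le, by rw [clock_zero]; exact zero_le⟩
  have hbdd : BddAbove S := ⟨u, fun s hs => hs.1⟩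
  have hvu : sSup S ≤ u := csSup_le hne fun s hs => hs.1
  have hle : clock β w i (sSup S) ≤ a := clock_le_of_forall_lt fun s hs => by
    obtain ⟨s', hs', h⟩ := exists_lt_of_lt_csSup hne hs
    exact (clock_mono β w i h.le).trans hs'.2
  refine ⟨sSup S, hvu, le_antisymm hle (not_lt.1 fun hlt => ?_)⟩
  have hvu' : sSup S < u := lt_of_le_of_ne hvu fun h => by
    rw [h] at hlt
    exact absurd ha (not_le.2 hlt)
  have hd : 0 < (a - clock β w i (sSup S)).toNNReal :=
    ENNReal.toNNReal_pos (tsub_pos_of_lt hlt).ne' (ENNReal.sub_ne_top hatop)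
  -- A time increment that stays below `u` and over which the clock gains at most the gap `a -
  -- clock`; the denominator `B + 1` avoids a division by zero.
  set d := min (u - sSup S) ((a - clock β w i (sSup S)).toNNReal / (B + 1)) with hdd
  have hdpos : 0 < d := lt_min (tsub_pos_of_lt hvu') (div_pos hd (by positivity))
  have hdu : sSup S + d ≤ u := by
    calc sSup S + d ≤ sSup S + (u - sSup S) := by gcongr; exact min_le_left _ _
      _ = u := add_tsub_cancel_of_le hvu
  have hmem : sSup S + d ∈ S := by
    refine ⟨hdu, ?_⟩
    rw [clock_add]
    have h1 : clock β (fun t => w (sSup S + t)) i d ≤ B * d :=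
      clock_le fun r hr => (hB _ (le_trans (by gcongr) hdu)).2
    have h2 : B * d ≤ (a - clock β w i (sSup S)).toNNReal := by
      calc B * d ≤ (B + 1) * ((a - clock β w i (sSup S)).toNNReal / (B + 1)) :=
            mul_le_mul' (by simp) (min_le_right _ _)
        _ = _ := mul_div_cancel₀ _ (by positivity)
    calc clock β w i (sSup S) + clock β (fun t => w (sSup S + t)) i d
        ≤ clock β w i (sSup S) + (a - clock β w i (sSup S)) := by
          gcongr
          refine h1.trans ?_
          rw [← ENNReal.coe_toNNReal (ENNReal.sub_ne_top hatop (b := clock β w i (sSup S)))]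
          exact_mod_cast h2
      _ = a := add_tsub_cancel_of_le hle
  have := le_csSup hbdd hmem
  exact absurd this (not_le.2 (by simpa using hdpos))

theorem live_of_le (hr : Regular w) (h : Live β w i u t) (hst : s ≤ t) :
    ∃ v ≤ u, Live β w i v s := by
  obtain ⟨v, hv, h'⟩ := hr.exists_clock_eq (β := β) h.1 (a := s) (by rw [h.2]; exact_mod_cast hst)
  exact ⟨v, hv, hr.mark_ne_zero hv h.1, h'⟩

theorem tau_eq (hr : Regular w) (h : Live β w i u t) : tau β w t i = u := by
  refine le_antisymm (sInf_le ⟨u, rfl, h.2⟩) (le_sInf ?_)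
  rintro _ ⟨v, rfl, hv⟩
  exact_mod_cast hr.clock_injective h.1 (hv.trans h.2.symm)

theorem clock_eq_of_part (hr : Regular w) (h : (w u).part i j) : clock β w i u = clock β w j u :=
  clock_congr fun _ hs => (w _).mark_eq (hr.mono hs.le h)

theorem live_congr (hr : Regular w) (h : Live β w i u t) (hij : (w u).part i j) :
    Live β w j u t :=
  ⟨fun h0 => h.1 (((w u).mark_eq hij).trans h0), (hr.clock_eq_of_part hij).symm.trans h.2⟩

/-- If `tau` is a finite time `u` and the mark at `u` were not `0`, right-continuity would give a
nonzero mark at a time close to `u` where the clock equals `t`, that is, a live time. So the mark at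
`u` is `0` and the block is frozen: together at `u` then means together at all times, exactly as
when `tau` is infinite. -/
theorem atTime_of_not_live (hr : Regular w) (hw : IsCadlag w) (h : ¬∃ u, Live β w i u t) :
    (atTime w (tau β w t i)).mark i = 0 ∧
      ∀ j, (atTime w (tau β w t i)).part i j ↔ ∀ s, (w s).part i j := by
  rcases eq_or_ne (tau β w t i) ⊤ with htop | htop
  · rw [htop]
    refine ⟨rfl, fun j => ⟨fun hj s => ?_, fun hj => Eventually.of_forall hj⟩⟩
    have hj' : ∀ᶠ r in atTop, (w r).part i j := hj
    obtain ⟨r, hr1, hr2⟩ := (hj'.and (eventually_ge_atTop s)).exists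
    exact hr.mono hr2 hr1
  · obtain ⟨u, hu⟩ : ∃ u : ℝ≥0, (u : ℝ≥0∞) = tau β w t i := ⟨_, ENNReal.coe_toNNReal htop⟩
    have h0 : (w u).mark i = 0 := by
      by_contra hne
      have hnear := (hw.tendsto_mark u i).eventually_ne hne
      obtain ⟨d, hd, hball⟩ := (nhdsGE_basis u).mem_iff.1 hnear
      have hlt : tau β w t i < d := by rw [← hu]; exact_mod_cast hd
      obtain ⟨_, ⟨v, rfl, hv⟩, hvd⟩ := sInf_lt_iff.1 hlt
      have huv : u ≤ v := by
        have : tau β w t i ≤ v := sInf_le ⟨v, rfl, hv⟩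
        rw [← hu] at this
        exact_mod_cast this
      exact h ⟨v, hball ⟨huv, by exact_mod_cast hvd⟩, hv⟩
    rw [← hu]
    refine ⟨h0, fun j => ⟨fun hj s => ?_, fun hj => hj u⟩⟩
    have hj' : (w u).part i j := hj
    rcases le_total s u with hs | hs
    · exact hr.mono hs hj'
    · exact hr.frozen hs h0 hj'

/-- The pathwise form of the compatibility condition of stopping lines: integers together at the
observation time have had the same marks until then, hence the same clock. In the dead case they are
together forever. -/
theorem tau_congr (hr : Regular w) (hw : IsCadlag w)
    (h : (atTime w (tau β w t i)).part i j) : tau β w t i = tau β w t j := by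
  by_cases hl : ∃ u, Live β w i u t
  · obtain ⟨u, hu⟩ := hl
    have e := hr.tau_eq hu
    rw [e] at h ⊢
    exact (hr.tau_eq (hr.live_congr hu h)).symm
  · have hs := ((hr.atTime_of_not_live hw hl).2 j).1 h
    have : ∀ u, clock β w i u = clock β w j u := fun u => hr.clock_eq_of_part (hs u)
    simp only [tau, this]

/-- With `timeChange_of_not_live`, this dichotomy replaces the definition through `tau` and `atLine`
in the path arguments below: a live integer is observed at its live time, a dead one has mark `0`
and its eventual block. -/
theorem timeChange_of_live (hr : Regular w) (hw : IsCadlag w) (h : Live β w i u t) :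
    (timeChange β w t).mark i = (w u).mark i ∧
      ∀ j, (timeChange β w t).part i j ↔ (w u).part i j := by
  have e := hr.tau_eq h
  constructor
  · change (atTime w (tau β w t i)).mark i = _
    rw [e]; rfl
  · intro j
    change tau β w t i = tau β w t j ∧ (atTime w (tau β w t i)).part i j ↔ _
    rw [and_iff_right_of_imp (hr.tau_congr hw), e]
    rfl

theorem timeChange_of_not_live (hr : Regular w) (hw : IsCadlag w) (h : ¬∃ u, Live β w i u t) :
    (timeChange β w t).mark i = 0 ∧
      ∀ j, (timeChange β w t).part i j ↔ ∀ s, (w s).part i j := by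
  refine ⟨(hr.atTime_of_not_live hw h).1, fun j => ?_⟩
  change tau β w t i = tau β w t j ∧ (atTime w (tau β w t i)).part i j ↔ _
  rw [and_iff_right_of_imp (hr.tau_congr hw), (hr.atTime_of_not_live hw h).2 j]

theorem timeChange_mark_ne_zero (hr : Regular w) (hw : IsCadlag w)
    (h : (timeChange β w t).mark i ≠ 0) : ∃ u, Live β w i u t := by
  by_contra hl
  exact h (hr.timeChange_of_not_live hw hl).1

/-- Time-changed regular paths are regular. -/
theorem regular_timeChange (hr : Regular w) (hw : IsCadlag w) :
    Regular (timeChange β w) where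
  mono {s t} hst {i j} h := by
    by_cases ht : ∃ u, Live β w i u t
    · obtain ⟨u, hu⟩ := ht
      obtain ⟨v, hv, hs⟩ := hr.live_of_le hu hst
      rw [(hr.timeChange_of_live hw hu).2] at h
      rw [(hr.timeChange_of_live hw hs).2]
      exact hr.mono hv h
    · rw [(hr.timeChange_of_not_live hw ht).2] at h
      by_cases hs : ∃ u, Live β w i u s
      · obtain ⟨v, hv⟩ := hs
        exact ((hr.timeChange_of_live hw hv).2 j).2 (h v)
      · exact ((hr.timeChange_of_not_live hw hs).2 j).2 h
  away {i t} h := by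
    obtain ⟨u, hu⟩ := hr.timeChange_mark_ne_zero hw h
    obtain ⟨e, he, h'⟩ := hr.away hu.1
    refine ⟨e, he, fun s hs => ?_⟩
    obtain ⟨v, hv, hvs⟩ := hr.live_of_le hu hs
    rw [(hr.timeChange_of_live hw hvs).1]
    exact h' v hv
  frozen {i j s t} hst h0 h := by
    have hs : ¬∃ u, Live β w i u s := fun ⟨u, hu⟩ =>
      hu.1 ((hr.timeChange_of_live hw hu).1.symm.trans h0)
    have ht : ¬∃ u, Live β w i u t := fun ⟨u, hu⟩ =>
      hs ((hr.live_of_le hu hst).imp fun v hv => hv.2)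
    rw [(hr.timeChange_of_not_live hw hs).2] at h
    exact ((hr.timeChange_of_not_live hw ht).2 j).2 h

end Regular

end MarkPart

/-! ### Shifts of the time change, and its one-sided limits. -/

namespace MarkPart

variable {β : ℝ} {w : ℝ≥0 → MarkPart} {i j : ℕ} {s t u v T : ℝ≥0}

namespace Regular

theorem shift (hr : Regular w) (T : ℝ≥0) : Regular fun t => w (T + t) where
  mono hst _ _ h := hr.mono (by gcongr) h
  away h := (hr.away h).imp fun _ he => ⟨he.1, fun _ hs => he.2 _ (by gcongr)⟩
  frozen hst h0 h := hr.frozen (by gcongr) h0 h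

theorem stopAt (hr : Regular w) (T : ℝ≥0) : Regular fun t => w (min t T) where
  mono hst _ _ h := hr.mono (min_le_min_right T hst) h
  away h := (hr.away h).imp fun _ he => ⟨he.1, fun _ hs => he.2 _ (min_le_min_right T hs)⟩
  frozen hst h0 h := hr.frozen (min_le_min_right T hst) h0 h

/-- Right-continuity of the inverse clock: what holds just after `u` on the original scale holds
just after `t` on the new one. -/
theorem eventually_live_right (hr : Regular w) (hw : IsCadlag w) (h : Live β w i u t)
    {p : ℝ≥0 → Prop} (hp : ∀ᶠ v in 𝓝[>] u, p v) :
    ∀ᶠ s in 𝓝[>] t, ∃ v, Live β w i v s ∧ p v := by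
  have hne : ∀ᶠ v in 𝓝[>] u, (w v).mark i ≠ 0 :=
    ((hw.tendsto_mark u i).eventually_ne h.1).filter_mono (nhdsWithin_mono _ Set.Ioi_subset_Ici_self)
  obtain ⟨d, hd, hball⟩ := (nhdsGT_basis u).mem_iff.1 (hp.and hne)
  obtain ⟨m, hm1, hm2⟩ := exists_between hd
  have hm := (hball ⟨hm1, hm2⟩).2
  have hlt := hr.clock_lt (β := β) hm hm1
  rw [h.2] at hlt
  have hfin := hr.clock_ne_top (β := β) hm
  have hlt' : t < (clock β w i m).toNNReal := by
    rw [← ENNReal.coe_lt_coe, ENNReal.coe_toNNReal hfin]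
    exact hlt
  filter_upwards [Ioo_mem_nhdsGT hlt'] with s hs
  have hs2 : (s : ℝ≥0∞) ≤ clock β w i m := by
    rw [← ENNReal.coe_toNNReal hfin]
    exact_mod_cast hs.2.le
  obtain ⟨v, hv, hvs⟩ := hr.exists_clock_eq hm hs2
  have hl : Live β w i v s := ⟨hr.mark_ne_zero hv hm, hvs⟩
  exact ⟨v, hl, (hball ⟨live_lt hl h hs.1, hv.trans_lt hm2⟩).1⟩

theorem not_live_of_le (hr : Regular w) (hst : s ≤ t) (h : ¬∃ u, Live β w i u s) :
    ¬∃ u, Live β w i u t := fun ⟨_, hu⟩ => h ((hr.live_of_le hu hst).imp fun _ hv => hv.2)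

theorem exists_dead_time (hr : Regular w) (hw : IsCadlag w) (h : (w T).mark i = 0) :
    ∃ T₀ ≤ T, (∀ s < T₀, (w s).mark i ≠ 0) ∧ ∀ s ≥ T₀, (w s).mark i = 0 := by
  set D : Set ℝ≥0 := {s | (w s).mark i = 0}
  have hD : D.Nonempty := ⟨T, h⟩
  have h0 : (w (sInf D)).mark i = 0 := by
    by_contra hne
    obtain ⟨d, hd, hball⟩ :=
      (nhdsGE_basis (sInf D)).mem_iff.1 ((hw.tendsto_mark _ i).eventually_ne hne)
    obtain ⟨v, hv, hvd⟩ := exists_lt_of_csInf_lt hD hd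
    exact hball ⟨csInf_le (OrderBot.bddBelow _) hv, hvd⟩ hv
  exact ⟨sInf D, csInf_le (OrderBot.bddBelow _) h,
    fun s hs hs' => notMem_of_lt_csInf hs (OrderBot.bddBelow _) hs',
    fun s hs => hr.mark_eq_zero hs h0⟩

theorem clock_eq_of_dead (hr : Regular w) (h : (w T).mark i = 0) (hTu : T ≤ u) :
    clock β w i u = clock β w i T := by
  obtain ⟨d, rfl⟩ := exists_add_of_le hTu
  rw [clock_add, clock_eq_zero (w := fun t => w (T + t)), add_zero]
  exact fun s _ => hr.mark_eq_zero (by simp) h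

/-- If `t` were never attained with a nonzero mark, intermediate values would keep the clock at most
`t` at all times with nonzero mark. Left continuity extends the bound to the death time, after which
the clock is constant. -/
theorem exists_live_of_lt_clock (hr : Regular w) (hw : IsCadlag w) (h : (t : ℝ≥0∞) < clock β w i T) :
    ∃ u < T, Live β w i u t := by
  by_contra hno
  push Not at hno
  have key : ∀ s ≤ T, (w s).mark i ≠ 0 → clock β w i s ≤ t := fun s hs hne => by
    by_contra hlt
    obtain ⟨v, hv, hvt⟩ := hr.exists_clock_eq hne (not_le.1 hlt).le
    have hvT : v ≠ T := fun e => by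
      rw [← e, hvt] at h
      exact lt_irrefl _ h
    exact hno v (lt_of_le_of_ne (hv.trans hs) hvT) ⟨hr.mark_ne_zero hv hne, hvt⟩
  by_cases hT : (w T).mark i = 0
  · obtain ⟨T₀, hT₀, h1, h2⟩ := hr.exists_dead_time hw hT
    have : clock β w i T₀ ≤ t :=
      clock_le_of_forall_lt fun s hs => key s (hs.le.trans hT₀) (h1 s hs)
    rw [hr.clock_eq_of_dead (h2 T₀ le_rfl) hT₀] at h
    exact absurd h (not_lt.2 this)
  · exact absurd h (not_lt.2 (key T le_rfl hT))

theorem clock_le_of_le_tau (hr : Regular w) (hw : IsCadlag w) (h : (T : ℝ≥0∞) ≤ tau β w t i) :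
    clock β w i T ≤ t := by
  by_contra hlt
  obtain ⟨u, hu, hl⟩ := hr.exists_live_of_lt_clock hw (not_le.1 hlt)
  rw [hr.tau_eq hl] at h
  exact absurd hu (not_lt.2 (by exact_mod_cast h))

/-- A finite infimum in `tau` is attained: either it is a live time, or the mark is `0` there and
the clock stays constant up to the later times at which it equals `t`. -/
theorem clock_tau (hr : Regular w) (hw : IsCadlag w) (h : tau β w t i = T) :
    clock β w i T = t := by
  by_cases hl : ∃ u, Live β w i u t
  · obtain ⟨u, hu⟩ := hl
    rw [hr.tau_eq hu] at h
    have : u = T := by exact_mod_cast h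
    exact this ▸ hu.2
  · have h0 := (hr.atTime_of_not_live hw hl).1
    rw [h] at h0
    have h0' : (w T).mark i = 0 := h0
    obtain ⟨_, ⟨v, rfl, hv⟩, -⟩ := sInf_lt_iff.1 (show tau β w t i < ⊤ by rw [h]; exact ENNReal.coe_lt_top)
    have hTv : T ≤ v := by
      have : tau β w t i ≤ v := sInf_le ⟨v, rfl, hv⟩
      rw [h] at this
      exact_mod_cast this
    rw [← hv, hr.clock_eq_of_dead h0' hTv]

theorem live_shift (hr : Regular w) (hw : IsCadlag w) {c : ℝ≥0} (hc : clock β w i T = c) (r : ℝ≥0) :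
    Live β w i u (c + r) ↔ ∃ v, u = T + v ∧ Live β (fun t => w (T + t)) i v r := by
  constructor
  · rintro ⟨h1, h2⟩
    -- The clock increases strictly just after a time with nonzero mark, so `u < T` would give the
    -- clock at `u` a value less than `c`.
    have hTu : T ≤ u := by
      by_contra hlt
      have hlt := not_le.1 hlt
      obtain ⟨d, hd, hball⟩ := (nhdsGE_basis u).mem_iff.1 ((hw.tendsto_mark _ i).eventually_ne h1)
      obtain ⟨m, hm1, hm2⟩ := exists_between (lt_min hd hlt)
      have hm := hball ⟨hm1.le, hm2.trans_le (min_le_left _ _)⟩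
      have h3 := hr.clock_lt (β := β) hm hm1
      have h4 := clock_mono β w i (hm2.trans_le (min_le_right _ _)).le
      rw [hc] at h4
      have h5 := h3.trans_le h4
      rw [h2] at h5
      exact absurd h5 (not_lt.2 (by simp))
    obtain ⟨v, rfl⟩ := exists_add_of_le hTu
    refine ⟨v, rfl, h1, ?_⟩
    rw [clock_add, hc, ENNReal.coe_add] at h2
    exact (ENNReal.add_right_inj ENNReal.coe_ne_top).1 h2
  · rintro ⟨v, rfl, h1, h2⟩
    exact ⟨h1, by rw [clock_add, hc, h2, ENNReal.coe_add]⟩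

/-- After the time `T`, at which the clock of `i` is `c`, the time change of the path is the time
change of the path after `T`. -/
theorem timeChange_add (hr : Regular w) (hw : IsCadlag w) {c : ℝ≥0} (hc : clock β w i T = c)
    (r : ℝ≥0) :
    (timeChange β w (c + r)).mark i = (timeChange β (fun t => w (T + t)) r).mark i ∧
      ∀ j, (timeChange β w (c + r)).part i j ↔
        (timeChange β (fun t => w (T + t)) r).part i j := by
  by_cases h : ∃ u, Live β w i u (c + r)
  · obtain ⟨u, hu⟩ := h
    obtain ⟨v, rfl, hv⟩ := (hr.live_shift hw hc r).1 hu
    have h1 := hr.timeChange_of_live hw hu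
    have h2 := (hr.shift T).timeChange_of_live (hw.shift T) hv
    exact ⟨h1.1.trans h2.1.symm, fun j => (h1.2 j).trans (h2.2 j).symm⟩
  · have h' : ¬∃ v, Live β (fun t => w (T + t)) i v r := fun ⟨v, hv⟩ =>
      h ⟨T + v, (hr.live_shift hw hc r).2 ⟨v, rfl, hv⟩⟩
    have h1 := hr.timeChange_of_not_live hw h
    have h2 := (hr.shift T).timeChange_of_not_live (hw.shift T) h'
    refine ⟨h1.1.trans h2.1.symm, fun j => (h1.2 j).trans (Iff.trans ?_ (h2.2 j).symm)⟩
    exact ⟨fun hs s => hs _, fun hs s => hr.mono (by simp) (hs s)⟩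

end Regular

/-- Regular paths such that a mark whose clock stays bounded tends to `0`. -/
structure Good (β : ℝ) (w : ℝ≥0 → MarkPart) : Prop extends Regular w where
  vanish : ∀ i, (∃ c : ℝ≥0, ∀ u, clock β w i u ≤ c) →
    Tendsto (fun t => (w t).mark i) atTop (𝓝 0)

/-- Suppose the integer is live at all `s < t`. If the corresponding live times are bounded, they
increase strictly to a finite time, where the path has a left limit. Otherwise they go to infinity
with a clock bounded by `t`, and `vanish` gives the limit `0`. The filter `F` treats both cases at
once. -/
theorem Good.exists_left_limit (hg : Good β w) (hw : IsCadlag w) (t : ℝ≥0) (i : ℕ) :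
    ∃ v, Tendsto (fun s => (timeChange β w s).mark i) (𝓝[<] t) (𝓝 v) := by
  have hr := hg.toRegular
  rcases eq_or_ne t 0 with rfl | ht
  · exact ⟨0, by simp⟩
  have ht := pos_iff_ne_zero.2 ht
  by_cases hlive : ∃ s < t, ¬∃ u, Live β w i u s
  · obtain ⟨s, hs, hl⟩ := hlive
    refine ⟨0, tendsto_const_nhds.congr' ?_⟩
    filter_upwards [Ioo_mem_nhdsLT hs] with r hr'
    exact (hr.timeChange_of_not_live hw (hr.not_live_of_le hr'.1.le hl)).1.symm
  push Not at hlive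
  obtain ⟨F, v, hv, hF⟩ : ∃ (F : Filter ℝ≥0) (v : Mark),
      Tendsto (fun u => (w u).mark i) F (𝓝 v) ∧
      ∀ p : ℝ≥0 → Prop, (∀ᶠ u in F, p u) → ∀ᶠ s in 𝓝[<] t, ∃ u, Live β w i u s ∧ p u := by
    by_cases hb : BddAbove {u | ∃ s < t, Live β w i u s}
    · obtain ⟨u₀, hu₀⟩ := hlive 0 ht
      have hne : {u | ∃ s < t, Live β w i u s}.Nonempty := ⟨u₀, 0, ht, hu₀⟩
      set U := sSup {u | ∃ s < t, Live β w i u s}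
      have hltU : ∀ s < t, ∀ u, Live β w i u s → u < U := fun s hs u hu => by
        obtain ⟨s', hs1, hs2⟩ := exists_between hs
        obtain ⟨u', hu'⟩ := hlive s' hs2
        exact (live_lt hu' hu hs1).trans_le (le_csSup hb ⟨s', hs2, hu'⟩)
      obtain ⟨v, hv⟩ := hw.exists_left_mark U i
      refine ⟨𝓝[<] U, v, hv, fun p hp => ?_⟩
      have hU0 : 0 < U := lt_of_le_of_lt zero_le (hltU 0 ht u₀ hu₀)
      obtain ⟨a, ha, hball⟩ := (mem_nhdsLT_iff_exists_Ioo_subset' hU0).1 hp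
      obtain ⟨u₁, ⟨s₁, hs₁, hl₁⟩, hau⟩ := exists_lt_of_lt_csSup hne ha
      filter_upwards [Ioo_mem_nhdsLT hs₁] with s hs
      obtain ⟨u, hu⟩ := hlive s hs.2
      exact ⟨u, hu, hball ⟨hau.trans (live_lt hu hl₁ hs.1), hltU s hs.2 u hu⟩⟩
    · have hunb : ∀ a, ∃ u, a < u ∧ ∃ s < t, Live β w i u s := fun a => by
        obtain ⟨u, hu, hau⟩ := not_bddAbove_iff.1 hb a
        exact ⟨u, hau, hu⟩
      refine ⟨atTop, 0, hg.vanish i ⟨t, fun u => ?_⟩, fun p hp => ?_⟩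
      · obtain ⟨u', huu', s, hs, hl⟩ := hunb u
        refine (clock_mono β w i huu'.le).trans ?_
        rw [hl.2]
        exact_mod_cast hs.le
      · obtain ⟨a, ha⟩ := eventually_atTop.1 hp
        obtain ⟨u₁, hau, s₁, hs₁, hl₁⟩ := hunb a
        filter_upwards [Ioo_mem_nhdsLT hs₁] with s hs
        obtain ⟨u, hu⟩ := hlive s hs.2
        exact ⟨u, hu, ha u (hau.le.trans (live_lt hu hl₁ hs.1).le)⟩
  refine ⟨v, fun N hN => mem_map.2 ?_⟩
  filter_upwards [hF _ (hv.eventually_mem hN)] with s hs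
  obtain ⟨u, hu, hN'⟩ := hs
  rw [Set.mem_preimage, (hr.timeChange_of_live hw hu).1]
  exact hN'

/-- The time change of a good path is right-continuous with left limits. -/
theorem Good.isCadlag_timeChange (hg : Good β w) (hw : IsCadlag w) :
    IsCadlag (timeChange β w) := by
  have hr := hg.toRegular
  have hr' := hr.regular_timeChange (β := β) hw
  refine isCadlag_of_coords (fun t i j => ?_) (fun t i => ?_) (fun t i j => ?_)
    (hg.exists_left_limit hw)
  · by_cases h : ∃ u, Live β w i u t
    · obtain ⟨u, hu⟩ := h
      have hp : ∀ᶠ v in 𝓝[>] u, ((w v).part i j ↔ (w u).part i j) :=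
        (MarkPart.tendsto_iff.1 (hw u).1).1 i j
      filter_upwards [hr.eventually_live_right hw hu hp] with s hs
      obtain ⟨v, hv, hvu⟩ := hs
      rw [(hr.timeChange_of_live hw hu).2, (hr.timeChange_of_live hw hv).2, hvu]
    · filter_upwards [self_mem_nhdsWithin] with s hs
      rw [(hr.timeChange_of_not_live hw h).2,
        (hr.timeChange_of_not_live hw (hr.not_live_of_le (le_of_lt hs) h)).2]
  · by_cases h : ∃ u, Live β w i u t
    · obtain ⟨u, hu⟩ := h
      intro N hN
      rw [(hr.timeChange_of_live hw hu).1] at hN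
      have hp := ((MarkPart.tendsto_iff.1 (hw u).1).2 i).eventually_mem hN
      refine mem_map.2 ?_
      filter_upwards [hr.eventually_live_right hw hu hp] with s hs
      obtain ⟨v, hv, hvu⟩ := hs
      rw [Set.mem_preimage, (hr.timeChange_of_live hw hv).1]
      exact hvu
    · rw [(hr.timeChange_of_not_live hw h).1]
      refine tendsto_const_nhds.congr' ?_
      filter_upwards [self_mem_nhdsWithin] with s hs
      exact (hr.timeChange_of_not_live hw (hr.not_live_of_le (le_of_lt hs) h)).1.symm
  · by_cases h : ∃ s < t, ¬(timeChange β w s).part i j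
    · obtain ⟨s, hs, hn⟩ := h
      refine Or.inr ?_
      filter_upwards [Ioo_mem_nhdsLT hs] with r hr1 hr2
      exact hn (hr'.mono hr1.1.le hr2)
    · push Not at h
      exact Or.inl (eventually_nhdsWithin_of_forall h)

end MarkPart

/-! ### The time change commutes with fragmentation and with permutations. -/

namespace MarkPart

variable {β : ℝ} {w : ℝ≥0 → MarkPart} {i j : ℕ} {s t u v T : ℝ≥0}

theorem tau_zero (β : ℝ) (w : ℝ≥0 → MarkPart) (i : ℕ) : tau β w 0 i = 0 := by
  refine le_antisymm (sInf_le ⟨0, by simp, ?_⟩) zero_le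
  rw [clock_zero]; simp

theorem timeChange_zero (β : ℝ) (w : ℝ≥0 → MarkPart) : timeChange β w 0 = w 0 := by
  refine MarkPart.ext (Setoid.ext fun i j => ?_) (funext fun i => ?_)
  · change tau β w 0 i = tau β w 0 j ∧ (atTime w (tau β w 0 i)).part i j ↔ _
    rw [tau_zero, tau_zero]
    exact and_iff_right rfl
  · change (atTime w (tau β w 0 i)).mark i = _
    rw [tau_zero]
    rfl

theorem tau_eq_iInf (β : ℝ) (w : ℝ≥0 → MarkPart) (t : ℝ≥0) (i : ℕ) :
    tau β w t i = ⨅ (u : ℝ≥0) (_ : clock β w i u = t), (u : ℝ≥0∞) := by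
  refine le_antisymm (le_iInf₂ fun u hu => sInf_le ⟨u, rfl, hu⟩) (le_sInf ?_)
  rintro _ ⟨u, rfl, hu⟩
  exact iInf₂_le u hu

theorem tau_scale {w' : ℝ≥0 → MarkPart} {c d : ℝ≥0} (hc : 0 < c) (i : ℕ)
    (h : ∀ u, clock β w' i u = t ↔ clock β w i (c * u) = d) :
    tau β w' t i = (c⁻¹ : ℝ≥0) * tau β w d i := by
  rw [tau_eq_iInf, tau_eq_iInf]
  refine le_antisymm ?_ (le_iInf₂ fun u hu => ?_)
  · rw [ENNReal.coe_inv hc.ne', ← ENNReal.mul_le_mul_iff_right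
      (a := (c : ℝ≥0∞)) (by exact_mod_cast hc.ne') ENNReal.coe_ne_top, ← mul_assoc,
      ENNReal.mul_inv_cancel (by exact_mod_cast hc.ne') ENNReal.coe_ne_top, _root_.one_mul]
    refine le_iInf₂ fun u hu => ?_
    have hu' : clock β w' i (c⁻¹ * u) = t := by
      rw [h, mul_inv_cancel_left₀ hc.ne', hu]
    calc (c : ℝ≥0∞) * _ ≤ c * ((c⁻¹ * u : ℝ≥0) : ℝ≥0∞) := by
          gcongr
          exact iInf₂_le (f := fun (u : ℝ≥0) (_ : clock β w' i u = t) => (u : ℝ≥0∞)) _ hu'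
      _ = u := by
        rw [← ENNReal.coe_mul, mul_inv_cancel_left₀ hc.ne']
  · calc ((c⁻¹ : ℝ≥0) : ℝ≥0∞) * _ ≤ (c⁻¹ : ℝ≥0) * ((c * u : ℝ≥0) : ℝ≥0∞) := by
          gcongr
          exact iInf₂_le (f := fun (u : ℝ≥0) (_ : clock β w i u = d) => (u : ℝ≥0∞)) _
            ((h u).1 hu)
      _ = u := by rw [← ENNReal.coe_mul, inv_mul_cancel_left₀ hc.ne']

/-- The factor `v ^ β` comes from the multiplication of the marks by `v`, and `v ^ (-α)` from the
substitution in time. Hence the inner clock must run up to `v ^ (α - β) * t`, which is where the new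
index appears in `tau_ssFrag`. -/
theorem clock_ssFrag {x : MarkPart} {i : ℕ} (hx : x.mark i ≠ 0) (α β : ℝ)
    (f : ℕ → ℝ≥0 → MarkPart) (u : ℝ≥0) :
    clock β (ssFrag α x f) i u = ((x.mark i).pow (β - α) : ℝ≥0) *
      clock β (f (x.blockLabel i)) i ((x.mark i).pow α * u) := by
  have hc := Mark.pow_pos hx α
  have h1 : clock β (ssFrag α x f) i u = ((x.mark i).pow β : ℝ≥0) *
      clock β (fun t => f (x.blockLabel i) ((x.mark i).pow α * t)) i u := by
    simp only [clock]
    rw [← lintegral_const_mul' _ _ ENNReal.coe_ne_top]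
    congr 1
    ext s
    rw [← ENNReal.coe_mul, ← Mark.pow_mul]
    rfl
  rw [h1, clock_const_mul hc, ← mul_assoc, ← ENNReal.coe_mul]
  congr 3
  rw [Mark.pow_of_ne hx, Mark.pow_of_ne hx, Mark.pow_of_ne hx, NNReal.rpow_sub (Mark.val_pos hx).ne',
    div_eq_mul_inv]

theorem tau_ssFrag {x : MarkPart} {i : ℕ} (hx : x.mark i ≠ 0) (α β : ℝ)
    (f : ℕ → ℝ≥0 → MarkPart) (t : ℝ≥0) :
    tau β (ssFrag α x f) t i = (((x.mark i).pow α)⁻¹ : ℝ≥0) *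
      tau β (f (x.blockLabel i)) ((x.mark i).pow (α - β) * t) i := by
  refine tau_scale (Mark.pow_pos hx α) i fun u => ?_
  rw [clock_ssFrag hx]
  have hne := (Mark.pow_pos hx (β - α)).ne'
  have e : ((x.mark i).pow (α - β) * t : ℝ≥0) = ((x.mark i).pow (β - α))⁻¹ * t := by
    rw [Mark.pow_of_ne hx, Mark.pow_of_ne hx, ← NNReal.rpow_neg, neg_sub]
  rw [e, ENNReal.coe_mul, ENNReal.coe_inv hne]
  rw [← ENNReal.div_eq_inv_mul,
    ENNReal.eq_div_iff (by exact_mod_cast hne) ENNReal.coe_ne_top]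

theorem tau_of_dead {x : MarkPart} {i : ℕ} (hx : x.mark i = 0) (α β : ℝ)
    (f : ℕ → ℝ≥0 → MarkPart) (ht : t ≠ 0) : tau β (ssFrag α x f) t i = ⊤ := by
  refine sInf_eq_top.2 ?_
  rintro _ ⟨u, rfl, hu⟩
  rw [clock_eq_zero] at hu
  · exact absurd hu.symm (by exact_mod_cast ht)
  · intro s _
    change x.mark i * _ = 0
    rw [hx, Mark.zero_mul]

/-- The time change of a fragmentation is the fragmentation, with another index, of the time
changes. -/
theorem timeChange_ssFrag (α β : ℝ) (x : MarkPart) (f : ℕ → ℝ≥0 → MarkPart) (t : ℝ≥0) :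
    timeChange β (ssFrag α x f) t = ssFrag (α - β) x (fun k => timeChange β (f k)) t := by
  have key : ∀ i, (timeChange β (ssFrag α x f) t).mark i =
        (ssFrag (α - β) x (fun k => timeChange β (f k)) t).mark i ∧
      ∀ j, x.part i j → ((atTime (ssFrag α x f) (tau β (ssFrag α x f) t i)).part i j ↔
        (atTime (f (x.blockLabel i)) (tau β (f (x.blockLabel i))
          ((x.mark i).pow (α - β) * t) i)).part i j) := by
    intro i
    change (atTime (ssFrag α x f) (tau β (ssFrag α x f) t i)).mark i = x.mark i *
      (atTime (f (x.blockLabel i)) (tau β (f (x.blockLabel i))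
          ((x.mark i).pow (α - β) * t) i)).mark i ∧ _
    -- With mark `0` both sides are frozen. The convention `0 ^ a = 0` evaluates the inner path at
    -- time `0`, whereas the outer `tau` is `0` or `⊤` according to whether `t = 0`; the fragmented
    -- block is the same at all these times.
    by_cases hx : x.mark i = 0
    · rw [hx, Mark.pow_zero_left, MulZeroClass.zero_mul, tau_zero, Mark.zero_mul]
      have hp : ∀ s j, x.part i j → ((ssFrag α x f s).part i j ↔
          (f (x.blockLabel i) 0).part i j) := fun s j hj => by
        change x.part i j ∧ (f (x.blockLabel i) ((x.mark i).pow α * s)).part i j ↔ _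
        rw [hx, Mark.pow_zero_left, MulZeroClass.zero_mul]
        exact and_iff_right hj
      by_cases ht : t = 0
      · subst ht
        rw [tau_zero]
        refine ⟨?_, hp 0⟩
        change x.mark i * _ = 0
        rw [hx, Mark.zero_mul]
      · rw [tau_of_dead hx α β f ht]
        refine ⟨rfl, fun j hj => ?_⟩
        change (∀ᶠ s in atTop, (ssFrag α x f s).part i j) ↔ _
        simp only [hp _ j hj, eventually_const]
        rfl
    · have hc := Mark.pow_pos hx α
      rw [tau_ssFrag hx]
      set τ := tau β (f (x.blockLabel i)) ((x.mark i).pow (α - β) * t) i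
      rcases eq_or_ne τ ⊤ with h | h
      · rw [h, ENNReal.mul_top (by exact_mod_cast (inv_pos.2 hc).ne')]
        refine ⟨(Mark.mul_eq_zero.2 (Or.inr rfl)).symm, fun j hj => ?_⟩
        change (∀ᶠ s in atTop, x.part i j ∧
          (f (x.blockLabel i) ((x.mark i).pow α * s)).part i j) ↔
          ∀ᶠ s in atTop, (f (x.blockLabel i) s).part i j
        simp only [hj, true_and]
        constructor
        · intro hs
          have h1 : Tendsto (fun s : ℝ≥0 => ((x.mark i).pow α)⁻¹ * s) atTop atTop :=
            tendsto_id.const_mul_atTop (inv_pos.2 hc)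
          filter_upwards [h1.eventually hs] with s hs
          rwa [mul_inv_cancel_left₀ hc.ne'] at hs
        · intro hs
          exact (tendsto_id.const_mul_atTop hc).eventually hs
      · obtain ⟨a, ha⟩ : ∃ a : ℝ≥0, (a : ℝ≥0∞) = τ := ⟨_, ENNReal.coe_toNNReal h⟩
        rw [← ha, ← ENNReal.coe_mul]
        have e : (x.mark i).pow α * (((x.mark i).pow α)⁻¹ * a) = a :=
          mul_inv_cancel_left₀ hc.ne' a
        constructor
        · change x.mark i * (f (x.blockLabel i)
            ((x.mark i).pow α * (((x.mark i).pow α)⁻¹ * a))).mark i = _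
          rw [e]
          rfl
        · intro j hj
          change x.part i j ∧ (f (x.blockLabel i)
            ((x.mark i).pow α * (((x.mark i).pow α)⁻¹ * a))).part i j ↔ _
          rw [e, and_iff_right hj]
          rfl
  refine MarkPart.ext (Setoid.ext fun i j => ?_) (funext fun i => (key i).1)
  change tau β (ssFrag α x f) t i = tau β (ssFrag α x f) t j ∧
      (atTime (ssFrag α x f) (tau β (ssFrag α x f) t i)).part i j ↔
    x.part i j ∧ tau β (f (x.blockLabel i)) ((x.mark i).pow (α - β) * t) i =
      tau β (f (x.blockLabel i)) ((x.mark i).pow (α - β) * t) j ∧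
      (atTime (f (x.blockLabel i)) (tau β (f (x.blockLabel i))
          ((x.mark i).pow (α - β) * t) i)).part i j
  by_cases hj : x.part i j
  · rw [(key i).2 j hj]
    have hτ : tau β (ssFrag α x f) t i = tau β (ssFrag α x f) t j ↔
        tau β (f (x.blockLabel i)) ((x.mark i).pow (α - β) * t) i =
        tau β (f (x.blockLabel i)) ((x.mark i).pow (α - β) * t) j := by
      have hm := x.mark_eq hj
      by_cases hx : x.mark i = 0
      · rw [hx, Mark.pow_zero_left, MulZeroClass.zero_mul, tau_zero, tau_zero]
        refine iff_of_true ?_ rfl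
        by_cases ht : t = 0
        · rw [ht, tau_zero, tau_zero]
        · rw [tau_of_dead hx α β f ht, tau_of_dead (hm ▸ hx) α β f ht]
      · have hx' : x.mark j ≠ 0 := hm ▸ hx
        have hc : 0 < ((x.mark j).pow α)⁻¹ := inv_pos.2 (Mark.pow_pos hx' α)
        rw [tau_ssFrag hx, tau_ssFrag hx', hm, blockLabel_eq hj]
        exact ENNReal.mul_right_inj (by exact_mod_cast hc.ne') ENNReal.coe_ne_top
    rw [hτ]
    exact (and_iff_right hj).symm
  · refine iff_of_false (fun h => hj ?_) fun h => hj h.1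
    have h2 := h.2
    rcases eq_or_ne (tau β (ssFrag α x f) t i) ⊤ with h3 | h3
    · rw [h3] at h2
      have h2' : ∀ᶠ s in atTop, (ssFrag α x f s).part i j := h2
      obtain ⟨s, hs⟩ := h2'.exists
      exact hs.1
    · obtain ⟨a, ha⟩ : ∃ a : ℝ≥0, (a : ℝ≥0∞) = tau β (ssFrag α x f) t i :=
        ⟨_, ENNReal.coe_toNNReal h3⟩
      rw [← ha] at h2
      have h2' : (ssFrag α x f a).part i j := h2
      exact h2'.1

theorem timeChange_perm (β : ℝ) (w : ℝ≥0 → MarkPart) (σ : Equiv.Perm ℕ) (t : ℝ≥0) :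
    timeChange β (fun s => (w s).perm σ) t = (timeChange β w t).perm σ := by
  have hτ : ∀ i, tau β (fun s => (w s).perm σ) t i = tau β w t (σ i) := fun i => rfl
  have ha : ∀ r, atTime (fun s => (w s).perm σ) r = (atTime w r).perm σ := by
    intro r
    cases r with
    | top => rfl
    | coe r => rfl
  refine MarkPart.ext (Setoid.ext fun i j => ?_) (funext fun i => ?_)
  · change tau β (fun s => (w s).perm σ) t i = tau β (fun s => (w s).perm σ) t j ∧
      (atTime (fun s => (w s).perm σ) (tau β (fun s => (w s).perm σ) t i)).part i j ↔ _
    rw [hτ, hτ, ha]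
    rfl
  · change (atTime (fun s => (w s).perm σ) (tau β (fun s => (w s).perm σ) t i)).mark i = _
    rw [hτ, ha]
    rfl

end MarkPart

/-! ### Path properties that can be checked on countably many times. -/

/-- A dense sequence of times. -/
def grid : ℕ → ℝ≥0 := TopologicalSpace.denseSeq ℝ≥0

theorem exists_grid_btwn {a b : ℝ≥0} (h : a < b) : ∃ n, a < grid n ∧ grid n < b := by
  obtain ⟨n, hn⟩ := (TopologicalSpace.denseRange_denseSeq ℝ≥0).exists_mem_open
    isOpen_Ioo (Set.nonempty_Ioo.2 h)
  exact ⟨n, hn⟩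

theorem exists_grid_right {p : ℝ≥0 → Prop} {s b : ℝ≥0} (hp : ∀ᶠ r in 𝓝[≥] s, p r) (h : s < b) :
    ∃ n, s < grid n ∧ grid n < b ∧ p (grid n) := by
  obtain ⟨d, hd, hball⟩ := (nhdsGE_basis s).mem_iff.1 hp
  obtain ⟨n, hn1, hn2⟩ := exists_grid_btwn (lt_min hd h)
  exact ⟨n, hn1, hn2.trans_le (min_le_right _ _),
    hball ⟨hn1.le, hn2.trans_le (min_le_left _ _)⟩⟩

namespace MarkPart

variable {β : ℝ} {w : ℝ≥0 → MarkPart} {i j : ℕ} {s t u v T : ℝ≥0}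

/-- Right-continuity carries each property from grid times, taken slightly to the right, to all
times. The countable form is what almost-sure arguments and measurability can handle. -/
theorem regular_of_grid (hw : IsCadlag w)
    (h1 : ∀ m n i j, grid m ≤ grid n → (w (grid n)).part i j → (w (grid m)).part i j)
    (h2 : ∀ n i, (w (grid n)).mark i ≠ 0 →
      ∃ k : ℕ, ∀ m, grid m ≤ grid n → 1 / ((k : ℝ≥0) + 1) ≤ ((w (grid m)).mark i).size)
    (h3 : ∀ m n i j, grid m ≤ grid n → (w (grid m)).mark i = 0 → (w (grid m)).part i j →
      (w (grid n)).part i j) : Regular w := by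
  have haway : ∀ {i : ℕ} {t : ℝ≥0}, (w t).mark i ≠ 0 →
      ∃ e > 0, ∀ s ≤ t, e ≤ ((w s).mark i).size := by
    intro i t ht
    obtain ⟨n, hn1, -, hn2⟩ := exists_grid_right ((hw.tendsto_mark t i).eventually_ne ht)
      (lt_add_one t)
    obtain ⟨k, hk⟩ := h2 n i hn2
    refine ⟨1 / ((k : ℝ≥0) + 1), by positivity, fun s hs => ?_⟩
    by_contra hlt
    have hsz := (Mark.continuous_size.tendsto _).comp (hw.tendsto_mark s i)
    obtain ⟨m, -, hm1, hm2⟩ := exists_grid_right (hsz.eventually_lt_const (not_le.1 hlt))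
      (hs.trans_lt hn1)
    exact absurd (hk m hm1.le) (not_le.2 hm2)
  have hzero : ∀ {i : ℕ} {s t : ℝ≥0}, s ≤ t → (w s).mark i = 0 → (w t).mark i = 0 := by
    intro i s t hst hs
    by_contra hne
    obtain ⟨e, he, h⟩ := haway hne
    have := h s hst
    rw [hs, Mark.size_zero] at this
    exact he.ne' (le_antisymm this zero_le)
  refine ⟨fun {s t} hst {i j} h => ?_, haway, fun {i j s t} hst h0 h => ?_⟩
  · rcases hst.eq_or_lt with rfl | hst
    · exact h
    obtain ⟨n, hn1, -, hn2⟩ := exists_grid_right (hw.eventually_part t i j) (lt_add_one t)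
    obtain ⟨m, -, hm1, hm2⟩ := exists_grid_right (hw.eventually_part s i j) (hst.trans hn1)
    exact hm2.1 (h1 m n i j hm1.le (hn2.2 h))
  · rcases hst.eq_or_lt with rfl | hst
    · exact h
    obtain ⟨n, hn1, -, hn2⟩ := exists_grid_right (hw.eventually_part t i j) (lt_add_one t)
    obtain ⟨m, hm0, hm1, hm2⟩ := exists_grid_right (hw.eventually_part s i j) (hst.trans hn1)
    exact hn2.1 (h3 m n i j hm1.le (hzero hm0.le h0) (hm2.2 h))

theorem vanish_of_grid (hw : IsCadlag w)
    (h : ∀ k : ℕ, ∃ N : ℕ, ∀ n, (N : ℝ≥0) ≤ grid n →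
      ((w (grid n)).mark i).size ≤ 1 / ((k : ℝ≥0) + 1)) :
    Tendsto (fun t => (w t).mark i) atTop (𝓝 0) := by
  rw [Mark.tendsto_zero_iff]
  refine tendsto_order.2 ⟨fun a ha => absurd ha not_lt_zero, fun a ha => ?_⟩
  obtain ⟨k, hk⟩ := NNReal.exists_nat_pos_inv_lt (b := a) ha
  obtain ⟨N, hN⟩ := h k
  filter_upwards [eventually_ge_atTop (N : ℝ≥0)] with t ht
  by_contra hlt
  have hka : 1 / ((k : ℝ≥0) + 1) < a := by
    refine lt_of_le_of_lt ?_ hk.2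
    rw [one_div]
    exact inv_anti₀ (by exact_mod_cast hk.1) (by simp)
  have hsz := (Mark.continuous_size.tendsto _).comp (hw.tendsto_mark t i)
  obtain ⟨m, hm0, -, hm2⟩ := exists_grid_right
    (hsz.eventually_const_lt (hka.trans_le (not_lt.1 hlt))) (lt_add_one t)
  exact absurd (hN m (ht.trans hm0.le)) (not_le.2 hm2)

end MarkPart

/-! ## Measurability of the time change -/

theorem measurable_clock_of_mark {S : Type*} [MeasurableSpace S] (β : ℝ) {V : ℝ≥0 → S → Mark}
    (hV : Measurable fun p : ℝ≥0 × S => V p.1 p.2) :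
    Measurable fun p : ℝ≥0 × S =>
      ∫⁻ s in Set.Icc (0 : ℝ) p.1, ((V s.toNNReal p.2).pow β : ℝ≥0∞) := by
  have h1 : Measurable fun q : (ℝ≥0 × S) × ℝ => ((V q.2.toNNReal q.1.2).pow β : ℝ≥0∞) :=
    ((Mark.measurable_pow β).comp (hV.comp (measurable_snd.real_toNNReal.prodMk
      (measurable_snd.comp measurable_fst)))).coe_nnreal_ennreal
  have h2 : MeasurableSet {q : (ℝ≥0 × S) × ℝ | q.2 ∈ Set.Icc (0 : ℝ) q.1.1} :=
    (measurableSet_le measurable_const measurable_snd).inter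
      (measurableSet_le measurable_snd (measurable_fst.comp measurable_fst).coe_nnreal_real)
  have h3 := (h1.indicator h2).lintegral_prod_right' (ν := (volume : Measure ℝ))
  have e : (fun p : ℝ≥0 × S => ∫⁻ s in Set.Icc (0 : ℝ) p.1, ((V s.toNNReal p.2).pow β : ℝ≥0∞)) =
      fun p => ∫⁻ s, {q : (ℝ≥0 × S) × ℝ | q.2 ∈ Set.Icc (0 : ℝ) q.1.1}.indicator
        (fun q => ((V q.2.toNNReal q.1.2).pow β : ℝ≥0∞)) (p, s) := by
    funext p
    rw [← lintegral_indicator measurableSet_Icc]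
    rfl
  rw [e]
  exact h3

theorem measurable_clock (β : ℝ) (i : ℕ) :
    Measurable fun p : ℝ≥0 × Path => clock β p.2.1 i p.1 :=
  measurable_clock_of_mark β (V := fun t (w : Path) => (w.1 t).mark i)
    ((measurable_mark i).comp measurable_eval)

namespace MarkPart

variable {β : ℝ} {w : ℝ≥0 → MarkPart} {i j : ℕ} {s t u v T : ℝ≥0}

/-- The clock, when it is finite, is continuous from the right. -/
theorem le_clock_of_forall_gt {a : ℝ≥0∞} (hfin : ∃ v > s, clock β w i v ≠ ⊤)
    (h : ∀ u > s, a ≤ clock β w i u) : a ≤ clock β w i s := by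
  have hI : Set.Icc (0 : ℝ) s = ⋂ n : ℕ, Set.Icc (0 : ℝ) ((s + 1 / ((n : ℝ≥0) + 1) : ℝ≥0) : ℝ) := by
    ext r
    simp only [Set.mem_Icc, Set.mem_iInter]
    constructor
    · rintro ⟨h1, h2⟩ n
      refine ⟨h1, h2.trans ?_⟩
      rw [NNReal.coe_le_coe]
      simp
    · intro hr
      refine ⟨(hr 0).1, le_of_forall_pos_le_add fun e he => ?_⟩
      obtain ⟨n, hn⟩ := exists_nat_one_div_lt he
      have := (hr n).2
      push_cast at this
      linarith
  have hanti : Antitone fun n : ℕ =>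
      Set.Icc (0 : ℝ) ((s + 1 / ((n : ℝ≥0) + 1) : ℝ≥0) : ℝ) := by
    intro m n hmn
    refine Set.Icc_subset_Icc le_rfl ?_
    rw [NNReal.coe_le_coe]
    gcongr
  obtain ⟨v, hv, hvfin⟩ := hfin
  obtain ⟨n₀, hn₀⟩ : ∃ n : ℕ, s + 1 / ((n : ℝ≥0) + 1) ≤ v := by
    obtain ⟨n, hn⟩ := exists_nat_one_div_lt (sub_pos.2 (NNReal.coe_lt_coe.2 hv))
    refine ⟨n, ?_⟩
    rw [← NNReal.coe_le_coe]
    push_cast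
    linarith
  rw [clock_eq_measure, hI, hanti.measure_iInter (fun n => measurableSet_Icc.nullMeasurableSet)
    ⟨n₀, ?_⟩]
  · refine le_iInf fun n => ?_
    rw [← clock_eq_measure]
    refine h _ ?_
    simp only [gt_iff_lt, lt_add_iff_pos_right]
    positivity
  · rw [← clock_eq_measure]
    exact ne_top_of_le_ne_top hvfin (clock_mono β w i hn₀)

/-- This expresses the event that `tau` is at most `s` by the clock at grid times not exceeding `s`,
so that `tau` is a stopping time of the raw filtration. No regularity is assumed; values of the
clock beyond `t`, possibly infinite, are discarded by the condition in the supremum. -/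
theorem tau_le_iff (β : ℝ) (w : ℝ≥0 → MarkPart) (t : ℝ≥0) (i : ℕ) (s : ℝ≥0) :
    tau β w t i ≤ s ↔ (⨆ (n : ℕ) (_ : grid n ≤ s ∧ clock β w i (grid n) ≤ t),
      clock β w i (grid n)) = t := by
  have hsup : (⨆ (n : ℕ) (_ : grid n ≤ s ∧ clock β w i (grid n) ≤ t),
      clock β w i (grid n)) ≤ t := iSup₂_le fun n hn => hn.2
  have hlow : ∀ u ≤ s, clock β w i u = t → (t : ℝ≥0∞) ≤
      ⨆ (n : ℕ) (_ : grid n ≤ s ∧ clock β w i (grid n) ≤ t), clock β w i (grid n) := by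
    intro u hu hut
    rw [← hut]
    refine clock_le_of_forall_lt fun r hr => ?_
    obtain ⟨n, hn1, hn2⟩ := exists_grid_btwn hr
    refine (clock_mono β w i hn1.le).trans (le_iSup₂_of_le n ⟨hn2.le.trans hu, ?_⟩ le_rfl)
    exact clock_mono β w i hn2.le
  constructor
  · intro h
    refine le_antisymm hsup ?_
    by_cases hex : ∃ u ≤ s, clock β w i u = t
    · obtain ⟨u, hu, hut⟩ := hex
      exact hlow u hu hut
    · push Not at hex
      -- The infimum may be at most `s` without the value `t` being taken by time `s`. Then `t` is
      -- taken arbitrarily soon after `s`, the clock is finite there, and right continuity gives the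
      -- value `t` at `s` itself, a contradiction.
      have hright : ∀ v > s, ∃ u, u ≤ v ∧ s < u ∧ clock β w i u = t := fun v hv => by
        have hlt : tau β w t i < v := h.trans_lt (by exact_mod_cast hv)
        obtain ⟨_, ⟨u, rfl, hut⟩, huv⟩ := sInf_lt_iff.1 hlt
        have huv' : u ≤ v := by exact_mod_cast huv.le
        have hsu : s < u := lt_of_not_ge fun hus => hex u hus hut
        exact ⟨u, huv', hsu, hut⟩
      refine absurd (?_ : clock β w i s = t) (hex s le_rfl)
      have hfin : (∃ v, s < v ∧ clock β w i v = t) → ∃ v > s, clock β w i v ≠ ⊤ :=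
        fun ⟨v, hv, hvt⟩ => ⟨v, hv, by rw [hvt]; exact ENNReal.coe_ne_top⟩
      obtain ⟨v, -, hv2, hvt⟩ := hright (s + 1) (lt_add_one s)
      refine le_antisymm ?_ (le_clock_of_forall_gt (hfin ⟨v, hv2, hvt⟩) fun u hu => ?_)
      · rw [← hvt]
        exact clock_mono β w i hv2.le
      · obtain ⟨u', hu', -, hut⟩ := hright u hu
        rw [← hut]
        exact clock_mono β w i hu'
  · intro h
    set D : Set ℝ≥0 := {u | u ≤ s ∧ clock β w i u ≤ t}
    have hne : D.Nonempty := ⟨0, zero_le, by rw [clock_zero]; exact zero_le⟩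
    have hbdd : BddAbove D := ⟨s, fun u hu => hu.1⟩
    have h1 : clock β w i (sSup D) ≤ t := clock_le_of_forall_lt fun r hr => by
      obtain ⟨u, hu, hru⟩ := exists_lt_of_lt_csSup hne hr
      exact (clock_mono β w i hru.le).trans hu.2
    have h2 : (t : ℝ≥0∞) ≤ clock β w i (sSup D) := by
      rw [← h]
      exact iSup₂_le fun n hn => clock_mono β w i (le_csSup hbdd hn)
    have h3 : tau β w t i ≤ (sSup D : ℝ≥0) := sInf_le ⟨sSup D, rfl, le_antisymm h1 h2⟩
    refine h3.trans ?_
    exact_mod_cast csSup_le hne fun u hu => hu.1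

end MarkPart

theorem measurableSet_tau_le {S : Type*} [MeasurableSpace S] {β : ℝ} {Z : S → ℝ≥0 → MarkPart}
    {i : ℕ} {s : ℝ≥0} (h : ∀ u ≤ s, Measurable fun ω => clock β (Z ω) i u) (t : ℝ≥0) :
    MeasurableSet {ω | tau β (Z ω) t i ≤ s} := by
  simp only [tau_le_iff]
  refine measurableSet_eq_fun (Measurable.iSup fun n => ?_) measurable_const
  by_cases hn : grid n ≤ s
  · have hm := h _ hn
    have e : (fun ω => ⨆ (_ : grid n ≤ s ∧ clock β (Z ω) i (grid n) ≤ t), clock β (Z ω) i (grid n))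
        = {ω | clock β (Z ω) i (grid n) ≤ t}.indicator fun ω => clock β (Z ω) i (grid n) := by
      funext ω
      by_cases hc : clock β (Z ω) i (grid n) ≤ t
      · rw [Set.indicator_of_mem (by exact hc)]
        simp [hn, hc]
      · rw [Set.indicator_of_notMem (by exact hc)]
        simp [hc]
    rw [e]
    exact hm.indicator (measurableSet_le hm measurable_const)
  · simp [hn]

theorem measurable_tau (β : ℝ) (t : ℝ≥0) (i : ℕ) : Measurable fun w : Path => tau β w.1 t i := by
  refine measurable_of_Iic fun a => ?_
  induction a using ENNReal.recTopCoe with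
  | top => simp
  | coe s => exact measurableSet_tau_le (fun u _ => (measurable_clock β i).comp
      (measurable_const.prodMk measurable_id)) t

/-- The mark of `i` at the time when the clock of `i` equals `t`, when this time is finite. -/
theorem measurable_mark_tau (β : ℝ) (t : ℝ≥0) (i k : ℕ) :
    Measurable fun w : Path => (w.1 (tau β w.1 t i).toNNReal).mark k :=
  (measurable_mark k).comp (measurable_eval_comp (measurable_tau β t i).ennreal_toNNReal
    measurable_id)

theorem measurableSet_regular : MeasurableSet {w : Path | Regular w.1} := by
  have hm : ∀ n i, Measurable fun w : Path => (w.1 (grid n)).mark i := fun n i =>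
    (measurable_mark i).comp (measurable_coord (grid n))
  have hp : ∀ n i j, Measurable fun w : Path => (w.1 (grid n)).part i j := fun n i j =>
    measurableSet_setOfPred.1 (measurable_coord (grid n) (measurableSet_part i j))
  have h0 : ∀ n i, Measurable fun w : Path => (w.1 (grid n)).mark i = 0 := fun n i =>
    measurableSet_setOfPred.1 (hm n i (measurableSet_singleton 0))
  have hs : ∀ n i (a : ℝ≥0), Measurable fun w : Path => a ≤ ((w.1 (grid n)).mark i).size :=
    fun n i a => measurableSet_setOfPred.1
      (measurableSet_le measurable_const (Mark.measurable_size.comp (hm n i)))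
  have e : ∀ w : Path, Regular w.1 ↔
      (∀ m n i j, grid m ≤ grid n → (w.1 (grid n)).part i j → (w.1 (grid m)).part i j) ∧
      (∀ n i, ¬(w.1 (grid n)).mark i = 0 →
        ∃ k : ℕ, ∀ m, grid m ≤ grid n → 1 / ((k : ℝ≥0) + 1) ≤ ((w.1 (grid m)).mark i).size) ∧
      ∀ m n i j, grid m ≤ grid n → (w.1 (grid m)).mark i = 0 → (w.1 (grid m)).part i j →
        (w.1 (grid n)).part i j := by
    intro w
    constructor
    · intro h
      refine ⟨fun m n i j hmn => h.mono hmn, fun n i hne => ?_, fun m n i j hmn => h.frozen hmn⟩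
      obtain ⟨e, he, h'⟩ := h.away hne
      obtain ⟨k, hk⟩ := NNReal.exists_nat_pos_inv_lt (b := e) he
      refine ⟨k, fun m hm => le_trans ?_ (h' _ hm)⟩
      refine le_trans ?_ hk.2.le
      rw [one_div]
      exact inv_anti₀ (by exact_mod_cast hk.1) (by simp)
    · rintro ⟨h1, h2, h3⟩
      exact regular_of_grid w.2 h1 h2 h3
  simp only [e]
  refine measurableSet_setOfPred.2 (Measurable.and ?_ (Measurable.and ?_ ?_))
  · exact .forall fun m => .forall fun n => .forall fun i => .forall fun j =>
      .imp measurable_const (.imp (hp n i j) (hp m i j))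
  · exact .forall fun n => .forall fun i => .imp (h0 n i).not (.exists fun k => .forall fun m =>
      .imp measurable_const (hs m i _))
  · exact .forall fun m => .forall fun n => .forall fun i => .forall fun j =>
      .imp measurable_const (.imp (h0 m i) (.imp (hp m i j) (hp n i j)))

theorem measurableSet_good (β : ℝ) : MeasurableSet {w : Path | Good β w.1} := by
  have hc : ∀ n i, Measurable fun w : Path => clock β w.1 i (grid n) := fun n i =>
    (measurable_clock β i).comp (measurable_const.prodMk measurable_id)
  have hs' : ∀ n i (a : ℝ≥0), Measurable fun w : Path => ((w.1 (grid n)).mark i).size ≤ a :=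
    fun n i a => measurableSet_setOfPred.1
      (measurableSet_le (Mark.measurable_size.comp
        ((measurable_mark i).comp (measurable_coord (grid n)))) measurable_const)
  have hcl : ∀ n i (a : ℝ≥0∞), Measurable fun w : Path => clock β w.1 i (grid n) ≤ a :=
    fun n i a => measurableSet_setOfPred.1 (measurableSet_le (hc n i) measurable_const)
  have e : ∀ w : Path, Good β w.1 ↔ Regular w.1 ∧
      ∀ i, (∃ c : ℕ, ∀ n, clock β w.1 i (grid n) ≤ c) → ∀ k : ℕ, ∃ N : ℕ, ∀ n,
        (N : ℝ≥0) ≤ grid n → ((w.1 (grid n)).mark i).size ≤ 1 / ((k : ℝ≥0) + 1) := by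
    intro w
    constructor
    · intro h
      refine ⟨h.toRegular, fun i ⟨c, hc⟩ k => ?_⟩
      have hv := h.vanish i ⟨c, fun u => by
        obtain ⟨n, hn, -⟩ := exists_grid_btwn (lt_add_one u)
        exact (clock_mono β w.1 i hn.le).trans (by exact_mod_cast hc n)⟩
      rw [Mark.tendsto_zero_iff] at hv
      obtain ⟨a, ha⟩ := eventually_atTop.1
        (hv.eventually_le_const (u := 1 / ((k : ℝ≥0) + 1)) (by positivity))
      exact ⟨⌈a⌉₊, fun n hn => ha _ ((Nat.le_ceil a).trans hn)⟩
    · rintro ⟨h1, h4⟩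
      refine ⟨h1, fun i ⟨c, hc⟩ => vanish_of_grid w.2 (h4 i ⟨⌈c⌉₊, fun n => (hc _).trans ?_⟩)⟩
      exact_mod_cast Nat.le_ceil c
  simp only [e]
  refine measurableSet_regular.inter (measurableSet_setOfPred.2 ?_)
  exact .forall fun i => .imp (.exists fun c => .forall fun n => hcl n i _)
    (.forall fun k => .exists fun N => .forall fun n => .imp measurable_const (hs' n i _))

open Classical in
/-- The time change of a good path, and a constant path for the others. -/
def timeChangePath (β : ℝ) (w : Path) : Path :=
  if h : Good β w.1 then ⟨timeChange β w.1, h.isCadlag_timeChange w.2⟩ else constPath one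

theorem timeChangePath_of_good {β : ℝ} {w : Path} (h : Good β w.1) (t : ℝ≥0) :
    (timeChangePath β w).1 t = timeChange β w.1 t := by
  rw [timeChangePath, dif_pos h]

theorem regular_timeChangePath (β : ℝ) (w : Path) : Regular (timeChangePath β w).1 := by
  rw [timeChangePath]
  split_ifs with h
  · exact h.toRegular.regular_timeChange w.2
  · exact ⟨fun _ _ _ _ => trivial, fun _ => ⟨1, one_pos, fun _ _ => Mark.size_one.ge⟩,
      fun _ _ h => h⟩

theorem measurable_timeChangePath (β : ℝ) : Measurable (timeChangePath β) := by
  refine measurable_toPath.2 fun t => ?_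
  have hev : ∀ i, Measurable fun w : Path => w.1 (tau β w.1 t i).toNNReal := fun i =>
    measurable_eval_comp (measurable_tau β t i).ennreal_toNNReal measurable_id
  have htop : ∀ i, MeasurableSet {w : Path | tau β w.1 t i = ⊤} := fun i =>
    measurable_tau β t i (measurableSet_singleton ⊤)
  refine MarkPart.measurable_iff.2 ⟨fun i j => ?_, fun i => ?_⟩
  · have e : {w : Path | ((timeChangePath β w).1 t).part i j} =
        {w | Good β w.1}ᶜ ∪ {w | Good β w.1} ∩ (({w | tau β w.1 t i = ⊤} ∩
          {w | ∀ n, (w.1 (grid n)).part i j}) ∪ ({w | tau β w.1 t i = ⊤}ᶜ ∩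
          {w | (w.1 (tau β w.1 t i).toNNReal).part i j})) := by
      ext w
      by_cases hg : Good β w.1
      · have hr := hg.toRegular
        have e1 : ((timeChangePath β w).1 t).part i j ↔
            (atTime w.1 (tau β w.1 t i)).part i j := by
          rw [timeChangePath_of_good hg]
          exact and_iff_right_of_imp (hr.tau_congr w.2)
        have e2 : (w ∈ {w : Path | ((timeChangePath β w).1 t).part i j}) ↔
            (atTime w.1 (tau β w.1 t i)).part i j := e1
        rw [e2]
        by_cases hτ : tau β w.1 t i = ⊤
        -- The value at `⊤` is not an evaluation of the path; since partitions refine, being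
        -- together at all large times is the same as being together at all grid times.
        · have e3 : (atTime w.1 ⊤).part i j ↔ ∀ n, (w.1 (grid n)).part i j := by
            change (∀ᶠ s in atTop, (w.1 s).part i j) ↔ _
            constructor
            · intro h n
              obtain ⟨s, hs1, hs2⟩ := (h.and (eventually_ge_atTop (grid n))).exists
              exact hr.mono hs2 hs1
            · intro h
              refine Eventually.of_forall fun s => ?_
              obtain ⟨n, hn, -⟩ := exists_grid_btwn (lt_add_one s)
              exact hr.mono hn.le (h n)
          have e4 : (atTime w.1 (tau β w.1 t i)).part i j ↔ ∀ n, (w.1 (grid n)).part i j := by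
            rw [hτ]; exact e3
          rw [e4]
          simp [hg, hτ]
        · obtain ⟨a, ha⟩ : ∃ a : ℝ≥0, (a : ℝ≥0∞) = tau β w.1 t i :=
            ⟨_, ENNReal.coe_toNNReal hτ⟩
          have e3 : (atTime w.1 a).part i j ↔ (w.1 a).part i j := Iff.rfl
          have e4 : (atTime w.1 (tau β w.1 t i)).part i j ↔
              (w.1 (tau β w.1 t i).toNNReal).part i j := by
            rw [← ha]; exact e3
          rw [e4]
          simp [hg, hτ]
      · have e1 : ((timeChangePath β w).1 t).part i j := by
          rw [timeChangePath, dif_neg hg]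
          trivial
        simp [hg, e1]
    rw [e]
    have hG := measurableSet_good β
    refine hG.compl.union (hG.inter (((htop i).inter ?_).union ((htop i).compl.inter ?_)))
    · exact measurableSet_setOfPred.2 (.forall fun n => measurableSet_setOfPred.1
        (measurable_coord (grid n) (measurableSet_part i j)))
    · exact hev i (measurableSet_part i j)
  · classical
    have e : (fun w : Path => ((timeChangePath β w).1 t).mark i) = fun w : Path =>
        if Good β w.1 then (if tau β w.1 t i = ⊤ then 0 else
          (w.1 (tau β w.1 t i).toNNReal).mark i) else 1 := by
      funext w
      by_cases hg : Good β w.1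
      · rw [timeChangePath_of_good hg, if_pos hg]
        change (atTime w.1 (tau β w.1 t i)).mark i = _
        by_cases hτ : tau β w.1 t i = ⊤
        · rw [if_pos hτ, hτ]; rfl
        · rw [if_neg hτ]
          conv_lhs => rw [← ENNReal.coe_toNNReal hτ]
          rfl
      · rw [if_neg hg, timeChangePath, dif_neg hg]
        rfl
    rw [e]
    exact Measurable.ite (measurableSet_good β) (Measurable.ite (htop i) measurable_const
      ((measurable_mark i).comp (hev i))) measurable_const

/-! ## Laws on the path space -/

/-- The branching property, on the path space. -/
structure BranchLaw (α : ℝ) (Q : Kernel MarkPart Path) : Prop where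
  start : ∀ x, ∀ᵐ w ∂(Q x), w.1 0 = x
  branching : ∀ x, Q x = (Measure.infinitePi fun _ : ℕ => Q one).map (frag α x)

/-- The properties, on the path space, of the laws of an extended self-similar fragmentation
process. -/
structure PathLaw (α : ℝ) (Q : Kernel MarkPart Path) : Prop extends BranchLaw α Q where
  strongMarkov : ∀ (T : Path → WithTop ℝ≥0)
    (hT : IsStoppingTime (history coord measurable_coord) T) (x : MarkPart) (A B : Set Path),
    MeasurableSet[hT.measurableSpace] A → (∀ w ∈ A, T w ≠ ⊤) → MeasurableSet B →
    Q x (A ∩ {w | shift ((T w).untopD 0) w ∈ B}) =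
      ∫⁻ w in A, Q (w.1 ((T w).untopD 0)) B ∂(Q x)
  stochasticallyContinuous : ∀ x t, ∀ U ∈ 𝓝ˢ (Set.diagonal MarkPart),
    Tendsto (fun s => Q x {w | (w.1 s, w.1 t) ∉ U}) (𝓝 t) (𝓝 0)

theorem measurable_path_of_coord {S : Type*} {m : MeasurableSpace S} {f : S → Path}
    (h : ∀ t, Measurable[m] fun a => (f a).1 t) : Measurable[m] f := (@measurable_toPath S m f).2 h

theorem history_le_iSup {E S : Type*} [MeasurableSpace S] [mE : MeasurableSpace E] {Z : ℝ≥0 → S → E}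
    (hZ : ∀ t, Measurable (Z t)) {s t : ℝ≥0} (h : s ≤ t) :
    Measurable[history Z hZ t] (Z s) := by
  have : MeasurableSpace.comap (Z s) mE ≤ history Z hZ t :=
    le_iSup₂_of_le (f := fun s (_ : s ≤ t) => MeasurableSpace.comap (Z s) mE) s h le_rfl
  exact fun B hB => this _ ⟨B, hB, rfl⟩

theorem measurable_stop_history (s : ℝ≥0) :
    Measurable[history coord measurable_coord s] (stopAt s) :=
  measurable_path_of_coord fun t =>
    history_le_iSup measurable_coord (s := min t s) (t := s) (min_le_right _ _)

theorem le_iSup_history : (inferInstance : MeasurableSpace Path) ≤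
    ⨆ t, history coord measurable_coord t := by
  have h : Measurable[⨆ t, history coord measurable_coord t] (id : Path → Path) :=
    measurable_path_of_coord fun t => (history_le_iSup measurable_coord (le_refl t)).mono
      (le_iSup (fun t => (history coord measurable_coord t : MeasurableSpace Path)) t) le_rfl
  exact fun B hB => h hB

theorem stop_apply_of_le {s t : ℝ≥0} (h : t ≤ s) (w : Path) : (stopAt s w).1 t = w.1 t :=
  congrArg w.1 (min_eq_left h)

theorem stop_stop (s t : ℝ≥0) (w : Path) : stopAt s (stopAt t w) = stopAt (min s t) w :=
  Subtype.ext (funext fun r => congrArg w.1 (by rw [min_assoc]))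

/-- A random time of which the comparison with `s` depends only on the path stopped at `s`. -/
def IsStopping (T : Path → ℝ≥0∞) : Prop := ∀ (s : ℝ≥0) w, T w ≤ s ↔ T (stopAt s w) ≤ s

/-- Galmarino's test: the event that `T` is at most `s` is its own preimage under `stopAt s`, a map
that is measurable for the history up to `s`. -/
theorem IsStopping.isStoppingTime {T : Path → ℝ≥0∞} (hT : Measurable T) (h : IsStopping T) :
    IsStoppingTime (history coord measurable_coord) T := fun s => by
  have e : {w | T w ≤ s} = stopAt s ⁻¹' {w | T w ≤ s} := by
    ext w
    exact h s w
  have := measurable_stop_history s (measurableSet_le hT (measurable_const (a := (s : ℝ≥0∞))))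
  rw [← e] at this
  exact this

theorem isStopping_const (s : ℝ≥0) : IsStopping fun _ => s := fun _ _ => Iff.rfl

theorem IsStopping.min {T T' : Path → ℝ≥0∞} (h : IsStopping T) (h' : IsStopping T') :
    IsStopping fun w => min (T w) (T' w) := fun s w => by
  simp only [min_le_iff, h s w, h' s w]

theorem IsStopping.eq_of_le {T : Path → ℝ≥0∞} (h : IsStopping T) {s : ℝ≥0} {w : Path}
    (hs : T w ≤ s) : T (stopAt s w) = T w := by
  have key : ∀ r : ℝ≥0, r ≤ s → (T (stopAt s w) ≤ r ↔ T w ≤ r) := fun r hr => by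
    rw [h r (stopAt s w), stop_stop, min_eq_left hr, h r w]
  have h1 := (h s w).1 hs
  obtain ⟨a, ha⟩ : ∃ a : ℝ≥0, (a : ℝ≥0∞) = T w :=
    ⟨_, ENNReal.coe_toNNReal (hs.trans_lt ENNReal.coe_lt_top).ne⟩
  obtain ⟨b, hb⟩ : ∃ b : ℝ≥0, (b : ℝ≥0∞) = T (stopAt s w) :=
    ⟨_, ENNReal.coe_toNNReal (h1.trans_lt ENNReal.coe_lt_top).ne⟩
  rw [← ha] at hs ⊢
  rw [← hb] at h1 ⊢
  refine le_antisymm ?_ ?_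
  · rw [hb]
    exact (key a (by exact_mod_cast hs)).2 ha.ge
  · rw [ha]
    exact (key b (by exact_mod_cast h1)).1 hb.ge

/-- The path stopped at `T` and `T` itself belong to the past of `T`: when `T ≤ s`, stopping the
path at `s` beforehand changes neither of them. -/
theorem IsStopping.measurable_past {T : Path → ℝ≥0∞} (hT : Measurable T) (h : IsStopping T) :
    Measurable[(h.isStoppingTime hT).measurableSpace]
      fun w : Path => (stopAt (T w).toNNReal w, (T w).toNNReal) := by
  have hm : Measurable fun w : Path => (stopAt (T w).toNNReal w, (T w).toNNReal) :=
    (measurable_stop_uncurry.comp (hT.ennreal_toNNReal.prodMk measurable_id)).prodMk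
      hT.ennreal_toNNReal
  intro B hB
  refine ⟨le_iSup_history _ (hm hB), fun s => ?_⟩
  have e : (fun w : Path => (stopAt (T w).toNNReal w, (T w).toNNReal)) ⁻¹' B ∩ {w | T w ≤ s} =
      stopAt s ⁻¹' ((fun w : Path => (stopAt (T w).toNNReal w, (T w).toNNReal)) ⁻¹' B ∩
        {w | T w ≤ s}) := by
    ext w
    have hiff : T w ≤ s ↔ T (stopAt s w) ≤ s := h s w
    simp only [Set.mem_inter_iff, Set.mem_preimage]
    refine and_congr_left_iff.2 ?_ |>.trans (and_congr_right fun _ => hiff)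
    intro hs
    have hs' : T w ≤ s := hs
    rw [h.eq_of_le hs', stop_stop, min_eq_left]
    exact ENNReal.toNNReal_mono ENNReal.coe_ne_top hs'
  have := measurable_stop_history s ((hm hB).inter
    (measurableSet_le hT (measurable_const (a := (s : ℝ≥0∞)))))
  rw [← e] at this
  exact this

/-! ### Consequences of the branching and strong Markov properties. -/

namespace BranchLaw

variable {α : ℝ} {Q : Kernel MarkPart Path} [IsMarkovKernel Q]

/-- Events on the block with label `k`. -/
theorem measure_le_of_block (hQ : BranchLaw α Q) (x : MarkPart) (k : ℕ) {B B' : Set Path}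
    (hB : MeasurableSet B) (hB' : MeasurableSet B')
    (h : ∀ f : ℕ → Path, (f k).1 0 = one → frag α x f ∈ B → f k ∈ B') : Q x B ≤ Q one B' := by
  have e := Measure.infinitePi_map_eval (fun _ : ℕ => Q one) k
  rw [hQ.branching x, Measure.map_apply (measurable_frag α x) hB]
  have h0 : ∀ᵐ f ∂(Measure.infinitePi fun _ : ℕ => Q one), (f k).1 0 = one := by
    refine ae_of_ae_map (f := fun f : ℕ → Path => f k) (measurable_pi_apply k).aemeasurable
      (p := fun w => w.1 0 = one) ?_
    have e' : (Measure.infinitePi fun _ : ℕ => Q one).map (fun f : ℕ → Path => f k) = Q one := e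
    rw [e']
    exact hQ.start one
  calc _ ≤ (Measure.infinitePi fun _ : ℕ => Q one) ((fun f => f k) ⁻¹' B') := by
        refine measure_mono_ae ?_
        filter_upwards [h0] with f hf hfB
        exact h f hf hfB
    _ = Q one B' := by
        rw [← Measure.map_apply (measurable_pi_apply k) hB']
        exact congrArg (fun m : Measure Path => m B') e

theorem ae_of_block (hQ : BranchLaw α Q) (x : MarkPart) (k : ℕ) {B B' : Set Path}
    (hB : MeasurableSet B) (hB' : MeasurableSet B') (hone : ∀ᵐ w ∂(Q one), w ∈ B')
    (h : ∀ f : ℕ → Path, (f k).1 0 = one → f k ∈ B' → frag α x f ∈ B) : ∀ᵐ w ∂(Q x), w ∈ B := by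
  refine le_antisymm ?_ zero_le
  refine (hQ.measure_le_of_block x k hB.compl hB'.compl fun f hf h1 h2 =>
    h1 (h f hf h2)).trans hone.le

end BranchLaw

namespace PathLaw

variable {α : ℝ} {Q : Kernel MarkPart Path} [IsMarkovKernel Q]

/-- Conditionally on the past of a stopping time, the future is a path from the current state. -/
theorem freeze (hQ : PathLaw α Q) {T : Path → ℝ≥0∞} (hT : Measurable T) (hs : IsStopping T)
    (x : MarkPart) {F : (Path × ℝ≥0) × Path → ℝ≥0∞} (hF : Measurable F) :
    ∫⁻ w in {w | T w ≠ ⊤}, F ((stopAt (T w).toNNReal w, (T w).toNNReal), shift (T w).toNNReal w)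
        ∂(Q x) =
      ∫⁻ w in {w | T w ≠ ⊤}, ∫⁻ w', F ((stopAt (T w).toNNReal w, (T w).toNNReal), w')
        ∂(Q (w.1 (T w).toNNReal)) ∂(Q x) := by
  have hfin : MeasurableSet {w : Path | T w ≠ ⊤} := (hT (measurableSet_singleton ⊤)).compl
  set Z : Path → Path × ℝ≥0 := fun w => (stopAt (T w).toNNReal w, (T w).toNNReal) with hZdef
  have hZ : Measurable Z :=
    (measurable_stop_uncurry.comp (hT.ennreal_toNNReal.prodMk measurable_id)).prodMk
      hT.ennreal_toNNReal
  have hZT := hs.measurable_past hT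
  have hsh : Measurable fun w : Path => shift (T w).toNNReal w :=
    measurable_shift_uncurry.comp (hT.ennreal_toNNReal.prodMk measurable_id)
  have he : Measurable fun z : Path × ℝ≥0 => z.1.1 z.2 :=
    measurable_eval_comp measurable_snd measurable_fst
  have heZ : ∀ w, (Z w).1.1 (Z w).2 = w.1 (T w).toNNReal := fun w => stop_apply_of_le le_rfl w
  set ν := ((Q x).restrict {w | T w ≠ ⊤}).map Z
  set κ := Q.comap (fun z : Path × ℝ≥0 => z.1.1 z.2) he
  -- On rectangles this is the strong Markov property; as an identity of measures it allows
  -- integrands that mix the past and the future.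
  have key : ((Q x).restrict {w | T w ≠ ⊤}).map (fun w => (Z w, shift (T w).toNNReal w)) =
      ν.compProd κ := by
    refine Measure.ext_prod fun {A B} hA hB => ?_
    rw [Measure.map_apply (hZ.prodMk hsh) (hA.prod hB), Measure.compProd_apply_prod hA hB,
      setLIntegral_map hA (κ.measurable_coe hB) hZ, Measure.restrict_restrict (hZ hA),
      Measure.restrict_apply ((hZ.prodMk hsh) (hA.prod hB))]
    have hmem : MeasurableSet[(hs.isStoppingTime hT).measurableSpace]
        (Z ⁻¹' A ∩ {w | T w ≠ ⊤}) := by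
      refine MeasurableSet.inter (hZT hA) ?_
      exact ((hs.isStoppingTime hT).measurable (measurableSet_singleton ⊤)).compl
    have := hQ.strongMarkov T (hs.isStoppingTime hT) x _ B hmem (fun w hw => hw.2) hB
    have e1 : (fun w => (Z w, shift (T w).toNNReal w)) ⁻¹' A ×ˢ B ∩ {w | T w ≠ ⊤} =
        Z ⁻¹' A ∩ {w | T w ≠ ⊤} ∩ {w | shift ((T w).untopD 0) w ∈ B} := by
      ext w
      simp only [Set.mem_inter_iff, Set.mem_preimage, Set.mem_prod]
      exact ⟨fun h => ⟨⟨h.1.1, h.2⟩, h.1.2⟩, fun h => ⟨⟨h.1.1, h.2⟩, h.1.2⟩⟩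
    rw [e1, this]
    refine lintegral_congr fun w => ?_
    change Q (w.1 (T w).toNNReal) B = Q ((Z w).1.1 (Z w).2) B
    rw [heZ]
  have h1 : ∫⁻ p, F p ∂(((Q x).restrict {w | T w ≠ ⊤}).map
      (fun w => (Z w, shift (T w).toNNReal w))) = ∫⁻ p, F p ∂(ν.compProd κ) := by rw [key]
  rw [lintegral_map hF (hZ.prodMk hsh), Measure.lintegral_compProd hF,
    lintegral_map (hF.lintegral_kernel_prod_right') hZ] at h1
  rw [h1]
  refine lintegral_congr fun w => ?_
  change ∫⁻ w', F (Z w, w') ∂(Q ((Z w).1.1 (Z w).2)) = _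
  rw [heZ]

/-- The Markov property at a fixed time. -/
theorem lintegral_markov (hQ : PathLaw α Q) (s : ℝ≥0) (x : MarkPart) {F : Path × Path → ℝ≥0∞}
    (hF : Measurable F) :
    ∫⁻ w, F (stopAt s w, shift s w) ∂(Q x) = ∫⁻ w, ∫⁻ w', F (stopAt s w, w') ∂(Q (w.1 s)) ∂(Q x) := by
  have := hQ.freeze (T := fun _ => (s : ℝ≥0∞)) measurable_const (isStopping_const s) x
    (F := fun p => F (p.1.1, p.2)) (hF.comp ((measurable_fst.comp measurable_fst).prodMk
      measurable_snd))
  simpa using this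

theorem measure_markov (hQ : PathLaw α Q) (s : ℝ≥0) (x : MarkPart) {A B : Set Path}
    (hA : MeasurableSet A) (hB : MeasurableSet B) :
    Q x {w | stopAt s w ∈ A ∧ shift s w ∈ B} = ∫⁻ w in stopAt s ⁻¹' A, Q (w.1 s) B ∂(Q x) := by
  have h := hQ.lintegral_markov s x (F := (A ×ˢ B).indicator 1)
    (measurable_one.indicator (hA.prod hB))
  have hm : Measurable fun w : Path => (stopAt s w, shift s w) :=
    (measurable_stop s).prodMk (measurable_shift s)
  have e1 : ∀ w : Path, (A ×ˢ B).indicator (1 : Path × Path → ℝ≥0∞) (stopAt s w, shift s w) =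
      {w | stopAt s w ∈ A ∧ shift s w ∈ B}.indicator 1 w := fun w => rfl
  simp only [e1] at h
  rw [lintegral_indicator_one (show MeasurableSet {w | stopAt s w ∈ A ∧ shift s w ∈ B} from
    hm (hA.prod hB))] at h
  rw [h, ← lintegral_indicator (measurable_stop s hA)]
  refine lintegral_congr fun w => ?_
  by_cases hw : stopAt s w ∈ A
  · rw [Set.indicator_of_mem (by exact hw), ← lintegral_indicator_one hB]
    refine lintegral_congr fun w' => ?_
    by_cases hw' : w' ∈ B <;> simp [hw, hw', Set.indicator]
  · rw [Set.indicator_of_notMem (by exact hw)]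
    simp [hw, Set.indicator]

theorem ae_markov (hQ : PathLaw α Q) (s : ℝ≥0) (x : MarkPart) {U : Set MarkPart} {B : Set Path}
    (hU : MeasurableSet U) (hB : MeasurableSet B) (h : ∀ y ∈ U, ∀ᵐ w ∂(Q y), w ∈ B) :
    ∀ᵐ w ∂(Q x), w.1 s ∈ U → shift s w ∈ B := by
  have hA : MeasurableSet {w : Path | w.1 s ∈ U} := measurable_coord s hU
  have := hQ.measure_markov s x hA hB.compl
  rw [ae_iff]
  have e : {w : Path | ¬(w.1 s ∈ U → shift s w ∈ B)} =
      {w | stopAt s w ∈ {w : Path | w.1 s ∈ U} ∧ shift s w ∈ Bᶜ} := by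
    ext w
    have : (stopAt s w).1 s = w.1 s := stop_apply_of_le le_rfl w
    simp [this]
  rw [e, this, setLIntegral_eq_zero_iff (measurable_stop s hA)
    (show Measurable fun w : Path => Q (w.1 s) Bᶜ from
      (Q.measurable_coe hB.compl).comp (measurable_coord s))]
  refine Eventually.of_forall fun w hw => ?_
  have hw' : w.1 s ∈ U := by
    have : (stopAt s w).1 s = w.1 s := stop_apply_of_le le_rfl w
    rw [← this]; exact hw
  exact h _ hw'

/-- Bound for the probability that a property of the future holds at the first visit. -/
theorem measure_first_visit_le (hQ : PathLaw α Q) (x : MarkPart) {U : Set MarkPart}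
    {B : Set Path} (hU : MeasurableSet U) (hB : MeasurableSet B) {δ : ℝ≥0∞}
    (h : ∀ y ∈ U, Q y B ≤ δ) (F : Finset ℝ≥0) :
    Q x {w | ∃ q ∈ F, w.1 q ∈ U ∧ (∀ r ∈ F, r < q → w.1 r ∉ U) ∧ shift q w ∈ B} ≤ δ := by
  set A : ℝ≥0 → Set Path := fun q => {w | w.1 q ∈ U ∧ ∀ r ∈ F, r < q → w.1 r ∉ U} with hA
  have hAm : ∀ q, MeasurableSet (A q) := fun q => by
    refine MeasurableSet.inter (measurable_coord q hU) ?_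
    have e : {w : Path | ∀ r ∈ F, r < q → w.1 r ∉ U} =
        ⋂ r ∈ F, ⋂ (_ : r < q), {w : Path | w.1 r ∉ U} := by
      ext w; simp
    have e' : MeasurableSet {w : Path | ∀ r ∈ F, r < q → w.1 r ∉ U} := by
      rw [e]
      exact Finset.measurableSet_biInter F fun r _ => MeasurableSet.iInter fun _ =>
        (measurable_coord r hU).compl
    exact e'
  have hst : ∀ q, stopAt q ⁻¹' A q = A q := fun q => by
    ext w
    have h1 : ∀ r ≤ q, (stopAt q w).1 r = w.1 r := fun r hr => stop_apply_of_le hr w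
    simp only [hA, Set.mem_preimage]
    refine and_congr (by rw [h1 q le_rfl]) (forall₃_congr fun r _ hr => by rw [h1 r hr.le])
  have hdisj : (F : Set ℝ≥0).PairwiseDisjoint A := by
    intro q hq r hr hqr
    refine Set.disjoint_left.2 fun w h1 h2 => ?_
    rcases lt_or_gt_of_ne hqr with hlt | hlt
    · exact h2.2 q hq hlt h1.1
    · exact h1.2 r hr hlt h2.1
  calc _ ≤ Q x (⋃ q ∈ F, {w | stopAt q w ∈ A q ∧ shift q w ∈ B}) := by
        refine measure_mono ?_
        rintro w ⟨q, hq, h1, h2, h3⟩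
        refine Set.mem_biUnion (by exact hq) ⟨?_, h3⟩
        change w ∈ stopAt q ⁻¹' A q
        rw [hst]
        exact ⟨h1, h2⟩
    _ ≤ ∑ q ∈ F, Q x {w | stopAt q w ∈ A q ∧ shift q w ∈ B} := measure_biUnion_finset_le _ _
    _ ≤ ∑ q ∈ F, δ * Q x (A q) := by
        refine Finset.sum_le_sum fun q _ => ?_
        rw [hQ.measure_markov q x (hAm q) hB, hst]
        refine (setLIntegral_mono measurable_const fun w hw => h _ hw.1).trans ?_
        rw [setLIntegral_const]
    _ = δ * Q x (⋃ q ∈ F, A q) := by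
        rw [measure_biUnion_finset hdisj fun q _ => hAm q, Finset.mul_sum]
    _ ≤ δ := mul_le_of_le_one_right' prob_le_one

/-- An infinite sequence of times may contain no first visit to `U`. The hypothesis requires `B` at
every visit up to some visit, hence at the first one among any finite set of times containing it,
and the bound for finite sets passes to the increasing union. -/
theorem measure_visit_le (hQ : PathLaw α Q) (x : MarkPart) {U : Set MarkPart}
    {B E : Set Path} (hU : MeasurableSet U) (hB : MeasurableSet B) {δ : ℝ≥0∞}
    (h : ∀ y ∈ U, Q y B ≤ δ) (t : ℕ → ℝ≥0)
    (hE : ∀ w ∈ E, ∃ n, w.1 (t n) ∈ U ∧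
      ∀ m, t m ≤ t n → w.1 (t m) ∈ U → shift (t m) w ∈ B) : Q x E ≤ δ := by
  classical
  set S : ℕ → Set Path := fun N => {w | ∃ n < N, w.1 (t n) ∈ U ∧
    ∀ m, t m ≤ t n → w.1 (t m) ∈ U → shift (t m) w ∈ B}
  have hmono : Monotone S := fun a b hab w ⟨n, hn, hw⟩ => ⟨n, hn.trans_le hab, hw⟩
  have hsub : E ⊆ ⋃ N, S N := fun w hw => by
    obtain ⟨n, hn⟩ := hE w hw
    exact Set.mem_iUnion.2 ⟨n + 1, n, n.lt_succ_self, hn⟩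
  refine (measure_mono hsub).trans ?_
  rw [hmono.measure_iUnion]
  refine iSup_le fun N => ?_
  refine (measure_mono ?_).trans
    (hQ.measure_first_visit_le x hU hB h ((Finset.range N).image t))
  rintro w ⟨n, hn, hnU, hw⟩
  -- The visits among the first `N` times; the least of them is not later than `t n`, so the
  -- hypothesis applies to it.
  set G := ((Finset.range N).image t).filter fun r => w.1 r ∈ U
  have hnG : t n ∈ G := by
    simp only [G, Finset.mem_filter, Finset.mem_image, Finset.mem_range]
    exact ⟨⟨n, hn, rfl⟩, hnU⟩
  have hmem := Finset.min'_mem G ⟨_, hnG⟩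
  have hle := G.min'_le (t n) hnG
  have hmin : ∀ r ∈ G, G.min' ⟨_, hnG⟩ ≤ r := fun r hr => G.min'_le r hr
  generalize G.min' ⟨_, hnG⟩ = q at hmem hle hmin
  have hmem' := Finset.mem_filter.1 hmem
  obtain ⟨m, -, rfl⟩ := Finset.mem_image.1 hmem'.1
  refine ⟨t m, hmem'.1, hmem'.2, fun r hr hrq hrU => ?_, hw m hle hmem'.2⟩
  exact absurd (hmin r (Finset.mem_filter.2 ⟨hr, hrU⟩)) (not_le.2 hrq)

end PathLaw

theorem ENNReal_eq_of_forall_le {a b : ℝ≥0∞} (h : ∀ r : ℝ≥0, a ≤ r ↔ b ≤ r) : a = b := by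
  refine eq_of_forall_ge_iff fun c => ?_
  induction c using ENNReal.recTopCoe with
  | top => simp
  | coe r => exact h r

/-! ## The death time of an integer -/

namespace MarkPart

/-- The mark of `i` is bounded away from `0` up to time `s`. -/
def Alive (i : ℕ) (w : ℝ≥0 → MarkPart) (s : ℝ≥0) : Prop :=
  ∃ e > 0, ∀ r ≤ s, e ≤ ((w r).mark i).size

variable {i : ℕ} {w : ℝ≥0 → MarkPart} {s t q r : ℝ≥0}

theorem Alive.of_le (h : Alive i w t) (hst : s ≤ t) : Alive i w s := by
  obtain ⟨e, he, h⟩ := h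
  exact ⟨e, he, fun r hr => h r (hr.trans hst)⟩

theorem Alive.mark_ne_zero (h : Alive i w t) : (w t).mark i ≠ 0 := by
  obtain ⟨e, he, h⟩ := h
  intro h0
  have := h t le_rfl
  rw [h0, Mark.size_zero] at this
  exact absurd he (not_lt.2 this)

/-- Right-continuity leaves room after `s`. Hence a finite death time is itself a time at which the
integer is no longer alive, which gives `deathTime_le_iff`. -/
theorem Alive.exists_gt (hw : IsCadlag w) (h : Alive i w s) : ∃ t > s, Alive i w t := by
  obtain ⟨e, he, h⟩ := h
  have h1 := (Mark.continuous_size.tendsto _).comp (hw.tendsto_mark s i)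
  have h2 : ∀ᶠ r in 𝓝[≥] s, e / 2 < ((w r).mark i).size :=
    h1.eventually_const_lt ((NNReal.half_lt_self he.ne').trans_le (h s le_rfl))
  obtain ⟨d, hd, hball⟩ := (nhdsGE_basis s).mem_iff.1 h2
  obtain ⟨t, hst, htd⟩ := exists_between hd
  refine ⟨t, hst, e / 2, half_pos he, fun r hr => ?_⟩
  rcases le_total r s with hrs | hrs
  · exact (NNReal.half_le_self e).trans (h r hrs)
  · exact (hball ⟨hrs, hr.trans_lt htd⟩ : _ < _).le

theorem alive_add : Alive i w (q + r) ↔ Alive i w q ∧ Alive i (fun t => w (q + t)) r := by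
  constructor
  · intro h
    refine ⟨h.of_le le_self_add, ?_⟩
    obtain ⟨e, he, h⟩ := h
    exact ⟨e, he, fun s hs => h _ (by gcongr)⟩
  · rintro ⟨⟨e, he, h⟩, e', he', h'⟩
    refine ⟨min e e', lt_min he he', fun s hs => ?_⟩
    rcases le_total s q with hsq | hsq
    · exact (min_le_left _ _).trans (h s hsq)
    · obtain ⟨d, rfl⟩ := exists_add_of_le hsq
      exact (min_le_right _ _).trans (h' d (le_of_add_le_add_left hs))

/-- Grid times up to `s` control the times strictly before `s` only; the mark at `s` has to be
tested separately. -/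
theorem alive_iff_grid (hw : IsCadlag w) : Alive i w s ↔ ¬(w s).mark i = 0 ∧
    ∃ k : ℕ, ∀ n, grid n ≤ s → 1 / ((k : ℝ≥0) + 1) ≤ ((w (grid n)).mark i).size := by
  constructor
  · intro h
    refine ⟨h.mark_ne_zero, ?_⟩
    obtain ⟨e, he, h⟩ := h
    obtain ⟨k, hk⟩ := NNReal.exists_nat_pos_inv_lt (b := e) he
    refine ⟨k, fun m hm => le_trans ?_ (h _ hm)⟩
    refine le_trans ?_ hk.2.le
    rw [one_div]
    exact inv_anti₀ (by exact_mod_cast hk.1) (by simp)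
  · rintro ⟨h0, k, hk⟩
    refine ⟨min (1 / ((k : ℝ≥0) + 1)) ((w s).mark i).size,
      lt_min (by positivity) (Mark.size_pos h0), fun r hr => ?_⟩
    rcases hr.eq_or_lt with rfl | hr
    · exact min_le_right _ _
    refine (min_le_left _ _).trans (le_of_not_gt fun hlt => ?_)
    have h1 := (Mark.continuous_size.tendsto _).comp (hw.tendsto_mark r i)
    obtain ⟨n, -, hn, hn'⟩ := exists_grid_right (h1.eventually_lt_const hlt) hr
    exact absurd (hk n hn.le) (not_le.2 hn')

theorem alive_ssFrag {α : ℝ} {x : MarkPart} {f : ℕ → ℝ≥0 → MarkPart} (hx : x.mark i ≠ 0) :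
    Alive i (ssFrag α x f) s ↔ Alive i (f (x.blockLabel i)) ((x.mark i).pow α * s) := by
  have hc := Mark.pow_pos hx α
  have hsz := Mark.size_pos hx
  constructor
  · rintro ⟨e, he, h⟩
    refine ⟨e * (x.mark i).size, by positivity, fun r hr => ?_⟩
    have h1 := h (((x.mark i).pow α)⁻¹ * r) (by rwa [inv_mul_le_iff₀ hc])
    have h2 : (ssFrag α x f (((x.mark i).pow α)⁻¹ * r)).mark i =
        (f (x.blockLabel i) r).mark i * x.mark i := by
      change x.mark i * (f _ (_ * (_ * r))).mark i = _
      rw [mul_inv_cancel_left₀ hc.ne']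
      exact Mark.ext (mul_comm _ _)
    rw [h2] at h1
    exact (mul_le_mul_left h1 _).trans (Mark.size_mul_size_le _ _)
  · rintro ⟨e, he, h⟩
    refine ⟨(x.mark i).size * e, by positivity, fun r hr => ?_⟩
    exact (mul_le_mul_right (h _ (mul_le_mul_right hr _)) _).trans (Mark.size_mul_le _ _)

end MarkPart

/-- The first time at which the mark of `i`, or its left limit, is `0`. -/
def deathTime (i : ℕ) (w : Path) : ℝ≥0∞ := sInf {r | ∃ s : ℝ≥0, r = s ∧ ¬Alive i w.1 s}

section

variable {i : ℕ} {w : Path} {s t q : ℝ≥0}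

theorem deathTime_le_iff : deathTime i w ≤ s ↔ ¬Alive i w.1 s := by
  constructor
  · intro h hs
    obtain ⟨t, hst, ht⟩ := hs.exists_gt w.2
    obtain ⟨_, ⟨u, rfl, hu⟩, hut⟩ := sInf_lt_iff.1
      (lt_of_le_of_lt h (show (s : ℝ≥0∞) < t by exact_mod_cast hst))
    exact hu (ht.of_le (by exact_mod_cast hut.le))
  · intro h
    exact sInf_le ⟨s, rfl, h⟩

theorem measurable_deathTime (i : ℕ) : Measurable (deathTime i) := by
  refine measurable_of_Iic fun a => ?_
  induction a using ENNReal.recTopCoe with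
  | top => simp
  | coe s =>
    have e : deathTime i ⁻¹' Set.Iic (s : ℝ≥0∞) = {w : Path | ¬(¬(w.1 s).mark i = 0 ∧
        ∃ k : ℕ, ∀ n, grid n ≤ s → 1 / ((k : ℝ≥0) + 1) ≤ ((w.1 (grid n)).mark i).size)} := by
      ext w
      exact deathTime_le_iff.trans (not_congr (alive_iff_grid w.2))
    have hm : ∀ t, Measurable fun w : Path => (w.1 t).mark i := fun t =>
      (measurable_mark i).comp (measurable_coord t)
    rw [e]
    refine measurableSet_setOfPred.2 (Measurable.not (Measurable.and ?_ ?_))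
    · exact (measurableSet_setOfPred.1 (hm s (measurableSet_singleton 0))).not
    · exact .exists fun k => .forall fun n => .imp measurable_const (measurableSet_setOfPred.1
        (measurableSet_le measurable_const (Mark.measurable_size.comp (hm _))))

theorem isStopping_deathTime (i : ℕ) : IsStopping (deathTime i) := fun s w => by
  rw [deathTime_le_iff, deathTime_le_iff, not_iff_not]
  simp only [Alive]
  exact exists_congr fun e => and_congr_right fun _ => forall₂_congr fun r hr => by
    rw [stop_apply_of_le hr]

theorem deathTime_shift (h : deathTime i w = t) (hq : q < t) :
    deathTime i (shift q w) = (t - q : ℝ≥0) := by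
  refine ENNReal_eq_of_forall_le fun r => ?_
  have h1 : Alive i w.1 q := by
    by_contra h'
    rw [← deathTime_le_iff, h] at h'
    exact absurd hq (not_lt.2 (by exact_mod_cast h'))
  have h2 : deathTime i w ≤ (q + r : ℝ≥0) ↔ deathTime i (shift q w) ≤ r := by
    rw [deathTime_le_iff, deathTime_le_iff, alive_add, and_iff_right h1]
    rfl
  rw [← h2, h, ENNReal.coe_le_coe, ENNReal.coe_le_coe, tsub_le_iff_left]

theorem deathTime_frag {α : ℝ} {x : MarkPart} {f : ℕ → Path} (hx : x.mark i ≠ 0)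
    (h : deathTime i (frag α x f) = t) :
    deathTime i (f (x.blockLabel i)) = ((x.mark i).pow α * t : ℝ≥0) := by
  have hc := Mark.pow_pos hx α
  refine ENNReal_eq_of_forall_le fun r => ?_
  have h1 : deathTime i (frag α x f) ≤ (((x.mark i).pow α)⁻¹ * r : ℝ≥0) ↔
      deathTime i (f (x.blockLabel i)) ≤ r := by
    rw [deathTime_le_iff, deathTime_le_iff]
    have h2 : Alive i (frag α x f).1 (((x.mark i).pow α)⁻¹ * r) ↔
        Alive i (f (x.blockLabel i)).1 ((x.mark i).pow α * (((x.mark i).pow α)⁻¹ * r)) :=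
      alive_ssFrag (f := fun k => (f k).1) hx
    rw [h2, mul_inv_cancel_left₀ hc.ne']
  rw [← h1, h, ENNReal.coe_le_coe, ENNReal.coe_le_coe, le_inv_mul_iff₀ hc]

end

/-! ## Typical paths -/

theorem measurableSet_mark_zero (i : ℕ) : MeasurableSet {y : MarkPart | y.mark i = 0} :=
  measurable_mark i (measurableSet_singleton 0)

theorem measurableSet_dead (i : ℕ) :
    MeasurableSet {w : Path | ∀ n, (w.1 (grid n)).mark i = 0} :=
  measurableSet_setOfPred.2 (.forall fun n => measurableSet_setOfPred.1
    (measurable_coord (grid n) (measurableSet_mark_zero i)))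

theorem mark_zero_of_grid {w : Path} {i : ℕ} (h : ∀ n, (w.1 (grid n)).mark i = 0) (t : ℝ≥0) :
    (w.1 t).mark i = 0 := by
  by_contra h0
  obtain ⟨n, -, -, hn⟩ := exists_grid_right ((w.2.tendsto_mark t i).eventually_ne h0)
    (lt_add_one t)
  exact hn (h n)

namespace PathLaw

variable {α : ℝ} {Q : Kernel MarkPart Path} [IsMarkovKernel Q]

theorem ae_dead_of_mark_zero (hQ : PathLaw α Q) {y : MarkPart} {i : ℕ} (hy : y.mark i = 0) :
    ∀ᵐ w ∂(Q y), ∀ n, (w.1 (grid n)).mark i = 0 := by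
  refine hQ.ae_of_block y 0 (measurableSet_dead i) MeasurableSet.univ (by simp)
    fun f _ _ n => ?_
  change y.mark i * _ = 0
  rw [hy]
  exact Mark.zero_mul _

theorem ae_part_of_frozen (hQ : PathLaw α Q) {y : MarkPart} {i j : ℕ} (hy : y.mark i = 0)
    (hij : y.part i j) (t : ℝ≥0) : ∀ᵐ w ∂(Q y), (w.1 t).part i j := by
  refine hQ.ae_of_block y (y.blockLabel i) (measurable_coord t (measurableSet_part i j))
    MeasurableSet.univ (by simp) fun f h0 _ => ⟨hij, ?_⟩
  rw [hy, Mark.pow_zero_left, MulZeroClass.zero_mul]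
  change ((f (y.blockLabel i)).1 0).part i j
  rw [h0]
  trivial

theorem ae_not_part (hQ : PathLaw α Q) {y : MarkPart} {i j : ℕ} (hij : ¬y.part i j) (t : ℝ≥0) :
    ∀ᵐ w ∂(Q y), ¬(w.1 t).part i j :=
  hQ.ae_of_block y (y.blockLabel i) (measurable_coord t (measurableSet_part i j)).compl
    MeasurableSet.univ (by simp) fun f _ _ h => hij h.1

/-- On `E M` the mark at death has size at least `1 / (M + 1)`, though it had come arbitrarily close
to `0` before. Visit the states whose mark of `i` has size less than `η = 1 / (m + 1)`. From there,
by scaling, the event requires a copy started from `one` to be at its own death in a nonzero mark of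
size at most `η * (M + 1)`. These events `C m` decrease to the empty set, so their probabilities
tend to `0`, and `measure_visit_le` transfers the bound to `E M`. -/
theorem ae_mark_death (hQ : PathLaw α Q) (x : MarkPart) (i : ℕ) :
    ∀ᵐ w ∂(Q x), deathTime i w ≠ ⊤ → (w.1 (deathTime i w).toNNReal).mark i = 0 := by
  have hTm := measurable_deathTime i
  have hfin : MeasurableSet {w : Path | deathTime i w ≠ ⊤} :=
    (hTm (measurableSet_singleton ⊤)).compl
  have hV : Measurable fun w : Path => (w.1 (deathTime i w).toNNReal).mark i :=
    (measurable_mark i).comp (measurable_eval_comp hTm.ennreal_toNNReal measurable_id)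
  have hsz : Measurable fun w : Path => ((w.1 (deathTime i w).toNNReal).mark i).size :=
    Mark.measurable_size.comp hV
  have hle : ∀ a : ℝ≥0, MeasurableSet
      {w : Path | a ≤ ((w.1 (deathTime i w).toNNReal).mark i).size} := fun a =>
    measurableSet_le measurable_const hsz
  have hle' : ∀ a : ℝ≥0, MeasurableSet
      {w : Path | ((w.1 (deathTime i w).toNNReal).mark i).size ≤ a} := fun a =>
    measurableSet_le hsz measurable_const
  set E : ℕ → Set Path := fun M => {w | deathTime i w ≠ ⊤ ∧
    1 / ((M : ℝ≥0) + 1) ≤ ((w.1 (deathTime i w).toNNReal).mark i).size}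
  have hE : ∀ M, MeasurableSet (E M) := fun M =>
    hfin.inter (hle _)
  suffices h : ∀ M, Q x (E M) = 0 by
    have h' : ∀ᵐ w ∂(Q x), ∀ M, w ∉ E M := ae_all_iff.2 fun M => measure_eq_zero_iff_ae_notMem.1 (h M)
    filter_upwards [h'] with w hw hT
    by_contra h0
    obtain ⟨k, hk⟩ := NNReal.exists_nat_pos_inv_lt (Mark.size_pos h0)
    refine hw k ⟨hT, le_trans ?_ hk.2.le⟩
    rw [one_div]
    exact inv_anti₀ (by exact_mod_cast hk.1) (by simp)
  intro M
  -- If `y * z` has size at least `1 / (M + 1)` and `y` has size less than `1 / (m + 1)`, then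
  -- `size_mul_size_le` bounds the size of `z` by `(M + 1) / (m + 1)`.
  set C : ℕ → Set Path := fun m => {w | deathTime i w ≠ ⊤ ∧
    (¬(w.1 (deathTime i w).toNNReal).mark i = 0 ∧
    ((w.1 (deathTime i w).toNNReal).mark i).size ≤ 1 / ((m : ℝ≥0) + 1) * (M + 1))}
  have hC : ∀ m, MeasurableSet (C m) := fun m => hfin.inter
    ((hV (measurableSet_singleton 0)).compl.inter (hle' _))
  have hCanti : Antitone C := by
    rintro m n hmn w ⟨h1, h2, h3⟩
    refine ⟨h1, h2, h3.trans ?_⟩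
    gcongr
  have hlim : Tendsto (fun m => Q one (C m)) atTop (𝓝 0) := by
    have h1 := tendsto_measure_iInter_atTop (μ := Q one) (fun m => (hC m).nullMeasurableSet)
      hCanti ⟨0, measure_ne_top _ _⟩
    have h2 : ⋂ m, C m = ∅ := by
      refine Set.eq_empty_of_forall_notMem fun w hw => ?_
      rw [Set.mem_iInter] at hw
      have h3 : Tendsto (fun m : ℕ => 1 / ((m : ℝ≥0) + 1) * (M + 1)) atTop (𝓝 (0 * (M + 1))) :=
        tendsto_one_div_add_atTop_nhds_zero_nat.mul_const _
      rw [MulZeroClass.zero_mul] at h3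
      have h4 := ge_of_tendsto' h3 fun m => (hw m).2.2
      exact (hw 0).2.1 (Mark.size_eq_zero.1 (le_antisymm h4 zero_le))
    rw [h2, measure_empty] at h1
    exact h1
  refine le_antisymm (ge_of_tendsto' hlim fun m => ?_) zero_le
  set η : ℝ≥0 := 1 / ((m : ℝ≥0) + 1)
  have hη : 0 < η := by positivity
  have hU : MeasurableSet {y : MarkPart | (y.mark i).size < η} :=
    measurableSet_lt (Mark.measurable_size.comp (measurable_mark i)) measurable_const
  refine hQ.measure_visit_le x hU (hE M) (δ := Q one (C m)) (fun y hy => ?_) grid ?_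
  · refine hQ.measure_le_of_block y (y.blockLabel i) (hE M) (hC m) fun f _ hf => ?_
    obtain ⟨hT, hf⟩ := hf
    obtain ⟨t, ht⟩ : ∃ t : ℝ≥0, deathTime i (frag α y f) = t := ⟨_, (ENNReal.coe_toNNReal hT).symm⟩
    rw [ht, ENNReal.toNNReal_coe] at hf
    have hpos : 0 < 1 / ((M : ℝ≥0) + 1) := by positivity
    have hmk : ((frag α y f).1 t).mark i =
        y.mark i * ((f (y.blockLabel i)).1 ((y.mark i).pow α * t)).mark i := rfl
    have hne : ((frag α y f).1 t).mark i ≠ 0 := fun h0 => by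
      rw [h0, Mark.size_zero] at hf
      exact absurd hpos (not_lt.2 hf)
    have hy0 : y.mark i ≠ 0 := fun h0 => hne (by
      rw [hmk, h0]; exact Mark.zero_mul _)
    have hd := deathTime_frag hy0 ht
    refine ⟨by rw [hd]; exact ENNReal.coe_ne_top, ?_⟩
    rw [hd, ENNReal.toNNReal_coe]
    refine ⟨fun h0 => hne (by rw [hmk, Mark.mul_eq_zero]; exact Or.inr h0), ?_⟩
    rw [hmk] at hf
    set z := ((f (y.blockLabel i)).1 ((y.mark i).pow α * t)).mark i
    have h5 := (mul_le_mul_left hf z.size).trans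
      ((Mark.size_mul_size_le (y.mark i) z).trans (le_of_lt hy))
    rwa [one_div, inv_mul_le_iff₀ (by positivity), mul_comm] at h5
  · rintro w ⟨hT, hw⟩
    obtain ⟨t, ht⟩ : ∃ t : ℝ≥0, deathTime i w = t := ⟨_, (ENNReal.coe_toNNReal hT).symm⟩
    rw [ht, ENNReal.toNNReal_coe] at hw
    have hdead : ¬Alive i w.1 t := deathTime_le_iff.1 ht.le
    have hmin : 0 < min η (1 / ((M : ℝ≥0) + 1)) := lt_min hη (by positivity)
    obtain ⟨r, hr, hrs⟩ : ∃ r ≤ t, ((w.1 r).mark i).size < min η (1 / ((M : ℝ≥0) + 1)) := by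
      by_contra h'
      push Not at h'
      exact hdead ⟨_, hmin, h'⟩
    have hrt : r < t := lt_of_le_of_ne hr fun h' => by
      rw [h'] at hrs
      exact absurd (hrs.trans_le (min_le_right _ _)) (not_lt.2 hw)
    have h1 := (Mark.continuous_size.tendsto _).comp (w.2.tendsto_mark r i)
    obtain ⟨n, -, hn, hn'⟩ := exists_grid_right
      (h1.eventually_lt_const (hrs.trans_le (min_le_left _ _))) hrt
    refine ⟨n, hn', fun k hk _ => ?_⟩
    have hkt := hk.trans_lt hn
    have hd := deathTime_shift ht hkt
    refine ⟨by rw [hd]; exact ENNReal.coe_ne_top, ?_⟩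
    rw [hd, ENNReal.toNNReal_coe]
    change _ ≤ ((w.1 (grid k + (t - grid k))).mark i).size
    rwa [add_tsub_cancel_of_le hkt.le]

/-- The strong Markov property at the death time: by `ae_mark_death` the state there has mark `0`,
and the branching property keeps it at `0`. -/
theorem ae_dead (hQ : PathLaw α Q) (x : MarkPart) (i : ℕ) :
    ∀ᵐ w ∂(Q x), deathTime i w ≠ ⊤ → ∀ t, (w.1 ((deathTime i w).toNNReal + t)).mark i = 0 := by
  have hTm := measurable_deathTime i
  have hfin : MeasurableSet {w : Path | deathTime i w ≠ ⊤} :=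
    (hTm (measurableSet_singleton ⊤)).compl
  have hB := (measurableSet_dead i).compl
  have h := hQ.freeze hTm (isStopping_deathTime i) x
    (F := fun p => {w : Path | ∀ n, (w.1 (grid n)).mark i = 0}ᶜ.indicator 1 p.2)
    ((measurable_one.indicator hB).comp measurable_snd)
  have h0 : ∫⁻ w in {w | deathTime i w ≠ ⊤}, ∫⁻ w', {w : Path | ∀ n, (w.1 (grid n)).mark i = 0}ᶜ.indicator 1 w'
        ∂(Q (w.1 (deathTime i w).toNNReal)) ∂(Q x) = 0 := by
    rw [setLIntegral_congr_fun_ae (g := fun _ => 0) hfin, lintegral_zero]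
    filter_upwards [hQ.ae_mark_death x i] with w hw hT
    rw [lintegral_indicator_one hB]
    exact hQ.ae_dead_of_mark_zero (hw hT)
  have hsh : Measurable fun w : Path => shift (deathTime i w).toNNReal w :=
    measurable_shift_uncurry.comp (hTm.ennreal_toNNReal.prodMk measurable_id)
  rw [h0, setLIntegral_eq_zero_iff hfin (by exact (measurable_one.indicator hB).comp hsh)] at h
  filter_upwards [h] with w hw hT
  have h2 : shift (deathTime i w).toNNReal w ∈ {w : Path | ∀ n, (w.1 (grid n)).mark i = 0} := by
    by_contra h3
    have h4 := hw hT
    rw [Set.indicator_of_mem (by exact h3)] at h4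
    simp at h4
  exact mark_zero_of_grid h2

/-- Refinement and freezing come from the Markov property at grid times, because fragmentation never
merges blocks and runs blocks with mark `0` at speed `0`. The condition `away` is the absorption of
marks at their death time. -/
theorem ae_regular (hQ : PathLaw α Q) (x : MarkPart) : ∀ᵐ w ∂(Q x), Regular w.1 := by
  have h1 : ∀ᵐ w ∂(Q x), ∀ m n i j, grid m ≤ grid n → (w.1 (grid n)).part i j →
      (w.1 (grid m)).part i j := by
    simp only [ae_all_iff]
    intro m n i j hmn
    filter_upwards [hQ.ae_markov (grid m) x (measurableSet_part i j).compl
      (measurable_coord (grid n - grid m) (measurableSet_part i j)).compl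
      fun y hy => hQ.ae_not_part hy _] with w hw hn
    by_contra h
    refine hw h ?_
    change (w.1 (grid m + (grid n - grid m))).part i j
    rwa [add_tsub_cancel_of_le hmn]
  have h3 : ∀ᵐ w ∂(Q x), ∀ m n i j, grid m ≤ grid n → (w.1 (grid m)).mark i = 0 →
      (w.1 (grid m)).part i j → (w.1 (grid n)).part i j := by
    simp only [ae_all_iff]
    intro m n i j hmn
    filter_upwards [hQ.ae_markov (grid m) x
      ((measurableSet_mark_zero i).inter (measurableSet_part i j))
      (measurable_coord (grid n - grid m) (measurableSet_part i j))
      fun y hy => hQ.ae_part_of_frozen hy.1 hy.2 _] with w hw h1 h2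
    have : (w.1 (grid m + (grid n - grid m))).part i j := hw ⟨h1, h2⟩
    rwa [add_tsub_cancel_of_le hmn] at this
  filter_upwards [h1, h3, ae_all_iff.2 fun i => hQ.ae_dead x i] with w hw1 hw3 hw2
  refine regular_of_grid w.2 hw1 (fun n i hn => ?_) hw3
  refine ((alive_iff_grid w.2).1 ?_).2
  by_contra hdead
  have hle := deathTime_le_iff.2 hdead
  have hT : deathTime i w ≠ ⊤ := ne_top_of_le_ne_top ENNReal.coe_ne_top hle
  have h4 := hw2 i hT (grid n - (deathTime i w).toNNReal)
  rw [add_tsub_cancel_of_le (by simpa using ENNReal.toNNReal_mono ENNReal.coe_ne_top hle)] at h4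
  exact hn h4

theorem measurableSet_clock_le (β : ℝ) (i : ℕ) (a : ℝ≥0∞) :
    MeasurableSet {w : Path | ∀ n, clock β w.1 i (grid n) ≤ a} :=
  measurableSet_setOfPred.2 (.forall fun _ => measurableSet_setOfPred.1
    (measurableSet_le ((measurable_clock β i).comp (measurable_const.prodMk measurable_id))
      measurable_const))

theorem clock_le_of_grid {β : ℝ} {w : ℝ≥0 → MarkPart} {i : ℕ} {a : ℝ≥0∞}
    (h : ∀ n, clock β w i (grid n) ≤ a) (u : ℝ≥0) : clock β w i u ≤ a := by
  obtain ⟨n, hn, -⟩ := exists_grid_btwn (lt_add_one u)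
  exact (clock_mono β w i hn.le).trans (h n)

/-- From `one` the mark starts at `1` and stays nonzero for a while, so the clock is almost surely
positive at some time. -/
theorem tendsto_measure_clock_le (hQ : PathLaw α Q) (β : ℝ) (i : ℕ) :
    Tendsto (fun k : ℕ => Q one {w | ∀ n, clock β w.1 i (grid n) ≤ (1 / ((k : ℝ≥0) + 1) : ℝ≥0)})
      atTop (𝓝 0) := by
  have hanti : Antitone fun k : ℕ =>
      {w : Path | ∀ n, clock β w.1 i (grid n) ≤ (1 / ((k : ℝ≥0) + 1) : ℝ≥0)} := by
    intro k l hkl w hw n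
    refine (hw n).trans ?_
    rw [ENNReal.coe_le_coe]
    gcongr
  have h1 := tendsto_measure_iInter_atTop (μ := Q one)
    (fun k => (measurableSet_clock_le β i _).nullMeasurableSet) hanti ⟨0, measure_ne_top _ _⟩
  refine h1.trans_eq ?_
  congr 1
  have h2 : ∀ᵐ w ∂(Q one), w ∉ ⋂ k : ℕ,
      {w : Path | ∀ n, clock β w.1 i (grid n) ≤ (1 / ((k : ℝ≥0) + 1) : ℝ≥0)} := by
    filter_upwards [hQ.ae_regular one, hQ.start one] with w hr h0 hw
    rw [Set.mem_iInter] at hw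
    have hne : (w.1 0).mark i ≠ 0 := by rw [h0]; exact Mark.one_ne_zero
    obtain ⟨n, hn0, -, hn⟩ := exists_grid_right ((w.2.tendsto_mark 0 i).eventually_ne hne) one_pos
    have hpos := hr.clock_lt (β := β) hn hn0
    rw [clock_zero] at hpos
    have hle : clock β w.1 i (grid n) ≤ ((0 : ℝ≥0) : ℝ≥0∞) :=
      ge_of_tendsto' (ENNReal.tendsto_coe.2 tendsto_one_div_add_atTop_nhds_zero_nat)
        fun k => hw k n
    exact absurd hpos (not_lt.2 hle)
  exact measure_eq_zero_iff_ae_notMem.2 h2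

/-- Suppose the clock stays bounded but the mark keeps returning to sizes larger than `e`. At a late
such return the remaining clock is at most `b / (l + 1)`, while by scaling it is at least `b` times
the total clock of a copy started from `one`. The probability is thus at most that of a total clock
below `1 / (l + 1)`, which tends to `0` with `l`. -/
theorem ae_vanish (hQ : PathLaw α Q) (β : ℝ) (x : MarkPart) (i : ℕ) (k : ℕ) :
    ∀ᵐ w ∂(Q x), (∃ c : ℝ≥0, ∀ u, clock β w.1 i u ≤ c) → ∃ N : ℕ, ∀ n, (N : ℝ≥0) ≤ grid n →
      ((w.1 (grid n)).mark i).size ≤ 1 / ((k : ℝ≥0) + 1) := by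
  set e : ℝ≥0 := 1 / ((k : ℝ≥0) + 1)
  have he : 0 < e := by positivity
  -- A lower bound for `v ^ (β - α)`, the factor in `clock_ssFrag`, over the marks `v` of size at
  -- least `e`.
  set b : ℝ≥0 := e ^ |β - α|
  have hb : 0 < b := NNReal.rpow_pos he
  set B : ℕ → Set Path := fun l => {w | ∀ n, clock β w.1 i (grid n) ≤ (b * (1 / ((l : ℝ≥0) + 1)) : ℝ≥0)}
  set U : Set MarkPart := {y | e < (y.mark i).size}
  have hU : MeasurableSet U :=
    measurableSet_lt measurable_const (Mark.measurable_size.comp (measurable_mark i))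
  rw [ae_iff]
  refine le_antisymm (ge_of_tendsto' (hQ.tendsto_measure_clock_le β i) fun l => ?_) zero_le
  -- The bound on the remaining clock is required from an integer time on: these events increase
  -- with `N`, and the bound persists at all later visits, as `measure_visit_le` demands.
  set S : ℕ → Set Path := fun N => {w | (∀ u, clock β (fun t => w.1 (N + t)) i u ≤
    (b * (1 / ((l : ℝ≥0) + 1)) : ℝ≥0)) ∧ ∀ N' : ℕ, ∃ n, (N' : ℝ≥0) ≤ grid n ∧ w.1 (grid n) ∈ U}
  have hshift : ∀ (w : ℝ≥0 → MarkPart) (s d : ℝ≥0) (a : ℝ≥0∞),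
      (∀ u, clock β (fun t => w (s + t)) i u ≤ a) →
      ∀ u, clock β (fun t => w ((s + d) + t)) i u ≤ a := by
    intro w s d a h u
    have := clock_add β (fun t => w (s + t)) i d u
    simp only [← add_assoc] at this
    exact (le_add_self.trans this.ge).trans (h _)
  have hmono : Monotone S := fun N N' hNN w hw => by
    refine ⟨?_, hw.2⟩
    obtain ⟨d, rfl⟩ := exists_add_of_le hNN
    rw [Nat.cast_add]
    exact hshift w.1 N d _ hw.1
  have hsub : {w : Path | ¬((∃ c : ℝ≥0, ∀ u, clock β w.1 i u ≤ c) → ∃ N : ℕ, ∀ n,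
      (N : ℝ≥0) ≤ grid n → ((w.1 (grid n)).mark i).size ≤ e)} ⊆ ⋃ N, S N := by
    intro w hw
    obtain ⟨⟨c, hc⟩, hw⟩ := Classical.not_imp.1 hw
    push Not at hw
    have hsup : (⨆ u, clock β w.1 i u) ≠ ⊤ :=
      ne_top_of_le_ne_top ENNReal.coe_ne_top (iSup_le hc)
    have hpos : ((b * (1 / ((l : ℝ≥0) + 1)) : ℝ≥0) : ℝ≥0∞) ≠ 0 := by
      rw [ENNReal.coe_ne_zero]
      positivity
    obtain ⟨u, hu⟩ : ∃ u, (⨆ u, clock β w.1 i u) ≤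
        clock β w.1 i u + (b * (1 / ((l : ℝ≥0) + 1)) : ℝ≥0) := by
      rcases eq_or_ne (⨆ u, clock β w.1 i u) 0 with h0 | h0
      · exact ⟨0, by rw [h0]; exact zero_le⟩
      · obtain ⟨u, hu⟩ := lt_iSup_iff.1 (ENNReal.sub_lt_self hsup h0 hpos)
        exact ⟨u, tsub_le_iff_right.1 hu.le⟩
    have hN := Nat.le_ceil u
    refine Set.mem_iUnion.2 ⟨⌈u⌉₊, fun v => ?_, hw⟩
    have h1 := le_iSup (fun u => clock β w.1 i u) (⌈u⌉₊ + v)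
    have h2 : clock β w.1 i (⌈u⌉₊ + v) ≤
        clock β w.1 i ⌈u⌉₊ + (b * (1 / ((l : ℝ≥0) + 1)) : ℝ≥0) :=
      h1.trans (hu.trans (by gcongr; exact clock_mono β w.1 i hN))
    rw [clock_add] at h2
    exact (ENNReal.add_le_add_iff_left (ne_top_of_le_ne_top ENNReal.coe_ne_top (hc _))).1 h2
  refine (measure_mono hsub).trans ?_
  rw [hmono.measure_iUnion]
  refine iSup_le fun N => ?_
  refine hQ.measure_visit_le x hU (measurableSet_clock_le β i (b * (1 / ((l : ℝ≥0) + 1)) : ℝ≥0))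
    (fun y hy => ?_) (fun n => N + grid n) ?_
  · have hy0 : y.mark i ≠ 0 := fun h0 => by
      have hy' : e < (y.mark i).size := hy
      rw [h0, Mark.size_zero] at hy'
      exact not_lt_zero hy'
    refine hQ.measure_le_of_block y (y.blockLabel i) (measurableSet_clock_le β i _)
      (measurableSet_clock_le β i _) fun f _ hf n => ?_
    have h1 := clock_le_of_grid hf (((y.mark i).pow α)⁻¹ * grid n)
    have h2 := clock_ssFrag hy0 α β (fun k => (f k).1) (((y.mark i).pow α)⁻¹ * grid n)
    rw [mul_inv_cancel_left₀ (Mark.pow_pos hy0 α).ne'] at h2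
    have h3 : (b : ℝ≥0∞) * clock β (f (y.blockLabel i)).1 i (grid n) ≤
        b * (1 / ((l : ℝ≥0) + 1) : ℝ≥0) := by
      refine le_trans ?_ (h1.trans (ENNReal.coe_mul _ _).le)
      refine le_trans ?_ h2.ge
      gcongr
      exact Mark.le_pow he (le_of_lt hy) _
    exact (ENNReal.mul_le_mul_iff_right (ENNReal.coe_ne_zero.2 hb.ne') ENNReal.coe_ne_top).1 h3
  · rintro w ⟨h1, h2⟩
    obtain ⟨s, hs, hsU⟩ : ∃ s > (N : ℝ≥0), w.1 s ∈ U := by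
      obtain ⟨n, hn, hn'⟩ := h2 (N + 1)
      exact ⟨grid n, lt_of_lt_of_le (by simp) hn, hn'⟩
    have hsz := (Mark.continuous_size.tendsto _).comp (w.2.tendsto_mark s i)
    have hev : ∀ᶠ r in 𝓝[≥] s, w.1 r ∈ U := hsz.eventually_const_lt hsU
    have hadd : Tendsto (fun r => (N : ℝ≥0) + r) (𝓝[≥] (s - N)) (𝓝[≥] s) := by
      refine tendsto_nhdsWithin_iff.2 ⟨?_, ?_⟩
      · have := ((continuous_const_add (N : ℝ≥0)).tendsto (s - N)).mono_left
          (nhdsWithin_le_nhds (s := Set.Ici (s - N)))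
        rwa [add_tsub_cancel_of_le hs.le] at this
      · exact eventually_nhdsWithin_of_forall fun r (hr : s - N ≤ r) => (tsub_le_iff_left.1 hr : s ≤ N + r)
    obtain ⟨n, -, -, hn⟩ := exists_grid_right (hadd.eventually hev) (lt_add_one _)
    exact ⟨n, hn, fun m _ _ p => hshift w.1 N (grid m) _ h1 (grid p)⟩

theorem ae_good (hQ : PathLaw α Q) (β : ℝ) (x : MarkPart) : ∀ᵐ w ∂(Q x), Good β w.1 := by
  filter_upwards [hQ.ae_regular x,
    ae_all_iff.2 fun i => ae_all_iff.2 fun k => hQ.ae_vanish β x i k] with w h1 h2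
  exact ⟨h1, fun i hi => vanish_of_grid w.2 fun k => h2 i k hi⟩

end PathLaw

/-! ## Restriction to finitely many integers -/

namespace MarkPart

/-- The trace on a finite set: the other integers are singletons with mark `0`. -/
def restrict (J : Finset ℕ) (y : MarkPart) : MarkPart where
  part :=
    { r := fun i j => i = j ∨ (i ∈ J ∧ j ∈ J ∧ y.part i j)
      iseqv :=
        { refl := fun i => Or.inl rfl
          symm := by
            rintro i j (h | ⟨h1, h2, h3⟩)
            · exact Or.inl h.symm
            · exact Or.inr ⟨h2, h1, y.part.symm' h3⟩
          trans := by
            rintro i j k (rfl | ⟨h1, h2, h3⟩) h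
            · exact h
            · rcases h with rfl | ⟨g1, g2, g3⟩
              · exact Or.inr ⟨h1, h2, h3⟩
              · exact Or.inr ⟨h1, g2, y.part.trans' h3 g3⟩ } }
  mark := fun i => if i ∈ J then y.mark i else 0
  mark_eq := by
    rintro i j (rfl | ⟨h1, h2, h3⟩)
    · rfl
    · rw [if_pos h1, if_pos h2, y.mark_eq h3]

variable {J K : Finset ℕ} {y z : MarkPart} {i j : ℕ}

theorem restrict_part (hi : i ∈ J) (hj : j ∈ J) : (restrict J y).part i j ↔ y.part i j := by
  constructor
  · rintro (rfl | ⟨-, -, h⟩)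
    · exact y.part.refl' i
    · exact h
  · exact fun h => Or.inr ⟨hi, hj, h⟩

theorem restrict_mark (hi : i ∈ J) : (restrict J y).mark i = y.mark i := if_pos hi

theorem restrict_eq_iff : restrict J y = restrict J z ↔
    (∀ i ∈ J, ∀ j ∈ J, (y.part i j ↔ z.part i j)) ∧ ∀ i ∈ J, y.mark i = z.mark i := by
  constructor
  · intro h
    refine ⟨fun i hi j hj => ?_, fun i hi => ?_⟩
    · rw [← restrict_part hi hj, h, restrict_part hi hj]
    · rw [← restrict_mark hi, h, restrict_mark hi]
  · rintro ⟨h1, h2⟩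
    refine MarkPart.ext (Setoid.ext fun i j => ?_) (funext fun i => ?_)
    · exact or_congr_right (and_congr_right fun hi => and_congr_right fun hj => h1 i hi j hj)
    · by_cases hi : i ∈ J
      · rw [restrict_mark hi, restrict_mark hi, h2 i hi]
      · exact (if_neg hi).trans (if_neg hi).symm

theorem restrict_restrict (h : J ⊆ K) (y : MarkPart) : restrict J (restrict K y) = restrict J y :=
  restrict_eq_iff.2 ⟨fun _ hi _ hj => restrict_part (h hi) (h hj), fun _ hi => restrict_mark (h hi)⟩

theorem measurable_restrict (J : Finset ℕ) : Measurable (restrict J) := by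
  refine measurable_iff.2 ⟨fun i j => ?_, fun i => ?_⟩
  · exact (MeasurableSet.const _).union ((MeasurableSet.const _).inter ((MeasurableSet.const _).inter
      (measurableSet_part i j)))
  · by_cases hi : i ∈ J
    · simpa only [restrict_mark hi] using measurable_mark i
    · have : (fun y => (restrict J y).mark i) = fun _ => 0 := funext fun y => if_neg hi
      rw [this]
      exact measurable_const

theorem continuous_restrict (J : Finset ℕ) : Continuous (restrict J) := by
  refine continuous_iff_continuousAt.2 fun y => tendsto_iff.2 ⟨fun i j => ?_, fun i => ?_⟩
  · have h := (tendsto_iff.1 (tendsto_id (x := 𝓝 y))).1 i j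
    filter_upwards [h] with z hz
    exact or_congr_right (and_congr_right fun _ => and_congr_right fun _ => hz)
  · by_cases hi : i ∈ J
    · simp only [restrict_mark hi]
      exact (tendsto_iff.1 (tendsto_id (x := 𝓝 y))).2 i
    · have : (fun y => (restrict J y).mark i) = fun _ => 0 := funext fun y => if_neg hi
      rw [this, show (restrict J y).mark i = 0 from if_neg hi]
      exact tendsto_const_nhds

/-- The marked partition that coincides with `a` on `J` and with `b` off `J`. -/
def glue (J : Finset ℕ) (a b : MarkPart) : MarkPart where
  part :=
    { r := fun i j => (i ∈ J ∧ j ∈ J ∧ a.part i j) ∨ (i ∉ J ∧ j ∉ J ∧ b.part i j)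
      iseqv :=
        { refl := fun i => by
            by_cases hi : i ∈ J
            · exact Or.inl ⟨hi, hi, a.part.refl' i⟩
            · exact Or.inr ⟨hi, hi, b.part.refl' i⟩
          symm := by
            rintro i j (⟨h1, h2, h3⟩ | ⟨h1, h2, h3⟩)
            · exact Or.inl ⟨h2, h1, a.part.symm' h3⟩
            · exact Or.inr ⟨h2, h1, b.part.symm' h3⟩
          trans := by
            rintro i j k (⟨h1, h2, h3⟩ | ⟨h1, h2, h3⟩) (⟨g1, g2, g3⟩ | ⟨g1, g2, g3⟩)
            · exact Or.inl ⟨h1, g2, a.part.trans' h3 g3⟩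
            · exact absurd h2 g1
            · exact absurd g1 h2
            · exact Or.inr ⟨h1, g2, b.part.trans' h3 g3⟩ } }
  mark := fun i => if i ∈ J then a.mark i else b.mark i
  mark_eq := by
    rintro i j (⟨h1, h2, h3⟩ | ⟨h1, h2, h3⟩)
    · rw [if_pos h1, if_pos h2, a.mark_eq h3]
    · rw [if_neg h1, if_neg h2, b.mark_eq h3]

theorem glue_part_left (hi : i ∈ J) (hj : j ∈ J) : (glue J y z).part i j ↔ y.part i j :=
  ⟨fun h => h.elim (fun h => h.2.2) fun h => absurd hi h.1, fun h => Or.inl ⟨hi, hj, h⟩⟩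

theorem glue_part_right (hi : i ∉ J) (hj : j ∉ J) : (glue J y z).part i j ↔ z.part i j :=
  ⟨fun h => h.elim (fun h => absurd h.1 hi) fun h => h.2.2, fun h => Or.inr ⟨hi, hj, h⟩⟩

theorem glue_not_part (hi : i ∈ J) (hj : j ∉ J) : ¬(glue J y z).part i j :=
  fun h => h.elim (fun h => hj h.2.1) fun h => h.1 hi

theorem restrict_glue_left : restrict J (glue J y z) = restrict J y :=
  restrict_eq_iff.2 ⟨fun _ hi _ hj => glue_part_left hi hj, fun _ hi => if_pos hi⟩

theorem restrict_glue_right (h : Disjoint J K) : restrict K (glue J y z) = restrict K z :=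
  have h' : ∀ i ∈ K, i ∉ J := fun _ hi hi' => Finset.disjoint_left.1 h hi' hi
  restrict_eq_iff.2 ⟨fun i hi j hj => glue_part_right (h' i hi) (h' j hj),
    fun i hi => if_neg (h' i hi)⟩

theorem glue_restrict (h : Disjoint J K) (hy : ∀ i ∈ J, ∀ j ∈ K, ¬y.part i j) :
    glue J (restrict J y) (restrict K y) = restrict (J ∪ K) y := by
  have h' : ∀ i ∈ K, i ∉ J := fun _ hi hi' => Finset.disjoint_left.1 h hi' hi
  refine MarkPart.ext (Setoid.ext fun i j => ?_) (funext fun i => ?_)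
  · change (glue J (restrict J y) (restrict K y)).part i j ↔
      (i = j ∨ (i ∈ J ∪ K ∧ j ∈ J ∪ K ∧ y.part i j))
    by_cases hi : i ∈ J <;> by_cases hj : j ∈ J
    · rw [glue_part_left hi hj, restrict_part hi hj]
      simp only [Finset.mem_union, hi, hj, true_or, true_and]
      exact ⟨Or.inr, fun h => h.elim (fun e => e ▸ y.part.refl' i) id⟩
    · refine iff_of_false (glue_not_part hi hj) ?_
      rintro (rfl | ⟨-, h2, h3⟩)
      · exact hj hi
      · exact hy i hi j ((Finset.mem_union.1 h2).resolve_left hj) h3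
    · refine iff_of_false (fun h => glue_not_part hj hi (Setoid.symm' _ h)) ?_
      rintro (rfl | ⟨h1, -, h3⟩)
      · exact hi hj
      · exact hy j hj i ((Finset.mem_union.1 h1).resolve_left hi) (y.part.symm' h3)
    · rw [glue_part_right hi hj]
      simp only [Finset.mem_union, hi, hj, false_or]
      rfl
  · change (if i ∈ J then (restrict J y).mark i else (restrict K y).mark i) =
      if i ∈ J ∪ K then y.mark i else 0
    by_cases hi : i ∈ J
    · simp [hi, restrict_mark]
    · by_cases hk : i ∈ K
      · simp [hi, hk, restrict_mark]
      · have : (restrict K y).mark i = 0 := if_neg hk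
        simp [hi, hk, this]

/-- A block with a larger least element has a strictly larger label, since the least element of the
other block is then counted. -/
theorem blockLabel_eq_iff : y.blockLabel i = y.blockLabel j ↔ y.part i j := by
  refine ⟨fun h => ?_, blockLabel_eq⟩
  have hmin : ∀ i, y.part i (y.blockMin i) := fun i =>
    Nat.sInf_mem (s := y.block i) ⟨i, y.part.refl' i⟩
  have hmm : ∀ i, y.blockMin (y.blockMin i) = y.blockMin i := fun i => by
    change sInf (y.block (y.blockMin i)) = sInf (y.block i)
    rw [← block_eq (hmin i)]
  have hlt : ∀ {i j}, y.blockMin i < y.blockMin j → y.blockLabel i < y.blockLabel j := by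
    intro i j hij
    refine Set.ncard_lt_ncard ?_ ((Set.finite_lt_nat _).subset fun m hm => hm.1)
    refine ⟨fun m hm => ⟨hm.1.trans hij, hm.2⟩, fun hsub => ?_⟩
    exact lt_irrefl _ (hsub ⟨hij, hmm i⟩).1
  have heq : y.blockMin i = y.blockMin j := by
    rcases lt_trichotomy (y.blockMin i) (y.blockMin j) with hl | hl | hl
    · exact absurd h (hlt hl).ne
    · exact hl
    · exact absurd h (hlt hl).ne'
  exact y.part.trans' (hmin i) (heq ▸ y.part.symm' (hmin j))

theorem IsCadlag.restrict {w : ℝ≥0 → MarkPart} (hw : IsCadlag w) (J : Finset ℕ) :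
    IsCadlag fun t => restrict J (w t) := fun t => by
  refine ⟨((continuous_restrict J).tendsto _).comp (hw t).1, ?_⟩
  obtain ⟨l, hl⟩ := (hw t).2
  exact ⟨_, ((continuous_restrict J).tendsto _).comp hl⟩

theorem IsCadlag.glue {a b : ℝ≥0 → MarkPart} (ha : IsCadlag a) (hb : IsCadlag b) (J : Finset ℕ) :
    IsCadlag fun t => glue J (a t) (b t) := by
  have key : ∀ {l : Filter ℝ≥0} {x z : MarkPart}, Tendsto a l (𝓝 x) → Tendsto b l (𝓝 z) →
      Tendsto (fun t => MarkPart.glue J (a t) (b t)) l (𝓝 (MarkPart.glue J x z)) := by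
    intro l x z hx hz
    refine tendsto_iff.2 ⟨fun i j => ?_, fun i => ?_⟩
    · filter_upwards [(tendsto_iff.1 hx).1 i j, (tendsto_iff.1 hz).1 i j] with t h1 h2
      exact or_congr (and_congr_right fun _ => and_congr_right fun _ => h1)
        (and_congr_right fun _ => and_congr_right fun _ => h2)
    · by_cases hi : i ∈ J
      · simpa only [MarkPart.glue, if_pos hi] using (tendsto_iff.1 hx).2 i
      · simpa only [MarkPart.glue, if_neg hi] using (tendsto_iff.1 hz).2 i
  intro t
  obtain ⟨l, hl⟩ := (ha t).2
  obtain ⟨m, hm⟩ := (hb t).2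
  exact ⟨key (ha t).1 (hb t).1, _, key hl hm⟩

end MarkPart

/-- The restriction of a path. -/
def res (J : Finset ℕ) (w : Path) : Path := ⟨fun t => restrict J (w.1 t), w.2.restrict J⟩

theorem measurable_res (J : Finset ℕ) : Measurable (res J) :=
  measurable_toPath.2 fun t => (measurable_restrict J).comp (measurable_coord t)

theorem res_res {J K : Finset ℕ} (h : J ⊆ K) (w : Path) : res J (res K w) = res J w :=
  Subtype.ext (funext fun _ => restrict_restrict h _)

/-- The path that coincides with `p.1` on `J` and with `p.2` off `J`. -/
def gluePath (J : Finset ℕ) (p : Path × Path) : Path :=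
  ⟨fun t => glue J (p.1.1 t) (p.2.1 t), p.1.2.glue p.2.2 J⟩

theorem measurable_gluePath (J : Finset ℕ) : Measurable (gluePath J) := by
  refine measurable_toPath.2 fun t => MarkPart.measurable_iff.2 ⟨fun i j => ?_, fun i => ?_⟩
  · have h1 : MeasurableSet {p : Path × Path | (p.1.1 t).part i j} :=
      ((measurable_coord t).comp measurable_fst) (measurableSet_part i j)
    have h2 : MeasurableSet {p : Path × Path | (p.2.1 t).part i j} :=
      ((measurable_coord t).comp measurable_snd) (measurableSet_part i j)
    exact ((MeasurableSet.const _).inter ((MeasurableSet.const _).inter h1)).union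
      ((MeasurableSet.const _).inter ((MeasurableSet.const _).inter h2))
  · by_cases hi : i ∈ J
    · have e : (fun p => ((gluePath J p).1 t).mark i) = fun p => (p.1.1 t).mark i :=
        funext fun p => if_pos hi
      rw [e]
      exact (measurable_mark i).comp ((measurable_coord t).comp measurable_fst)
    · have e : (fun p => ((gluePath J p).1 t).mark i) = fun p => (p.2.1 t).mark i :=
        funext fun p => if_neg hi
      rw [e]
      exact (measurable_mark i).comp ((measurable_coord t).comp measurable_snd)

theorem gluePath_res {J K : Finset ℕ} (h : Disjoint J K) {w : Path}
    (hw : ∀ t, ∀ i ∈ J, ∀ j ∈ K, ¬(w.1 t).part i j) :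
    gluePath J (res J w, res K w) = res (J ∪ K) w :=
  Subtype.ext (funext fun t => glue_restrict h (hw t))

theorem isCountablySpanning_boxes (α β : Type*) [MeasurableSpace α] [MeasurableSpace β] :
    IsCountablySpanning (Set.image2 (fun (s : Set α) (t : Set β) => s ×ˢ t) {s | MeasurableSet s}
      {t | MeasurableSet t}) :=
  ⟨fun _ => Set.univ, fun _ => ⟨Set.univ, MeasurableSet.univ, Set.univ, MeasurableSet.univ,
    Set.univ_prod_univ⟩, Set.iUnion_const _⟩

theorem ext_prod_prod {α β γ δ : Type*} [MeasurableSpace α] [MeasurableSpace β]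
    [MeasurableSpace γ] [MeasurableSpace δ] {μ ν : Measure ((α × β) × (γ × δ))}
    [IsFiniteMeasure μ] (h : ∀ (s : Set α) (t : Set β) (u : Set γ) (v : Set δ), MeasurableSet s →
      MeasurableSet t → MeasurableSet u → MeasurableSet v →
      μ ((s ×ˢ t) ×ˢ (u ×ˢ v)) = ν ((s ×ˢ t) ×ˢ (u ×ˢ v))) : μ = ν := by
  refine ext_of_generate_finite _
    (generateFrom_eq_prod generateFrom_prod generateFrom_prod
      (isCountablySpanning_boxes α β) (isCountablySpanning_boxes γ δ)).symm
    (isPiSystem_prod.prod isPiSystem_prod) ?_ ?_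
  · rintro _ ⟨_, ⟨s, hs, t, ht, rfl⟩, _, ⟨u, hu, v, hv, rfl⟩, rfl⟩
    exact h s t u v hs ht hu hv
  · have := h Set.univ Set.univ Set.univ Set.univ .univ .univ .univ .univ
    simpa only [Set.univ_prod_univ] using this

namespace BranchLaw

variable {γ : ℝ} {R : Kernel MarkPart Path} [IsMarkovKernel R]

/-- The law of the restriction depends only on the restriction of the initial state. -/
theorem map_res_restrict (hR : BranchLaw γ R) (J : Finset ℕ) (y : MarkPart) :
    (R (restrict J y)).map (res J) = (R y).map (res J) := by
  classical
  set y' := restrict J y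
  have hlab : ∀ i ∈ J, ∀ j ∈ J, (y'.blockLabel i = y'.blockLabel j ↔
      y.blockLabel i = y.blockLabel j) := fun i hi j hj => by
    rw [blockLabel_eq_iff, blockLabel_eq_iff, restrict_part hi hj]
  -- Labels of blocks that meet `J` change when the state is restricted to `J`. This injection
  -- matches them, sending all other labels above those in use, and an i.i.d. sequence reindexed by
  -- an injection keeps its law.
  let σ : ℕ → ℕ := fun k => if h : ∃ i ∈ J, y'.blockLabel i = k then y.blockLabel h.choose
    else J.sup y.blockLabel + 1 + k
  have hσ : ∀ i ∈ J, σ (y'.blockLabel i) = y.blockLabel i := fun i hi => by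
    have h : ∃ j ∈ J, y'.blockLabel j = y'.blockLabel i := ⟨i, hi, rfl⟩
    change (if h : ∃ j ∈ J, y'.blockLabel j = y'.blockLabel i then y.blockLabel h.choose
      else _) = _
    rw [dif_pos h]
    exact (hlab _ h.choose_spec.1 i hi).1 h.choose_spec.2
  have hinj : Function.Injective σ := by
    have hle : ∀ i ∈ J, y.blockLabel i ≤ J.sup y.blockLabel := fun i hi =>
      Finset.le_sup (f := y.blockLabel) hi
    have hno : ∀ k, (¬∃ i ∈ J, y'.blockLabel i = k) → σ k = J.sup y.blockLabel + 1 + k :=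
      fun k hk => dif_neg hk
    intro k l hkl
    by_cases hk : ∃ i ∈ J, y'.blockLabel i = k <;> by_cases hl : ∃ i ∈ J, y'.blockLabel i = l
    · obtain ⟨i, hi, rfl⟩ := hk
      obtain ⟨j, hj, rfl⟩ := hl
      rw [hσ i hi, hσ j hj] at hkl
      exact (hlab i hi j hj).2 hkl
    · obtain ⟨i, hi, rfl⟩ := hk
      rw [hσ i hi, hno l hl] at hkl
      have := hle i hi
      omega
    · obtain ⟨j, hj, rfl⟩ := hl
      rw [hσ j hj, hno k hk] at hkl
      have := hle j hj
      omega
    · rw [hno k hk, hno l hl] at hkl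
      omega
  have hfrag : ∀ f : ℕ → Path, res J (frag γ y' fun k => f (σ k)) = res J (frag γ y f) := by
    intro f
    refine Subtype.ext (funext fun t => restrict_eq_iff.2 ⟨fun i hi j hj => ?_, fun i hi => ?_⟩)
    · change (y'.part i j ∧ ((f (σ (y'.blockLabel i))).1 ((y'.mark i).pow γ * t)).part i j) ↔
        (y.part i j ∧ ((f (y.blockLabel i)).1 ((y.mark i).pow γ * t)).part i j)
      rw [hσ i hi, restrict_mark hi, restrict_part hi hj]
    · change y'.mark i * ((f (σ (y'.blockLabel i))).1 ((y'.mark i).pow γ * t)).mark i =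
        y.mark i * ((f (y.blockLabel i)).1 ((y.mark i).pow γ * t)).mark i
      rw [hσ i hi, restrict_mark hi]
  have hlaw : (Measure.infinitePi fun _ : ℕ => R one).map (fun f k => f (σ k)) =
      Measure.infinitePi fun _ : ℕ => R one :=
    Measure.map_infinitePi_infinitePi_of_inj (P := fun _ : ℕ => R one) hinj
  have hm : Measurable fun (f : ℕ → Path) k => f (σ k) :=
    measurable_pi_lambda _ fun k => measurable_pi_apply (σ k)
  rw [hR.branching y', hR.branching y, Measure.map_map (measurable_res J) (measurable_frag γ _),
    Measure.map_map (measurable_res J) (measurable_frag γ _)]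
  conv_lhs => rw [← hlaw]
  rw [Measure.map_map ((measurable_res J).comp (measurable_frag γ _)) hm]
  congr 1
  exact funext hfrag

theorem measure_res_restrict (hR : BranchLaw γ R) (J : Finset ℕ) (y : MarkPart) {B : Set Path}
    (hB : MeasurableSet B) : R (restrict J y) (res J ⁻¹' B) = R y (res J ⁻¹' B) := by
  rw [← Measure.map_apply (measurable_res J) hB, ← Measure.map_apply (measurable_res J) hB,
    hR.map_res_restrict J y]

/-- Blocks that meet `J` and blocks that meet `K` carry different labels, so the two restrictions
are functions of disjoint families of independent copies. -/
theorem indepFun_res (hR : BranchLaw γ R) {J K : Finset ℕ} {y : MarkPart}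
    (hy : ∀ i ∈ J, ∀ j ∈ K, ¬y.part i j) : IndepFun (res J) (res K) (R y) := by
  classical
  have hext : ∀ (J : Finset ℕ), ∃ φ : (J.image y.blockLabel → Path) → Path, Measurable φ ∧
      ∀ f : ℕ → Path, res J (frag γ y f) = φ fun k => f k := by
    intro J
    refine ⟨fun g => res J (frag γ y fun k =>
      if h : k ∈ J.image y.blockLabel then g ⟨k, h⟩ else constPath one), ?_, fun f => ?_⟩
    · refine (measurable_res J).comp ((measurable_frag γ y).comp (measurable_pi_lambda _ fun k => ?_))
      by_cases h : k ∈ J.image y.blockLabel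
      · simpa only [dif_pos h] using measurable_pi_apply (⟨k, h⟩ : J.image y.blockLabel)
      · simp only [dif_neg h, measurable_const]
    · refine Subtype.ext (funext fun t => restrict_eq_iff.2 ⟨fun i hi j hj => ?_, fun i hi => ?_⟩)
      · have h : y.blockLabel i ∈ J.image y.blockLabel := Finset.mem_image_of_mem _ hi
        change (y.part i j ∧ ((f (y.blockLabel i)).1 ((y.mark i).pow γ * t)).part i j) ↔
          (y.part i j ∧ (Subtype.val (if h : y.blockLabel i ∈ J.image y.blockLabel then
            f (y.blockLabel i) else constPath one) ((y.mark i).pow γ * t)).part i j)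
        rw [dif_pos h]
      · have h : y.blockLabel i ∈ J.image y.blockLabel := Finset.mem_image_of_mem _ hi
        change y.mark i * ((f (y.blockLabel i)).1 ((y.mark i).pow γ * t)).mark i =
          y.mark i * (Subtype.val (if h : y.blockLabel i ∈ J.image y.blockLabel then
            f (y.blockLabel i) else constPath one) ((y.mark i).pow γ * t)).mark i
        rw [dif_pos h]
  obtain ⟨φ, hφ, hφe⟩ := hext J
  obtain ⟨ψ, hψ, hψe⟩ := hext K
  have hdisj : Disjoint (J.image y.blockLabel) (K.image y.blockLabel) := by
    refine Finset.disjoint_left.2 fun k hk hk' => ?_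
    obtain ⟨i, hi, rfl⟩ := Finset.mem_image.1 hk
    obtain ⟨j, hj, hij⟩ := Finset.mem_image.1 hk'
    exact hy i hi j hj (blockLabel_eq_iff.1 hij.symm)
  have hind := ((iIndepFun_infinitePi (P := fun _ : ℕ => R one) (X := fun _ w => w)
    fun _ => measurable_id).indepFun_finset _ _ hdisj fun k => measurable_pi_apply k).comp hφ hψ
  rw [indepFun_iff_measure_inter_preimage_eq_mul] at hind ⊢
  intro A B hA hB
  have := hind A B hA hB
  rw [hR.branching y, Measure.map_apply (measurable_frag γ y)
    ((measurable_res J hA).inter (measurable_res K hB)),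
    Measure.map_apply (measurable_frag γ y) (measurable_res J hA),
    Measure.map_apply (measurable_frag γ y) (measurable_res K hB)]
  have e1 : frag γ y ⁻¹' (res J ⁻¹' A) = (φ ∘ fun (f : ℕ → Path) (k : J.image y.blockLabel) => f k) ⁻¹' A := by
    ext f
    simp only [Set.mem_preimage, hφe, Function.comp_apply]
  have e2 : frag γ y ⁻¹' (res K ⁻¹' B) = (ψ ∘ fun (f : ℕ → Path) (k : K.image y.blockLabel) => f k) ⁻¹' B := by
    ext f
    simp only [Set.mem_preimage, hψe, Function.comp_apply]
  rw [Set.preimage_inter, e1, e2]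
  exact this

/-! ## The Markov property of restrictions -/

/-- The law of the restriction of a path from the state at time `t` of a path. -/
def resKernel (R : Kernel MarkPart Path) (J : Finset ℕ) (t : ℝ≥0) : Kernel Path Path :=
  (R.map (res J)).comap (coord t) (measurable_coord t)

instance (J : Finset ℕ) (t : ℝ≥0) : IsMarkovKernel (resKernel R J t) := by
  have := Kernel.IsMarkovKernel.map R (measurable_res J)
  exact Kernel.IsMarkovKernel.comap _ _

theorem resKernel_apply (J : Finset ℕ) (t : ℝ≥0) (p : Path) :
    resKernel R J t p = (R (p.1 t)).map (res J) := by
  rw [resKernel, Kernel.comap_apply, Kernel.map_apply _ (measurable_res J)]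
  rfl

/-- The Markov property, at time `t` and for the initial state `x`, of the restriction to `J`. -/
def ResMarkov (R : Kernel MarkPart Path) (J : Finset ℕ) (x : MarkPart) (t : ℝ≥0) : Prop :=
  (R x).map (fun w => (res J (stopAt t w), res J (shift t w))) =
    ((R x).map (fun w => res J (stopAt t w))).compProd (resKernel R J t)

theorem resMarkov_iff (hR : BranchLaw γ R) {J : Finset ℕ} {x : MarkPart} {t : ℝ≥0} :
    ResMarkov R J x t ↔ ∀ A B : Set Path, MeasurableSet A → MeasurableSet B →
      R x {w | res J (stopAt t w) ∈ A ∧ res J (shift t w) ∈ B} =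
        ∫⁻ w in {w | res J (stopAt t w) ∈ A}, R (w.1 t) (res J ⁻¹' B) ∂(R x) := by
  have h1 : Measurable fun w => res J (stopAt t w) := (measurable_res J).comp (measurable_stop t)
  have h2 : Measurable fun w => res J (shift t w) := (measurable_res J).comp (measurable_shift t)
  have key : ∀ A B : Set Path, MeasurableSet A → MeasurableSet B →
      (((R x).map (fun w => (res J (stopAt t w), res J (shift t w)))) (A ×ˢ B) =
        R x {w | res J (stopAt t w) ∈ A ∧ res J (shift t w) ∈ B}) ∧
      ((((R x).map (fun w => res J (stopAt t w))).compProd (resKernel R J t)) (A ×ˢ B) =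
        ∫⁻ w in {w | res J (stopAt t w) ∈ A}, R (w.1 t) (res J ⁻¹' B) ∂(R x)) := by
    intro A B hA hB
    constructor
    · rw [Measure.map_apply (h1.prodMk h2) (hA.prod hB)]
      rfl
    · rw [Measure.compProd_apply_prod hA hB,
        setLIntegral_map hA ((resKernel R J t).measurable_coe hB) h1]
      refine lintegral_congr fun w => ?_
      rw [resKernel_apply, Measure.map_apply (measurable_res J) hB]
      have e : (res J (stopAt t w)).1 t = restrict J (w.1 t) :=
        congrArg (restrict J) (stop_apply_of_le le_rfl w)
      rw [e, hR.measure_res_restrict J _ hB]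
  constructor
  · intro h A B hA hB
    rw [← (key A B hA hB).1, ← (key A B hA hB).2, h]
  · intro h
    have : IsProbabilityMeasure ((R x).map fun w => (res J (stopAt t w), res J (shift t w))) :=
      Measure.isProbabilityMeasure_map (h1.prodMk h2).aemeasurable
    refine Measure.ext_prod fun {A B} hA hB => ?_
    rw [(key A B hA hB).1, (key A B hA hB).2, h A B hA hB]

theorem ae_not_part_of_regular (hR : BranchLaw γ R)
    (hreg : ∀ x, ∀ᵐ w ∂(R x), Regular w.1) {J K : Finset ℕ} {y : MarkPart}
    (hy : ∀ i ∈ J, ∀ j ∈ K, ¬y.part i j) :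
    ∀ᵐ w ∂(R y), ∀ t, ∀ i ∈ J, ∀ j ∈ K, ¬(w.1 t).part i j := by
  filter_upwards [hreg y, hR.start y] with w hw h0 t i hi j hj h
  have := hw.mono zero_le h
  rw [h0] at this
  exact hy i hi j hj this

/-- The restrictions to two separated sets are jointly Markov. -/
theorem ResMarkov.union (hR : BranchLaw γ R) (hreg : ∀ x, ∀ᵐ w ∂(R x), Regular w.1)
    {J K : Finset ℕ} (hJK : Disjoint J K) {x : MarkPart} {t : ℝ≥0}
    (hx : ∀ i ∈ J, ∀ j ∈ K, ¬x.part i j) (hJ : ResMarkov R J x t) (hK : ResMarkov R K x t) :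
    ResMarkov R (J ∪ K) x t := by
  have m1 : ∀ J, Measurable fun w => res J (stopAt t w) := fun J =>
    (measurable_res J).comp (measurable_stop t)
  have m2 : ∀ J, Measurable fun w => res J (shift t w) := fun J =>
    (measurable_res J).comp (measurable_shift t)
  have mJ : Measurable fun w => (res J (stopAt t w), res K (stopAt t w)) := (m1 J).prodMk (m1 K)
  have mK : Measurable fun w => (res J (shift t w), res K (shift t w)) := (m2 J).prodMk (m2 K)
  have hind : ∀ {y : MarkPart}, (∀ i ∈ J, ∀ j ∈ K, ¬y.part i j) → ∀ {A B : Set Path},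
      MeasurableSet A → MeasurableSet B →
      R y (res J ⁻¹' A ∩ res K ⁻¹' B) = R y (res J ⁻¹' A) * R y (res K ⁻¹' B) := fun hy A B hA hB =>
    indepFun_iff_measure_inter_preimage_eq_mul.1 (hR.indepFun_res hy) A B hA hB
  set ν₁ := (R x).map fun w => res J (stopAt t w)
  set ν₂ := (R x).map fun w => res K (stopAt t w)
  have : IsProbabilityMeasure ν₁ := Measure.isProbabilityMeasure_map (m1 J).aemeasurable
  have : IsProbabilityMeasure ν₂ := Measure.isProbabilityMeasure_map (m1 K).aemeasurable
  have : IsProbabilityMeasure ((R x).map fun w => ((res J (stopAt t w), res K (stopAt t w)),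
      (res J (shift t w), res K (shift t w)))) :=
    Measure.isProbabilityMeasure_map (mJ.prodMk mK).aemeasurable
  -- The initial state separates `J` and `K`, so past and future on `J` are independent of past and
  -- future on `K`, and the two Markov properties multiply.
  have hm : (R x).map (fun w => ((res J (stopAt t w), res K (stopAt t w)),
      (res J (shift t w), res K (shift t w)))) =
      (ν₁.prod ν₂).compProd ((resKernel R J t).parallelComp (resKernel R K t)) := by
    refine ext_prod_prod fun A₁ A₂ B₁ B₂ hA₁ hA₂ hB₁ hB₂ => ?_
    rw [Measure.map_apply (mJ.prodMk mK) ((hA₁.prod hA₂).prod (hB₁.prod hB₂)),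
      Measure.compProd_apply_prod (hA₁.prod hA₂) (hB₁.prod hB₂)]
    have e1 : (fun w => ((res J (stopAt t w), res K (stopAt t w)),
        (res J (shift t w), res K (shift t w)))) ⁻¹' ((A₁ ×ˢ A₂) ×ˢ (B₁ ×ˢ B₂)) =
        res J ⁻¹' {w | stopAt t w ∈ A₁ ∧ shift t w ∈ B₁} ∩
          res K ⁻¹' {w | stopAt t w ∈ A₂ ∧ shift t w ∈ B₂} := by
      ext w
      constructor
      · rintro ⟨⟨h1, h2⟩, h3, h4⟩
        exact ⟨⟨h1, h3⟩, h2, h4⟩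
      · rintro ⟨⟨h1, h3⟩, h2, h4⟩
        exact ⟨⟨h1, h2⟩, h3, h4⟩
    have hres : ∀ {J : Finset ℕ} {A B : Set Path}, MeasurableSet A → MeasurableSet B →
        ResMarkov R J x t → R x (res J ⁻¹' (stopAt t ⁻¹' A ∩ shift t ⁻¹' B)) =
          ∫⁻ p in A, resKernel R J t p B ∂((R x).map fun w => res J (stopAt t w)) := by
      intro J A B hA hB h
      rw [← Measure.compProd_apply_prod hA hB, ← h,
        Measure.map_apply ((m1 J).prodMk (m2 J)) (hA.prod hB)]
      rfl
    rw [e1]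
    refine (hind hx ((measurable_stop t hA₁).inter (measurable_shift t hB₁))
      ((measurable_stop t hA₂).inter (measurable_shift t hB₂))).trans ?_
    rw [hres hA₁ hB₁ hJ, hres hA₂ hB₂ hK,
      ← Measure.prod_restrict,
      ← lintegral_prod_mul ((resKernel R J t).measurable_coe hB₁).aemeasurable
        ((resKernel R K t).measurable_coe hB₂).aemeasurable]
    refine lintegral_congr fun p => ?_
    rw [Kernel.parallelComp_apply, Measure.prod_prod]
  have hglue : ∀ {y : MarkPart}, (∀ i ∈ J, ∀ j ∈ K, ¬y.part i j) →
      ∀ᵐ w ∂(R y), gluePath J (res J w, res K w) = res (J ∪ K) w := fun hy => by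
    filter_upwards [hR.ae_not_part_of_regular hreg hy] with w hw
    exact gluePath_res hJK hw
  refine hR.resMarkov_iff.2 fun A B hA hB => ?_
  have hgA := measurable_gluePath J hA
  have hgB := measurable_gluePath J hB
  have hae : ∀ᵐ w ∂(R x), gluePath J (res J (stopAt t w), res K (stopAt t w)) = res (J ∪ K) (stopAt t w) ∧
      gluePath J (res J (shift t w), res K (shift t w)) = res (J ∪ K) (shift t w) := by
    filter_upwards [hR.ae_not_part_of_regular hreg hx] with w hw
    exact ⟨gluePath_res hJK fun s => hw _, gluePath_res hJK fun s => hw _⟩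
  -- A glued state separates `J` and `K`. By independence the product of the two kernels is then the
  -- joint law of the restrictions started from it, and gluing recovers the restriction to `J ∪ K`.
  have hker : ∀ p : Path × Path, ((resKernel R J t).parallelComp (resKernel R K t)) p
      (gluePath J ⁻¹' B) = R ((gluePath J p).1 t) (res (J ∪ K) ⁻¹' B) := by
    intro p
    set z := (gluePath J p).1 t
    have hz : ∀ i ∈ J, ∀ j ∈ K, ¬z.part i j := fun i hi j hj =>
      glue_not_part hi fun hj' => Finset.disjoint_left.1 hJK hj' hj
    have e1 : (R (p.1.1 t)).map (res J) = (R z).map (res J) := by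
      rw [← hR.map_res_restrict J (p.1.1 t), ← hR.map_res_restrict J z]
      exact congrArg (fun y => (R y).map (res J)) restrict_glue_left.symm
    have e2 : (R (p.2.1 t)).map (res K) = (R z).map (res K) := by
      rw [← hR.map_res_restrict K (p.2.1 t), ← hR.map_res_restrict K z]
      exact congrArg (fun y => (R y).map (res K)) (restrict_glue_right hJK).symm
    rw [Kernel.parallelComp_apply, resKernel_apply, resKernel_apply, e1, e2,
      ← (indepFun_iff_map_prod_eq_prod_map_map (measurable_res J).aemeasurable
        (measurable_res K).aemeasurable).1 (hR.indepFun_res hz),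
      Measure.map_apply ((measurable_res J).prodMk (measurable_res K)) hgB]
    refine measure_congr ?_
    filter_upwards [hglue hz] with w hw
    exact propext (by change gluePath J (res J w, res K w) ∈ B ↔ _; rw [hw]; rfl)
  have hmeas : Measurable fun y : MarkPart => R y (res (J ∪ K) ⁻¹' B) :=
    R.measurable_coe (measurable_res _ hB)
  calc R x {w | res (J ∪ K) (stopAt t w) ∈ A ∧ res (J ∪ K) (shift t w) ∈ B}
      = (R x).map (fun w => ((res J (stopAt t w), res K (stopAt t w)),
          (res J (shift t w), res K (shift t w)))) ((gluePath J ⁻¹' A) ×ˢ (gluePath J ⁻¹' B)) := by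
        rw [Measure.map_apply (mJ.prodMk mK) (hgA.prod hgB)]
        refine measure_congr ?_
        filter_upwards [hae] with w hw
        refine propext ?_
        change (res (J ∪ K) (stopAt t w) ∈ A ∧ res (J ∪ K) (shift t w) ∈ B) ↔
          (gluePath J (res J (stopAt t w), res K (stopAt t w)) ∈ A ∧
            gluePath J (res J (shift t w), res K (shift t w)) ∈ B)
        rw [hw.1, hw.2]
    _ = ∫⁻ p in gluePath J ⁻¹' A, R ((gluePath J p).1 t) (res (J ∪ K) ⁻¹' B) ∂(ν₁.prod ν₂) := by
        rw [hm, Measure.compProd_apply_prod hgA hgB]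
        exact lintegral_congr hker
    _ = ∫⁻ p in gluePath J ⁻¹' A, R ((gluePath J p).1 t) (res (J ∪ K) ⁻¹' B)
          ∂((R x).map fun w => (res J (stopAt t w), res K (stopAt t w))) := by
        congr 2
        have := congrArg Measure.fst hm
        rw [Measure.fst_compProd, Measure.fst_map_prodMk mK] at this
        exact this.symm
    _ = _ := by
        rw [setLIntegral_map (f := fun p => R ((gluePath J p).1 t) (res (J ∪ K) ⁻¹' B)) hgA (hmeas.comp ((measurable_coord t).comp (measurable_gluePath J))) mJ]
        have hset : {w | res (J ∪ K) (stopAt t w) ∈ A} =ᵐ[R x]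
            (fun w => (res J (stopAt t w), res K (stopAt t w))) ⁻¹' (gluePath J ⁻¹' A) := by
          filter_upwards [hae] with w hw
          refine propext ?_
          change res (J ∪ K) (stopAt t w) ∈ A ↔ gluePath J (res J (stopAt t w), res K (stopAt t w)) ∈ A
          rw [hw.1]
        rw [setLIntegral_congr hset]
        refine lintegral_congr_ae (ae_restrict_of_ae ?_)
        filter_upwards [hae] with w hw
        rw [hw.1]
        have e : (res (J ∪ K) (stopAt t w)).1 t = restrict (J ∪ K) (w.1 t) :=
          congrArg (restrict (J ∪ K)) (stop_apply_of_le le_rfl w)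
        rw [e, hR.measure_res_restrict _ _ hB]

/-- At time `0` there is nothing to prove. -/
theorem resMarkov_zero (hR : BranchLaw γ R) (J : Finset ℕ) (x : MarkPart) : ResMarkov R J x 0 := by
  refine hR.resMarkov_iff.2 fun A B hA hB => ?_
  have h1 : ∀ᵐ w ∂(R x), stopAt 0 w = constPath x := by
    filter_upwards [hR.start x] with w hw
    exact Subtype.ext (funext fun s => (congrArg w.1 (min_eq_right zero_le)).trans hw)
  by_cases hc : res J (constPath x) ∈ A
  · have e1 : {w | res J (stopAt 0 w) ∈ A ∧ res J (shift 0 w) ∈ B} =ᵐ[R x] res J ⁻¹' B := by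
      filter_upwards [h1] with w hw
      refine propext ?_
      change (res J (stopAt 0 w) ∈ A ∧ res J (shift 0 w) ∈ B) ↔ res J w ∈ B
      rw [hw, shift_zero]
      exact and_iff_right hc
    have e2 : {w | res J (stopAt 0 w) ∈ A} =ᵐ[R x] Set.univ := by
      filter_upwards [h1] with w hw
      refine propext ?_
      change res J (stopAt 0 w) ∈ A ↔ True
      rw [hw]
      exact iff_of_true hc trivial
    rw [measure_congr e1, setLIntegral_congr e2, setLIntegral_univ,
      lintegral_congr_ae (g := fun _ => R x (res J ⁻¹' B))]
    · simp
    · filter_upwards [hR.start x] with w hw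
      rw [hw]
  · have e2 : {w | res J (stopAt 0 w) ∈ A} =ᵐ[R x] (∅ : Set Path) := by
      filter_upwards [h1] with w hw
      refine propext ?_
      change res J (stopAt 0 w) ∈ A ↔ False
      rw [hw]
      exact iff_of_false hc id
    rw [setLIntegral_congr e2, Measure.restrict_empty, lintegral_zero_measure]
    refine measure_mono_null (fun w hw => hw.1) (measure_congr e2 |>.trans measure_empty)

end BranchLaw

/-! ### The splitting time of a finite set, and shifts of good paths. -/

namespace MarkPart

theorem Good.shift {β : ℝ} {w : ℝ≥0 → MarkPart} (hg : Good β w) (T : ℝ≥0) :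
    Good β fun t => w (T + t) := by
  refine ⟨hg.toRegular.shift T, fun i ⟨c, hc⟩ => ?_⟩
  by_cases hT : (w T).mark i = 0
  · refine tendsto_const_nhds.congr fun t => ?_
    exact (hg.toRegular.mark_eq_zero le_self_add hT).symm
  · obtain ⟨b, hb⟩ : ∃ b : ℝ≥0, (b : ℝ≥0∞) = clock β w i T :=
      ⟨_, ENNReal.coe_toNNReal (hg.toRegular.clock_ne_top hT)⟩
    have h1 := hg.vanish i ⟨b + c, fun u => by
      refine (clock_mono β w i (le_add_self : u ≤ T + u)).trans ?_
      rw [clock_add, ← hb, ENNReal.coe_add]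
      gcongr
      exact hc u⟩
    exact h1.comp (tendsto_atTop_mono (fun t => le_add_self) tendsto_id)

/-- The partition with a single block, with mark `v`. -/
def single (v : Mark) : MarkPart where
  part := ⊤
  mark := fun _ => v
  mark_eq := fun _ => rfl

theorem measurable_single : Measurable single :=
  measurable_iff.2 ⟨fun _ _ => MeasurableSet.univ, fun _ => measurable_id⟩

/-- The elements of `J` are in the same block up to time `s`. -/
def Together (J : Finset ℕ) (w : ℝ≥0 → MarkPart) (s : ℝ≥0) : Prop :=
  ∀ r ≤ s, ∀ i ∈ J, ∀ j ∈ J, (w r).part i j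

variable {J : Finset ℕ} {w : ℝ≥0 → MarkPart} {s t : ℝ≥0}

theorem Together.exists_gt (hw : IsCadlag w) (h : Together J w s) : ∃ t > s, Together J w t := by
  have hev : ∀ᶠ r in 𝓝[≥] s, ∀ i ∈ J, ∀ j ∈ J, (w r).part i j := by
    refine (J.eventually_all).2 fun i hi => (J.eventually_all).2 fun j hj => ?_
    exact (hw.eventually_part s i j).mono fun r hr => hr.2 (h s le_rfl i hi j hj)
  obtain ⟨d, hd, hball⟩ := (nhdsGE_basis s).mem_iff.1 hev
  obtain ⟨t, hst, htd⟩ := exists_between hd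
  refine ⟨t, hst, fun r hr => ?_⟩
  rcases le_total r s with hrs | hrs
  · exact h r hrs
  · exact hball ⟨hrs, hr.trans_lt htd⟩

theorem together_iff_grid (hw : IsCadlag w) : Together J w s ↔
    (∀ i ∈ J, ∀ j ∈ J, (w s).part i j) ∧
      ∀ n, grid n ≤ s → ∀ i ∈ J, ∀ j ∈ J, (w (grid n)).part i j := by
  refine ⟨fun h => ⟨h s le_rfl, fun n hn => h _ hn⟩, fun ⟨h1, h2⟩ r hr i hi j hj => ?_⟩
  rcases hr.eq_or_lt with rfl | hr
  · exact h1 i hi j hj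
  · obtain ⟨n, -, hn, hn'⟩ := exists_grid_right (hw.eventually_part r i j) hr
    exact hn'.1 (h2 n hn.le i hi j hj)

end MarkPart

/-- The first time at which the elements of `J` are not in the same block. -/
def splitTime (J : Finset ℕ) (w : Path) : ℝ≥0∞ := sInf {r | ∃ s : ℝ≥0, r = s ∧ ¬Together J w.1 s}

theorem splitTime_le_iff {J : Finset ℕ} {w : Path} {s : ℝ≥0} :
    splitTime J w ≤ s ↔ ¬Together J w.1 s := by
  constructor
  · intro h hs
    obtain ⟨t, hst, ht⟩ := hs.exists_gt w.2
    obtain ⟨_, ⟨u, rfl, hu⟩, hut⟩ := sInf_lt_iff.1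
      (lt_of_le_of_lt h (show (s : ℝ≥0∞) < t by exact_mod_cast hst))
    exact hu fun r hr => ht r (hr.trans (by exact_mod_cast hut.le))
  · intro h
    exact sInf_le ⟨s, rfl, h⟩

theorem measurable_splitTime (J : Finset ℕ) : Measurable (splitTime J) := by
  refine measurable_of_Iic fun a => ?_
  induction a using ENNReal.recTopCoe with
  | top => simp
  | coe s =>
    have e : splitTime J ⁻¹' Set.Iic (s : ℝ≥0∞) = {w : Path | ¬((∀ i ∈ J, ∀ j ∈ J,
        (w.1 s).part i j) ∧ ∀ n, grid n ≤ s → ∀ i ∈ J, ∀ j ∈ J, (w.1 (grid n)).part i j)} := by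
      ext w
      exact splitTime_le_iff.trans (not_congr (together_iff_grid w.2))
    have hp : ∀ t, Measurable fun w : Path => ∀ i ∈ J, ∀ j ∈ J, (w.1 t).part i j := fun t =>
      .forall fun i => .imp measurable_const (.forall fun j => .imp measurable_const
        (measurableSet_setOfPred.1 (measurable_coord t (measurableSet_part i j))))
    rw [e]
    exact measurableSet_setOfPred.2 (Measurable.not (Measurable.and (hp s)
      (.forall fun n => .imp measurable_const (hp (grid n)))))

theorem isStopping_splitTime (J : Finset ℕ) : IsStopping (splitTime J) := fun s w => by
  rw [splitTime_le_iff, splitTime_le_iff, not_iff_not]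
  exact forall₂_congr fun r hr => by rw [stop_apply_of_le hr]

theorem clock_stop (β : ℝ) (w : Path) (i : ℕ) {s u : ℝ≥0} (h : u ≤ s) :
    clock β (stopAt s w).1 i u = clock β w.1 i u :=
  clock_congr fun r hr => by rw [stop_apply_of_le (hr.le.trans h)]

theorem isStopping_tau (β : ℝ) (t : ℝ≥0) (i : ℕ) : IsStopping fun w => tau β w.1 t i := fun s w => by
  rw [tau_le_iff, tau_le_iff]
  have : ∀ n, grid n ≤ s → clock β (stopAt s w).1 i (grid n) = clock β w.1 i (grid n) :=
    fun n hn => clock_stop β w i hn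
  refine Eq.congr (iSup_congr fun n => ?_) rfl
  by_cases hn : grid n ≤ s
  · rw [this n hn]
  · simp [hn]

/-! ## The law of the time-changed path -/

/-- The laws of the time-changed path. -/
def timeChangeKernel (β : ℝ) (Q : Kernel MarkPart Path) : Kernel MarkPart Path :=
  Q.map (timeChangePath β)

instance (β : ℝ) (Q : Kernel MarkPart Path) [IsMarkovKernel Q] :
    IsMarkovKernel (timeChangeKernel β Q) :=
  Kernel.IsMarkovKernel.map Q (measurable_timeChangePath β)

theorem timeChangeKernel_apply (β : ℝ) (Q : Kernel MarkPart Path) (x : MarkPart) :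
    timeChangeKernel β Q x = (Q x).map (timeChangePath β) :=
  Kernel.map_apply _ (measurable_timeChangePath β) x

namespace PathLaw

variable {α : ℝ} {Q : Kernel MarkPart Path} [IsMarkovKernel Q]

theorem timeChange_regular (β : ℝ) (Q : Kernel MarkPart Path) (x : MarkPart) :
    ∀ᵐ w ∂(timeChangeKernel β Q x), Regular w.1 := by
  rw [timeChangeKernel_apply, ae_map_iff (measurable_timeChangePath β).aemeasurable
    measurableSet_regular]
  exact Eventually.of_forall fun w => regular_timeChangePath β w

/-- Almost surely the copies and the fragmented path are all good, so `timeChange_ssFrag` applies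
path by path, and the time-changed copies are again i.i.d. -/
theorem timeChange_branchLaw (hQ : PathLaw α Q) (β : ℝ) :
    BranchLaw (α - β) (timeChangeKernel β Q) where
  start x := by
    have hm : MeasurableSet {w : Path | w.1 0 = x} := measurable_coord 0 (measurableSet_singleton x)
    rw [timeChangeKernel_apply, ae_map_iff (measurable_timeChangePath β).aemeasurable hm]
    filter_upwards [hQ.ae_good β x, hQ.start x] with w hw h0
    rw [timeChangePath_of_good hw, timeChange_zero, h0]
  branching x := by
    have hm := measurable_timeChangePath β
    have hpi : Measurable fun (f : ℕ → Path) k => timeChangePath β (f k) :=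
      measurable_pi_lambda _ fun k => hm.comp (measurable_pi_apply k)
    rw [timeChangeKernel_apply, timeChangeKernel_apply, ← Measure.infinitePi_map_pi _ fun _ => hm,
      Measure.map_map (measurable_frag _ x) hpi, hQ.branching x,
      Measure.map_map hm (measurable_frag α x)]
    refine Measure.map_congr ?_
    have h1 : ∀ᵐ f ∂(Measure.infinitePi fun _ : ℕ => Q one), ∀ k, Good β (f k).1 := by
      refine ae_all_iff.2 fun k => ?_
      refine ae_of_ae_map (f := fun f : ℕ → Path => f k) (measurable_pi_apply k).aemeasurable
        (p := fun w => Good β w.1) ?_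
      have e := Measure.infinitePi_map_eval (fun _ : ℕ => Q one) k
      have e' : (Measure.infinitePi fun _ : ℕ => Q one).map (fun f : ℕ → Path => f k) = Q one := e
      rw [e']
      exact hQ.ae_good β one
    have h2 : ∀ᵐ f ∂(Measure.infinitePi fun _ : ℕ => Q one), Good β (frag α x f).1 := by
      refine ae_of_ae_map (measurable_frag α x).aemeasurable (p := fun w => Good β w.1) ?_
      rw [← hQ.branching x]
      exact hQ.ae_good β x
    filter_upwards [h1, h2] with f hf1 hf2
    refine Subtype.ext (funext fun t => ?_)
    change (timeChangePath β (frag α x f)).1 t = ssFrag (α - β) x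
      (fun k => (timeChangePath β (f k)).1) t
    rw [timeChangePath_of_good hf2]
    have e : (fun k => (timeChangePath β (f k)).1) = fun k => timeChange β (f k).1 :=
      funext fun k => funext fun s => timeChangePath_of_good (hf1 k) s
    rw [e]
    exact timeChange_ssFrag α β x (fun k => (f k).1) t

end PathLaw

theorem BranchLaw.ae_res_const {γ : ℝ} {R : Kernel MarkPart Path} (hR : BranchLaw γ R)
    (hreg : ∀ x, ∀ᵐ w ∂(R x), Regular w.1) {J : Finset ℕ} {y : MarkPart}
    (h : restrict J y = restrict J (single 0)) :
    ∀ᵐ w ∂(R y), res J w = constPath (restrict J (single 0)) := by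
  obtain ⟨h1, h2⟩ := restrict_eq_iff.1 h
  filter_upwards [hreg y, hR.start y] with w hw h0
  refine Subtype.ext (funext fun t => restrict_eq_iff.2 ⟨fun i hi j hj => ?_, fun i hi => ?_⟩)
  · refine iff_of_true (hw.frozen zero_le ?_ ?_) trivial
    · rw [h0]; exact h2 i hi
    · rw [h0]; exact (h1 i hi j hj).2 trivial
  · refine hw.mark_eq_zero zero_le ?_
    rw [h0]; exact h2 i hi

/-! ## The Markov property of the time-changed path -/

namespace MarkPart

variable {β : ℝ} {J : Finset ℕ} {i₀ : ℕ} {t r T : ℝ≥0}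

/-- Elements that are never separated share their live times; if `i₀` never reaches the clock value
`t`, none of them is live at `t` or later. -/
theorem Regular.restrict_timeChange_eq_zero {w : ℝ≥0 → MarkPart} (hr : Regular w)
    (hw : IsCadlag w) (hi : i₀ ∈ J) (h : ∀ s, Together J w s) (ht : tau β w t i₀ = ⊤)
    (htr : t ≤ r) : restrict J (timeChange β w r) = restrict J (single 0) := by
  have hno : ∀ i ∈ J, ¬∃ u, Live β w i u r := by
    rintro i hiJ ⟨u, hu⟩
    obtain ⟨v, -, hv⟩ := hr.live_of_le hu htr
    have := hr.tau_eq (hr.live_congr hv (h v v le_rfl i hiJ i₀ hi))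
    rw [ht] at this
    exact ENNReal.coe_ne_top this.symm
  refine restrict_eq_iff.2 ⟨fun i hiJ j hj => ?_, fun i hiJ => ?_⟩
  · exact iff_of_true (((hr.timeChange_of_not_live hw (hno i hiJ)).2 j).2
      fun s => h s s le_rfl i hiJ j hj) trivial
  · exact (hr.timeChange_of_not_live hw (hno i hiJ)).1

end MarkPart

section

variable (β : ℝ) (J : Finset ℕ) (i₀ : ℕ)

/-- The state of the time change at time `r`, on a set `J` that has not been separated, as a function
of the stopped path. -/
def pastState (z : Path × ℝ≥0) (r : ℝ≥0) : MarkPart :=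
  restrict J (single ((z.1.1 (tau β z.1.1 r i₀).toNNReal).mark i₀))

/-- The value of the clock at the time at which a path is stopped. -/
def age (z : Path × ℝ≥0) : ℝ≥0 := (clock β z.1.1 i₀ z.2).toNNReal

open Classical in
/-- The concatenation of the past of the time change and of its future. -/
def concat (z : Path × ℝ≥0) (v : Path) (r : ℝ≥0) : MarkPart :=
  if r < age β i₀ z then pastState β J i₀ z r else v.1 (r - age β i₀ z)

theorem measurable_age : Measurable (age β i₀) := by
  have h : Measurable fun z : Path × ℝ≥0 => clock β z.1.1 i₀ z.2 :=
    (measurable_clock β i₀).comp (measurable_snd.prodMk measurable_fst)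
  exact h.ennreal_toNNReal

theorem measurable_pastState (r : ℝ≥0) : Measurable fun z => pastState β J i₀ z r :=
  (measurable_restrict J).comp (measurable_single.comp
    ((measurable_mark_tau β r i₀ i₀).comp measurable_fst))

theorem measurable_concat :
    Measurable fun p : (Path × ℝ≥0) × Path => concat β J i₀ p.1 p.2 := by
  refine measurable_pi_iff.2 fun r => ?_
  have h : Measurable fun p : (Path × ℝ≥0) × Path => age β i₀ p.1 :=
    (measurable_age β i₀).comp measurable_fst
  refine Measurable.ite (measurableSet_lt measurable_const h)
    ((measurable_pastState β J i₀ r).comp measurable_fst) ?_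
  exact measurable_eval_comp (measurable_const.sub h) measurable_snd

end

namespace MarkPart

variable {β : ℝ} {J : Finset ℕ} {i₀ : ℕ} {t r T : ℝ≥0} {w : Path}

theorem coe_age (hc : clock β w.1 i₀ T ≠ ⊤) : (age β i₀ (ESSF.stopAt T w, T) : ℝ≥0∞) = clock β w.1 i₀ T := by
  rw [age, ENNReal.coe_toNNReal] <;> rw [clock_stop β w i₀ le_rfl]
  exact hc

theorem Regular.restrict_timeChange_past (hr : Regular w.1) (hi : i₀ ∈ J)
    (h : ∀ s < T, ∀ i ∈ J, ∀ j ∈ J, (w.1 s).part i j) (hlt : (r : ℝ≥0∞) < clock β w.1 i₀ T) :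
    restrict J (timeChange β w.1 r) = pastState β J i₀ (ESSF.stopAt T w, T) r := by
  obtain ⟨u, huT, hu⟩ := hr.exists_live_of_lt_clock w.2 hlt
  have hu' : Live β (ESSF.stopAt T w).1 i₀ u r := by
    refine ⟨?_, ?_⟩
    · rw [stop_apply_of_le huT.le]; exact hu.1
    · rw [clock_stop β w i₀ huT.le]; exact hu.2
  have hl : ∀ i ∈ J, Live β w.1 i u r := fun i hiJ => hr.live_congr hu (h u huT i₀ hi i hiJ)
  have htau : tau β (ESSF.stopAt T w).1 r i₀ = u := (hr.stopAt T).tau_eq hu'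
  change _ = restrict J (single (((ESSF.stopAt T w).1
    (tau β (ESSF.stopAt T w).1 r i₀).toNNReal).mark i₀))
  rw [htau, ENNReal.toNNReal_coe, stop_apply_of_le huT.le]
  refine restrict_eq_iff.2 ⟨fun i hiJ j hj => ?_, fun i hiJ => ?_⟩
  · exact iff_of_true (((hr.timeChange_of_live w.2 (hl i hiJ)).2 j).2 (h u huT i hiJ j hj)) trivial
  · rw [(hr.timeChange_of_live w.2 (hl i hiJ)).1]
    exact (w.1 u).mark_eq (h u huT i hiJ i₀ hi)

theorem Regular.restrict_timeChange_future (hr : Regular w.1) (hi : i₀ ∈ J)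
    (h : ∀ s < T, ∀ i ∈ J, ∀ j ∈ J, (w.1 s).part i j) {c : ℝ≥0} (hc : clock β w.1 i₀ T = c) :
    restrict J (timeChange β w.1 (c + r)) = restrict J (timeChange β (ESSF.shift T w).1 r) := by
  have hcl : ∀ i ∈ J, clock β w.1 i T = c := fun i hiJ => by
    rw [← hc]
    exact clock_congr fun s hs => (w.1 s).mark_eq (h s hs i hiJ i₀ hi)
  exact restrict_eq_iff.2 ⟨fun i hiJ j _ => (hr.timeChange_add w.2 (hcl i hiJ) r).2 j,
    fun i hiJ => (hr.timeChange_add w.2 (hcl i hiJ) r).1⟩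

/-- Before `T` the elements of `J` share their marks and their clock. Up to the value of this clock
at `T`, the time change on `J` is read off the path of `i₀` stopped at `T`; after it, it is the time
change of the path after `T`. -/
theorem Good.res_timeChangePath (hg : Good β w.1) (hi : i₀ ∈ J)
    (h : ∀ s < T, ∀ i ∈ J, ∀ j ∈ J, (w.1 s).part i j) (hc : clock β w.1 i₀ T ≠ ⊤) :
    (res J (timeChangePath β w)).1 =
      concat β J i₀ (ESSF.stopAt T w, T) (res J (timeChangePath β (ESSF.shift T w))) := by
  have hcA := coe_age hc
  funext r
  change restrict J ((timeChangePath β w).1 r) = _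
  rw [timeChangePath_of_good hg, concat]
  split_ifs with hlt
  · refine hg.toRegular.restrict_timeChange_past hi h ?_
    rw [← hcA]
    exact_mod_cast hlt
  · obtain ⟨d, hd⟩ := exists_add_of_le (not_lt.1 hlt)
    change _ = restrict J ((timeChangePath β (ESSF.shift T w)).1 _)
    rw [timeChangePath_of_good (w := ESSF.shift T w) (hg.shift T), hd, add_tsub_cancel_left]
    exact hg.toRegular.restrict_timeChange_future hi h hcA.symm

end MarkPart

theorem concat_stop {β : ℝ} {J : Finset ℕ} {i₀ : ℕ} {z : Path × ℝ≥0} {u v : Path} {t : ℝ≥0}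
    (h : u.1 = concat β J i₀ z v) (hc : age β i₀ z ≤ t) :
    (stopAt t u).1 = concat β J i₀ z (stopAt (t - age β i₀ z) v) ∧
      shift t u = shift (t - age β i₀ z) v := by
  constructor
  · funext r
    change u.1 (min r t) = _
    rw [h, concat, concat]
    by_cases hr : r < age β i₀ z
    · rw [if_pos hr, min_eq_left (hr.le.trans hc), if_pos hr]
    · rw [if_neg hr, if_neg (not_lt.2 (le_min (not_lt.1 hr) hc))]
      change _ = v.1 (min (r - age β i₀ z) (t - age β i₀ z))
      rcases le_total r t with hrt | hrt
      · rw [min_eq_left hrt, min_eq_left (tsub_le_tsub_right hrt _)]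
      · rw [min_eq_right hrt, min_eq_right (tsub_le_tsub_right hrt _)]
  · refine Subtype.ext (funext fun r => ?_)
    change u.1 (t + r) = v.1 (t - age β i₀ z + r)
    rw [h, concat, if_neg (not_lt.2 (hc.trans le_self_add)), tsub_add_eq_add_tsub hc]

namespace PathLaw

variable {α : ℝ} {Q : Kernel MarkPart Path} [IsMarkovKernel Q]

/-- It is enough to prove the Markov property from the states that separate `J`. -/
theorem resMarkov_of_split (hQ : PathLaw α Q) (β : ℝ) {J : Finset ℕ} {i₀ : ℕ} (hi : i₀ ∈ J)
    (hsplit : ∀ y s, (∃ i ∈ J, ∃ j ∈ J, ¬y.part i j) →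
      BranchLaw.ResMarkov (timeChangeKernel β Q) J y s) (x : MarkPart) (t : ℝ≥0) :
    BranchLaw.ResMarkov (timeChangeKernel β Q) J x t := by
  have hR := hQ.timeChange_branchLaw β
  have hreg := timeChange_regular β Q
  have hY := measurable_timeChangePath β
  have hrs : ∀ s, Measurable fun w => res J (stopAt s w) := fun s =>
    (measurable_res J).comp (measurable_stop s)
  have hrh : ∀ s, Measurable fun w => res J (shift s w) := fun s =>
    (measurable_res J).comp (measurable_shift s)
  refine hR.resMarkov_iff.2 fun A B hA hB => ?_
  have hA1 : ∀ s (A : Set Path), MeasurableSet A → MeasurableSet {w | res J (stopAt s w) ∈ A} :=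
    fun s A hA => (hrs s) hA
  have hAB : ∀ s (A : Set Path), MeasurableSet A →
      MeasurableSet {w | res J (stopAt s w) ∈ A ∧ res J (shift s w) ∈ B} :=
    fun s A hA => ((hrs s) hA).inter ((hrh s) hB)
  have hRB : ∀ s, Measurable fun w : Path => timeChangeKernel β Q (w.1 s) (res J ⁻¹' B) := fun s =>
    ((timeChangeKernel β Q).measurable_coe (measurable_res J hB)).comp (measurable_coord s)
  -- The stopping time.
  set T : Path → ℝ≥0∞ := fun w => min (splitTime J w) (tau β w.1 t i₀) with hTdef
  have hTm : Measurable T := (measurable_splitTime J).min (measurable_tau β t i₀)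
  have hTs : IsStopping T := (isStopping_splitTime J).min (isStopping_tau β t i₀)
  have htop : MeasurableSet {w : Path | T w = ⊤} := hTm (measurableSet_singleton ⊤)
  -- `concat` takes values in the space of all maps, since for arbitrary arguments it need not be
  -- càdlàg; the event is therefore written as the trace of a measurable set of that space.
  obtain ⟨A', hA', hAA⟩ := hA
  have hA : MeasurableSet A := ⟨A', hA', hAA⟩
  have hmemA : ∀ v : Path, v ∈ A ↔ v.1 ∈ A' := fun v => by rw [← hAA]; rfl
  have hE1 : MeasurableSet {w : Path | res J (stopAt t (timeChangePath β w)) ∈ A ∧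
      res J (shift t (timeChangePath β w)) ∈ B} :=
    (((hrs t).comp hY) hA).inter (((hrh t).comp hY) hB)
  have hE2 : MeasurableSet {w : Path | res J (stopAt t (timeChangePath β w)) ∈ A} :=
    ((hrs t).comp hY) hA
  rw [timeChangeKernel_apply, Measure.map_apply hY (hAB t A hA),
    setLIntegral_map (hA1 t A hA) (hRB t) hY]
  change Q x {w : Path | res J (stopAt t (timeChangePath β w)) ∈ A ∧
      res J (shift t (timeChangePath β w)) ∈ B} =
    ∫⁻ w in {w : Path | res J (stopAt t (timeChangePath β w)) ∈ A},
      timeChangeKernel β Q ((timeChangePath β w).1 t) (res J ⁻¹' B) ∂(Q x)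
  rw [← lintegral_indicator_one hE1, ← lintegral_indicator hE2]
  refine (lintegral_add_compl _ htop).symm.trans (Eq.trans ?_ (lintegral_add_compl _ htop))
  congr 1
  -- On `T = ⊤` the set `J` never splits and its clock never reaches `t`. From time `t` on, the
  -- restricted time change is the constant dead path, and both integrands are the same indicator.
  · refine setLIntegral_congr_fun_ae htop ?_
    filter_upwards [hQ.ae_good β x] with w hw hT
    have hT' : min (splitTime J w) (tau β w.1 t i₀) = ⊤ := hT
    have h1 : splitTime J w = ⊤ := top_le_iff.1 (hT'.ge.trans (min_le_left _ _))
    have h2 : tau β w.1 t i₀ = ⊤ := top_le_iff.1 (hT'.ge.trans (min_le_right _ _))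
    have htog : ∀ s, Together J w.1 s := fun s => by
      by_contra hs
      rw [← splitTime_le_iff, h1] at hs
      exact absurd hs (by simp)
    have hz : ∀ r, t ≤ r → restrict J ((timeChangePath β w).1 r) = restrict J (single 0) := fun r hr => by
      rw [timeChangePath_of_good hw]
      exact hw.toRegular.restrict_timeChange_eq_zero w.2 hi htog h2 hr
    have hsh : res J (shift t (timeChangePath β w)) = constPath (restrict J (single 0)) :=
      Subtype.ext (funext fun r => hz _ le_self_add)
    have hprob : timeChangeKernel β Q ((timeChangePath β w).1 t) (res J ⁻¹' B) =
        B.indicator 1 (constPath (restrict J (single 0))) := by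
      have hc := hR.ae_res_const hreg (hz t le_rfl)
      by_cases hB' : constPath (restrict J (single 0)) ∈ B
      · rw [Set.indicator_of_mem hB', Pi.one_apply]
        refine (prob_compl_eq_zero_iff (measurable_res J hB)).1 ?_
        refine measure_eq_zero_iff_ae_notMem.2 ?_
        filter_upwards [hc] with u hu hu'
        exact hu' (by rw [Set.mem_preimage, hu]; exact hB')
      · rw [Set.indicator_of_notMem hB']
        refine measure_eq_zero_iff_ae_notMem.2 ?_
        filter_upwards [hc] with u hu hu'
        rw [Set.mem_preimage, hu] at hu'
        exact hB' hu'
    by_cases hA1 : res J (stopAt t (timeChangePath β w)) ∈ A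
    · rw [Set.indicator_of_mem (s := {w : Path | res J (stopAt t (timeChangePath β w)) ∈ A}) hA1,
        hprob]
      by_cases hB' : constPath (restrict J (single 0)) ∈ B
      · rw [Set.indicator_of_mem hB', Set.indicator_of_mem]
        · rfl
        · exact ⟨hA1, hsh ▸ hB'⟩
      · rw [Set.indicator_of_notMem hB', Set.indicator_of_notMem]
        exact fun h => hB' (hsh ▸ h.2)
    · rw [Set.indicator_of_notMem (s := {w : Path | res J (stopAt t (timeChangePath β w)) ∈ A}) hA1,
        Set.indicator_of_notMem]
      exact fun h => hA1 h.1
  · -- The functions of the past and of the future.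
    set S1 : Set ((Path × ℝ≥0) × Path) := {p |
      concat β J i₀ p.1 (res J (stopAt (t - age β i₀ p.1) (timeChangePath β p.2))) ∈ A' ∧
      res J (shift (t - age β i₀ p.1) (timeChangePath β p.2)) ∈ B}
    set S2 : Set ((Path × ℝ≥0) × Path) := {p |
      concat β J i₀ p.1 (res J (stopAt (t - age β i₀ p.1) (timeChangePath β p.2))) ∈ A'}
    have hag : Measurable fun p : (Path × ℝ≥0) × Path => t - age β i₀ p.1 :=
      measurable_const.sub ((measurable_age β i₀).comp measurable_fst)
    have hYs : Measurable fun p : (Path × ℝ≥0) × Path => timeChangePath β p.2 :=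
      hY.comp measurable_snd
    have hm1 : Measurable fun p : (Path × ℝ≥0) × Path =>
        res J (stopAt (t - age β i₀ p.1) (timeChangePath β p.2)) :=
      (measurable_res J).comp (measurable_stop_uncurry.comp (hag.prodMk hYs))
    have hm2 : Measurable fun p : (Path × ℝ≥0) × Path =>
        res J (shift (t - age β i₀ p.1) (timeChangePath β p.2)) :=
      (measurable_res J).comp (measurable_shift_uncurry.comp (hag.prodMk hYs))
    have hm3 : Measurable fun p : (Path × ℝ≥0) × Path =>
        timeChangeKernel β Q ((timeChangePath β p.2).1 (t - age β i₀ p.1)) (res J ⁻¹' B) :=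
      ((timeChangeKernel β Q).measurable_coe (measurable_res J hB)).comp
        (measurable_eval_comp hag hYs)
    have hS2 : MeasurableSet S2 :=
      ((measurable_concat β J i₀).comp (measurable_fst.prodMk hm1)) hA'
    have hS1 : MeasurableSet S1 := hS2.inter (hm2 hB)
    have hf1 := hQ.freeze hTm hTs x (measurable_one.indicator hS1)
    have hf2 := hQ.freeze hTm hTs x (hm3.indicator hS2)
    have hcompl : {w : Path | T w = ⊤}ᶜ = {w | T w ≠ ⊤} := rfl
    rw [hcompl]
    have hfin : MeasurableSet {w : Path | T w ≠ ⊤} := htop.compl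
    -- The facts that hold at the stopping time.
    have hfacts : ∀ w : Path, Regular w.1 → T w ≠ ⊤ →
        (∀ s < (T w).toNNReal, ∀ i ∈ J, ∀ j ∈ J, (w.1 s).part i j) ∧
        clock β w.1 i₀ (T w).toNNReal ≤ t := by
      intro w hw hT
      have hcoe := ENNReal.coe_toNNReal hT
      refine ⟨fun s hs => ?_, hw.clock_le_of_le_tau w.2 (hcoe.le.trans (min_le_right _ _))⟩
      have hsT : (s : ℝ≥0∞) < T w := by
        rw [← hcoe]
        exact_mod_cast hs
      have hlt : ¬splitTime J w ≤ s := not_le.2 (hsT.trans_le (min_le_left _ _))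
      rw [splitTime_le_iff, not_not] at hlt
      exact hlt s le_rfl
    have hpath : ∀ᵐ w ∂(Q x), T w ≠ ⊤ →
        (res J (stopAt t (timeChangePath β w))).1 = concat β J i₀ (stopAt (T w).toNNReal w, (T w).toNNReal)
          (res J (stopAt (t - age β i₀ (stopAt (T w).toNNReal w, (T w).toNNReal))
            (timeChangePath β (shift (T w).toNNReal w)))) ∧
        res J (shift t (timeChangePath β w)) =
          res J (shift (t - age β i₀ (stopAt (T w).toNNReal w, (T w).toNNReal))
            (timeChangePath β (shift (T w).toNNReal w))) := by
      filter_upwards [hQ.ae_good β x] with w hw hT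
      obtain ⟨h1, h2⟩ := hfacts w hw.toRegular hT
      have hcne := ne_top_of_le_ne_top ENNReal.coe_ne_top h2
      refine concat_stop (hw.res_timeChangePath hi h1 hcne) ?_
      rw [← ENNReal.coe_le_coe, coe_age hcne]
      exact h2
    have hl1 : ∫⁻ w in {w | T w ≠ ⊤}, {w : Path | res J (stopAt t (timeChangePath β w)) ∈ A ∧
        res J (shift t (timeChangePath β w)) ∈ B}.indicator 1 w ∂(Q x) =
        ∫⁻ w in {w | T w ≠ ⊤}, S1.indicator 1 ((stopAt (T w).toNNReal w, (T w).toNNReal),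
          shift (T w).toNNReal w) ∂(Q x) := by
      refine setLIntegral_congr_fun_ae hfin ?_
      filter_upwards [hpath] with w hw hT
      obtain ⟨h1, h2⟩ := hw hT
      refine Set.indicator_eq_indicator (f := (1 : Path → ℝ≥0∞)) (g := 1) ?_ rfl
      refine and_congr ?_ ?_
      · rw [hmemA, h1]
      · rw [h2]
    have hl2 : ∫⁻ w in {w | T w ≠ ⊤}, {w : Path | res J (stopAt t (timeChangePath β w)) ∈ A}.indicator
        (fun w => timeChangeKernel β Q ((timeChangePath β w).1 t) (res J ⁻¹' B)) w ∂(Q x) =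
        ∫⁻ w in {w | T w ≠ ⊤}, S2.indicator (fun p =>
          timeChangeKernel β Q ((timeChangePath β p.2).1 (t - age β i₀ p.1)) (res J ⁻¹' B))
          ((stopAt (T w).toNNReal w, (T w).toNNReal), shift (T w).toNNReal w) ∂(Q x) := by
      refine setLIntegral_congr_fun_ae hfin ?_
      filter_upwards [hpath] with w hw hT
      obtain ⟨h1, h2⟩ := hw hT
      refine Set.indicator_eq_indicator ?_ ?_
      · change _ ∈ A ↔ _
        rw [hmemA, h1]
        rfl
      · have h3 := congrArg (fun v : Path => v.1 0) h2
        have h3' : restrict J ((timeChangePath β w).1 (t + 0)) = restrict J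
          ((timeChangePath β (shift (T w).toNNReal w)).1
            (t - age β i₀ (stopAt (T w).toNNReal w, (T w).toNNReal) + 0)) := h3
        rw [add_zero, add_zero] at h3'
        change timeChangeKernel β Q _ _ = timeChangeKernel β Q _ _
        rw [← hR.measure_res_restrict J _ hB, h3', hR.measure_res_restrict J _ hB]
    refine hl1.trans (hf1.trans (Eq.trans ?_ (hf2.symm.trans hl2.symm)))
    refine setLIntegral_congr_fun_ae hfin ?_
    filter_upwards [hQ.ae_regular x] with w hw hT
    obtain ⟨h1, h2⟩ := hfacts w hw hT
    set z : Path × ℝ≥0 := (stopAt (T w).toNNReal w, (T w).toNNReal)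
    set y := w.1 (T w).toNNReal
    -- If the splitting time comes first, the state at `T` separates `J` and `hsplit` applies.
    -- Otherwise the clock equals `t` at `T`, no time is left, and the property at time `0` is
    -- trivial.
    have hres : BranchLaw.ResMarkov (timeChangeKernel β Q) J y (t - age β i₀ z) := by
      rcases le_total (splitTime J w) (tau β w.1 t i₀) with hle | hle
      · have hTw : T w = splitTime J w := min_eq_left hle
        have hsp : splitTime J w ≤ (T w).toNNReal := by
          rw [ENNReal.coe_toNNReal hT, hTw]
        rw [splitTime_le_iff] at hsp
        refine hsplit y _ ?_
        by_contra hno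
        push Not at hno
        exact hsp fun r hr i hiJ j hj => hw.mono hr (hno i hiJ j hj)
      · have hTw : T w = tau β w.1 t i₀ := min_eq_right hle
        have hct := hw.clock_tau w.2 (T := (T w).toNNReal) (by rw [ENNReal.coe_toNNReal hT, hTw])
        have : age β i₀ z = t := by
          rw [← ENNReal.coe_inj, coe_age (ne_top_of_le_ne_top ENNReal.coe_ne_top h2), hct]
        rw [this, tsub_self]
        exact hR.resMarkov_zero J y
    have hAz : MeasurableSet {q : Path | concat β J i₀ z q ∈ A'} :=
      ((measurable_concat β J i₀).comp (measurable_const.prodMk measurable_id)) hA'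
    have hfinal := hR.resMarkov_iff.1 hres _ B hAz hB
    rw [timeChangeKernel_apply, Measure.map_apply hY (hAB _ _ hAz),
      setLIntegral_map (hA1 _ _ hAz) (hRB _) hY, ← lintegral_indicator_one
        (hY (hAB _ _ hAz)), ← lintegral_indicator (hY (hA1 _ _ hAz))] at hfinal
    exact hfinal

/-- Induction on the cardinality. A state that separates `J` cuts it into the elements in the block
of `i` and the others; both parts are nonempty, hence strictly smaller, and `ResMarkov.union` puts
them together. -/
theorem resMarkov (hQ : PathLaw α Q) (β : ℝ) (n : ℕ) : ∀ J : Finset ℕ, J.card = n → J.Nonempty →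
    ∀ x t, BranchLaw.ResMarkov (timeChangeKernel β Q) J x t := by
  classical
  have hR := hQ.timeChange_branchLaw β
  induction n using Nat.strong_induction_on with
  | _ n ih =>
    rintro J rfl ⟨i₀, hi₀⟩ x t
    refine hQ.resMarkov_of_split β hi₀ (fun y s hy => ?_) x t
    obtain ⟨i, hi, j, hj, hij⟩ := hy
    set J₁ := J.filter fun k => y.part i k
    set J₂ := J.filter fun k => ¬y.part i k
    have hu : J₁ ∪ J₂ = J := Finset.filter_union_filter_not_eq _ J
    have hd : Disjoint J₁ J₂ := Finset.disjoint_filter_filter_not J J _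
    have h1 : i ∈ J₁ := Finset.mem_filter.2 ⟨hi, y.part.refl' i⟩
    have h2 : j ∈ J₂ := Finset.mem_filter.2 ⟨hj, hij⟩
    have hc := Finset.card_union_of_disjoint hd
    rw [hu] at hc
    have hp1 := Finset.card_pos.2 ⟨i, h1⟩
    have hp2 := Finset.card_pos.2 ⟨j, h2⟩
    rw [← hu]
    refine BranchLaw.ResMarkov.union hR (timeChange_regular β Q) hd (fun k hk l hl hkl => ?_)
      (ih _ (by omega) J₁ rfl ⟨i, h1⟩ y s) (ih _ (by omega) J₂ rfl ⟨j, h2⟩ y s)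
    exact (Finset.mem_filter.1 hl).2 (y.part.trans' (Finset.mem_filter.1 hk).2 hkl)

end PathLaw

/-! ## From restrictions to paths -/

/-- The events that depend on finitely many integers. -/
def resCylinders : Set (Set Path) :=
  {S | ∃ (n : ℕ) (A : Set Path), MeasurableSet A ∧ S = res (Finset.range (n + 1)) ⁻¹' A}

theorem resCylinders_exists_ge {S : Set Path} (h : S ∈ resCylinders) :
    ∃ n, ∀ m ≥ n, ∃ A : Set Path, MeasurableSet A ∧ S = res (Finset.range (m + 1)) ⁻¹' A := by
  obtain ⟨n, A, hA, rfl⟩ := h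
  refine ⟨n, fun m hm => ⟨_, measurable_res (Finset.range (n + 1)) hA, ?_⟩⟩
  ext w
  simp only [Set.mem_preimage]
  rw [res_res (Finset.range_mono (by omega))]

theorem isPiSystem_resCylinders : IsPiSystem resCylinders := by
  intro S hS S' hS' _
  obtain ⟨n, hn⟩ := resCylinders_exists_ge hS
  obtain ⟨m, hm⟩ := resCylinders_exists_ge hS'
  obtain ⟨A, hA, rfl⟩ := hn (max n m) (le_max_left _ _)
  obtain ⟨A', hA', rfl⟩ := hm (max n m) (le_max_right _ _)
  exact ⟨max n m, A ∩ A', hA.inter hA', rfl⟩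

theorem generateFrom_resCylinders :
    MeasurableSpace.generateFrom resCylinders = (inferInstance : MeasurableSpace Path) := by
  refine le_antisymm (MeasurableSpace.generateFrom_le ?_) ?_
  · rintro _ ⟨n, A, hA, rfl⟩
    exact measurable_res _ hA
  · have h : Measurable[MeasurableSpace.generateFrom resCylinders] (id : Path → Path) := by
      refine measurable_path_of_coord fun t => ?_
      refine (@MarkPart.measurable_iff Path (MeasurableSpace.generateFrom resCylinders) _).2
        ⟨fun i j => ?_, fun i => ?_⟩
      · refine MeasurableSpace.measurableSet_generateFrom ⟨max i j, {w : Path | (w.1 t).part i j},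
          measurable_coord t (measurableSet_part i j), ?_⟩
        ext w
        exact (restrict_part (y := w.1 t) (Finset.mem_range.2 (by omega))
          (Finset.mem_range.2 (by omega))).symm
      · intro B hB
        refine MeasurableSpace.measurableSet_generateFrom ⟨i, {w : Path | (w.1 t).mark i ∈ B},
          ((measurable_mark i).comp (measurable_coord t)) hB, ?_⟩
        ext w
        have e : ((res (Finset.range (i + 1)) w).1 t).mark i = (w.1 t).mark i :=
          restrict_mark (Finset.mem_range.2 (by omega))
        change (w.1 t).mark i ∈ B ↔ ((res (Finset.range (i + 1)) w).1 t).mark i ∈ B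
        rw [e]
    exact fun B hB => h hB

theorem isCountablySpanning_resCylinders : IsCountablySpanning resCylinders :=
  ⟨fun _ => Set.univ, fun _ => ⟨0, Set.univ, MeasurableSet.univ, rfl⟩, Set.iUnion_const _⟩

/-- The Markov property at fixed times, on the path space. -/
def MarkovLaw (R : Kernel MarkPart Path) : Prop :=
  ∀ x t (A B : Set Path), MeasurableSet A → MeasurableSet B →
    R x {w | stopAt t w ∈ A ∧ shift t w ∈ B} = ∫⁻ w in stopAt t ⁻¹' A, R (w.1 t) B ∂(R x)

theorem BranchLaw.markovLaw_of_resMarkov {γ : ℝ} {R : Kernel MarkPart Path} [IsMarkovKernel R]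
    (hR : BranchLaw γ R) (h : ∀ n x t, ResMarkov R (Finset.range (n + 1)) x t) : MarkovLaw R := by
  intro x t A B hA hB
  have hm := (measurable_stop t).prodMk (measurable_shift t)
  have : IsProbabilityMeasure ((R x).map fun w => (stopAt t w, shift t w)) :=
    Measure.isProbabilityMeasure_map hm.aemeasurable
  have : IsProbabilityMeasure ((R x).map (stopAt t)) :=
    Measure.isProbabilityMeasure_map (measurable_stop t).aemeasurable
  set κ : Kernel Path Path := R.comap (coord t) (measurable_coord t)
  have hκ : ∀ (A B : Set Path), MeasurableSet A → MeasurableSet B →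
      (((R x).map (stopAt t)).compProd κ) (A ×ˢ B) = ∫⁻ w in stopAt t ⁻¹' A, R (w.1 t) B ∂(R x) := by
    intro A B hA hB
    rw [Measure.compProd_apply_prod hA hB, setLIntegral_map hA (κ.measurable_coe hB)
      (measurable_stop t)]
    refine lintegral_congr fun w => ?_
    change R ((stopAt t w).1 t) B = _
    rw [stop_apply_of_le le_rfl]
  have key : (R x).map (fun w => (stopAt t w, shift t w)) = ((R x).map (stopAt t)).compProd κ := by
    refine ext_of_generate_finite _ (generateFrom_eq_prod generateFrom_resCylinders
      generateFrom_resCylinders isCountablySpanning_resCylinders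
      isCountablySpanning_resCylinders).symm (isPiSystem_resCylinders.prod isPiSystem_resCylinders)
      ?_ ?_
    · rintro _ ⟨S, hS, S', hS', rfl⟩
      obtain ⟨n, hn⟩ := resCylinders_exists_ge hS
      obtain ⟨m, hm'⟩ := resCylinders_exists_ge hS'
      obtain ⟨A, hA, rfl⟩ := hn (max n m) (le_max_left _ _)
      obtain ⟨B, hB, rfl⟩ := hm' (max n m) (le_max_right _ _)
      have hA1 := measurable_res (Finset.range (max n m + 1)) hA
      have hB1 := measurable_res (Finset.range (max n m + 1)) hB
      rw [hκ _ _ hA1 hB1, Measure.map_apply hm (hA1.prod hB1)]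
      exact hR.resMarkov_iff.1 (h (max n m) x t) A B hA hB
    · simp
  rw [← hκ A B hA hB, ← key, Measure.map_apply hm (hA.prod hB)]
  rfl

theorem PathLaw.markovLaw {α : ℝ} {Q : Kernel MarkPart Path} [IsMarkovKernel Q]
    (hQ : PathLaw α Q) (β : ℝ) : MarkovLaw (timeChangeKernel β Q) :=
  (hQ.timeChange_branchLaw β).markovLaw_of_resMarkov fun n x t =>
    hQ.resMarkov β _ _ rfl ⟨0, by simp⟩ x t

/-! ### Inverting the time change, and scaling of the splitting time. -/

namespace MarkPart

variable {β : ℝ} {w : ℝ≥0 → MarkPart} {i : ℕ} {u t : ℝ≥0}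

theorem measurable_mark_of_isCadlag (hw : IsCadlag w) (i : ℕ) : Measurable fun s => (w s).mark i :=
  (measurable_mark i).comp (measurable_eval.comp (measurable_id.prodMk
    (measurable_const (a := (⟨w, hw⟩ : Path)))))

/-- The image of the clock measure under the clock is the Lebesgue measure. -/
theorem Regular.map_clockMeasure (hr : Regular w) (h : Live β w i u t) :
    ((clockMeasure β w i).restrict (Set.Icc 0 u)).map
      (fun s => (clock β w i (min s.toNNReal u)).toReal) = volume.restrict (Set.Icc 0 (t : ℝ)) := by
  obtain ⟨hu, hct⟩ := h
  have hfin : ∀ s : ℝ, clock β w i (min s.toNNReal u) ≠ ⊤ := fun s =>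
    ne_top_of_le_ne_top (hr.clock_ne_top hu) (clock_mono β w i (min_le_right _ _))
  have hmono : Monotone fun s : ℝ => (clock β w i (min s.toNNReal u)).toReal := fun a b hab =>
    ENNReal.toReal_mono (hfin b) (clock_mono β w i (min_le_min_right u (Real.toNNReal_le_toNNReal hab)))
  have htot : clockMeasure β w i (Set.Icc 0 u) = t := (clock_eq_measure β w i u).symm.trans hct
  have : IsFiniteMeasure ((clockMeasure β w i).restrict (Set.Icc 0 (u : ℝ))) :=
    ⟨by rw [Measure.restrict_apply_univ, htot]; exact ENNReal.coe_lt_top⟩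
  have : IsFiniteMeasure (((clockMeasure β w i).restrict (Set.Icc 0 (u : ℝ))).map
      (fun s => (clock β w i (min s.toNNReal u)).toReal)) := inferInstance
  refine Measure.ext_of_Iic _ _ fun a => ?_
  rw [Measure.map_apply hmono.measurable measurableSet_Iic,
    Measure.restrict_apply (hmono.measurable measurableSet_Iic),
    Measure.restrict_apply measurableSet_Iic]
  rcases lt_or_ge a 0 with ha | ha
  · have e1 : (fun s => (clock β w i (min s.toNNReal u)).toReal) ⁻¹' Set.Iic a ∩ Set.Icc 0 (u : ℝ) =
        ∅ := Set.eq_empty_of_forall_notMem fun s hs =>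
      absurd (ENNReal.toReal_nonneg.trans hs.1) (not_le.2 ha)
    have e2 : Set.Iic a ∩ Set.Icc 0 (t : ℝ) = ∅ := Set.eq_empty_of_forall_notMem fun s hs =>
      absurd (hs.2.1.trans hs.1) (not_le.2 ha)
    rw [e1, e2, measure_empty, measure_empty]
  · lift a to ℝ≥0 using ha
    -- The time at which the clock equals `min a t`: by strict monotonicity the preimage of the
    -- half-line up to `a` is the interval from `0` to `v`, whose clock measure is `min a t`.
    obtain ⟨v, hvu, hv⟩ := hr.exists_clock_eq hu (a := (min a t : ℝ≥0))
      (by rw [hct]; exact_mod_cast min_le_right a t)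
    have hvne : (w v).mark i ≠ 0 := hr.mark_ne_zero hvu hu
    have e1 : (fun s => (clock β w i (min s.toNNReal u)).toReal) ⁻¹' Set.Iic (a : ℝ) ∩
        Set.Icc 0 (u : ℝ) = Set.Icc 0 (v : ℝ) := by
      ext s
      constructor
      · rintro ⟨h1, h2, h3⟩
        refine ⟨h2, ?_⟩
        lift s to ℝ≥0 using h2
        have h3' : s ≤ u := by exact_mod_cast h3
        have h1' : (clock β w i (min (s : ℝ).toNNReal u)).toReal ≤ a := h1
        rw [Real.toNNReal_coe, min_eq_left h3'] at h1'
        by_contra hlt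
        have hlt' : v < s := by exact_mod_cast not_le.1 hlt
        have hsne := hr.mark_ne_zero h3' hu
        have h4 := hr.clock_lt (β := β) hsne hlt'
        have h5 : clock β w i s ≤ a := by
          rw [← ENNReal.ofReal_toReal (hr.clock_ne_top hsne), ← ENNReal.ofReal_coe_nnreal]
          exact ENNReal.ofReal_le_ofReal h1'
        have h6 : clock β w i s ≤ t := hct ▸ clock_mono β w i h3'
        rw [hv] at h4
        refine absurd h4 (not_lt.2 ?_)
        rw [ENNReal.coe_min]
        exact le_min h5 h6
      · rintro ⟨h2, h3⟩
        lift s to ℝ≥0 using h2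
        have h3' : s ≤ v := by exact_mod_cast h3
        refine ⟨?_, s.2, by exact_mod_cast h3'.trans hvu⟩
        change (clock β w i (min (s : ℝ).toNNReal u)).toReal ≤ a
        rw [Real.toNNReal_coe, min_eq_left (h3'.trans hvu)]
        refine ENNReal.toReal_le_coe_of_le_coe ((clock_mono β w i h3').trans ?_)
        rw [hv]
        exact_mod_cast min_le_left a t
    have e2 : Set.Iic (a : ℝ) ∩ Set.Icc 0 (t : ℝ) = Set.Icc 0 ((min a t : ℝ≥0) : ℝ) := by
      ext s
      simp only [Set.mem_inter_iff, Set.mem_Iic, Set.mem_Icc, NNReal.coe_min, le_min_iff]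
      tauto
    rw [e1, e2, ← clock_eq_measure, hv, Real.volume_Icc, sub_zero, ENNReal.ofReal_coe_nnreal]

/-- The time change by the opposite power is the inverse time change. -/
theorem Good.clock_timeChange (hg : Good β w) (hw : IsCadlag w) (h : Live β w i u t) :
    clock (-β) (timeChange β w) i t = u := by
  have hr := hg.toRegular
  have hfin : ∀ s : ℝ, clock β w i (min s.toNNReal u) ≠ ⊤ := fun s =>
    ne_top_of_le_ne_top (hr.clock_ne_top h.1) (clock_mono β w i (min_le_right _ _))
  have hmono : Monotone fun s : ℝ => (clock β w i (min s.toNNReal u)).toReal := fun a b hab =>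
    ENNReal.toReal_mono (hfin b) (clock_mono β w i (min_le_min_right u (Real.toNNReal_le_toNNReal hab)))
  have hm : ∀ {v : ℝ≥0 → MarkPart} (_ : IsCadlag v) (b : ℝ),
      Measurable fun s : ℝ => (((v s.toNNReal).mark i).pow b : ℝ≥0∞) := fun hv b =>
    measurable_coe_nnreal_ennreal.comp ((Mark.measurable_pow b).comp
      ((measurable_mark_of_isCadlag hv i).comp measurable_real_toNNReal))
  have hm' : Measurable fun s : ℝ => (((timeChange β w
      (clock β w i (min s.toNNReal u)).toReal.toNNReal).mark i).pow (-β) : ℝ≥0∞) :=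
    (hm (hg.isCadlag_timeChange hw) (-β)).comp hmono.measurable
  rw [clock, ← hr.map_clockMeasure h,
    lintegral_map (hm (hg.isCadlag_timeChange hw) (-β)) hmono.measurable, clockMeasure,
    restrict_withDensity measurableSet_Icc, lintegral_withDensity_eq_lintegral_mul _ (hm hw β) hm']
  have e : ∫⁻ s in Set.Icc (0 : ℝ) u, (1 : ℝ≥0∞) = u := by simp
  refine Eq.trans (setLIntegral_congr_fun measurableSet_Icc fun s hs => ?_) e
  obtain ⟨hs0, hsu⟩ := hs
  lift s to ℝ≥0 using hs0
  have hsu' : s ≤ u := by exact_mod_cast hsu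
  have hne := hr.mark_ne_zero hsu' h.1
  simp only [Pi.mul_apply, Real.toNNReal_coe, min_eq_left hsu']
  have hl : Live β w i s (clock β w i s).toReal.toNNReal :=
    ⟨hne, (ENNReal.coe_toNNReal (hr.clock_ne_top hne)).symm.trans (by
      rw [ENNReal.toReal, Real.toNNReal_coe])⟩
  -- Every `s ≤ u` is the live time of its own clock value, so the power `-β` of the time-changed
  -- mark cancels the density of the clock and the integral reduces to the length of the interval.
  rw [(hr.timeChange_of_live hw hl).1, ← ENNReal.coe_mul, ← Mark.pow_add, add_neg_cancel,
    Mark.pow_of_ne hne, NNReal.rpow_zero, ENNReal.coe_one]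

variable {J : Finset ℕ} {q r : ℝ≥0}

theorem together_add : Together J w (q + r) ↔ Together J w q ∧ Together J (fun t => w (q + t)) r := by
  constructor
  · exact fun h => ⟨fun s hs => h s (hs.trans le_self_add), fun s hs => h _ (by gcongr)⟩
  · rintro ⟨h, h'⟩ s hs
    rcases le_total s q with hsq | hsq
    · exact h s hsq
    · obtain ⟨d, rfl⟩ := exists_add_of_le hsq
      exact h' d (le_of_add_le_add_left hs)

end MarkPart

section

variable {J : Finset ℕ} {w : Path} {c q : ℝ≥0} {i₀ : ℕ}

theorem together_of_lt_splitTime (h : (q : ℝ≥0∞) < splitTime J w) : Together J w.1 q := by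
  by_contra h'
  exact absurd (splitTime_le_iff.2 h') (not_le.2 h)

theorem splitTime_shift (h : splitTime J w = c) (hq : q < c) :
    splitTime J (shift q w) = (c - q : ℝ≥0) := by
  refine ENNReal_eq_of_forall_le fun r => ?_
  have h1 : Together J w.1 q := together_of_lt_splitTime (by rw [h]; exact_mod_cast hq)
  have h2 : splitTime J w ≤ (q + r : ℝ≥0) ↔ splitTime J (shift q w) ≤ r := by
    rw [splitTime_le_iff, splitTime_le_iff, together_add, and_iff_right h1]
    rfl
  rw [← h2, h, ENNReal.coe_le_coe, ENNReal.coe_le_coe, tsub_le_iff_left]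

theorem splitTime_frag {γ : ℝ} {x : MarkPart} {f : ℕ → Path} (hi : i₀ ∈ J)
    (hf : (f (x.blockLabel i₀)).1 0 = one) (hc : 0 < c) (h : splitTime J (frag γ x f) = c) :
    splitTime J (f (x.blockLabel i₀)) = ((x.mark i₀).pow γ * c : ℝ≥0) := by
  have h0 : Together J (frag γ x f).1 0 :=
    together_of_lt_splitTime (by rw [h]; exact_mod_cast hc)
  have hx : ∀ i ∈ J, ∀ j ∈ J, x.part i j := fun i hiJ j hj => (h0 0 le_rfl i hiJ j hj).1
  have hiff : ∀ r, ∀ i ∈ J, ∀ j ∈ J, ((frag γ x f).1 r).part i j ↔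
      ((f (x.blockLabel i₀)).1 ((x.mark i₀).pow γ * r)).part i j := fun r i hiJ j hj => by
    change x.part i j ∧ ((f (x.blockLabel i)).1 ((x.mark i).pow γ * r)).part i j ↔ _
    rw [and_iff_right (hx i hiJ j hj), blockLabel_eq (hx i hiJ i₀ hi),
      x.mark_eq (hx i hiJ i₀ hi)]
  -- A zero power means a zero mark: the copy is then observed only at time `0`, where it is `one`,
  -- so `J` never splits and the splitting time cannot equal `c`.
  rcases eq_or_ne ((x.mark i₀).pow γ) 0 with hz | hz
  · have : ¬splitTime J (frag γ x f) ≤ c := by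
      rw [splitTime_le_iff, not_not]
      intro r _ i hiJ j hj
      rw [hiff r i hiJ j hj, hz, MulZeroClass.zero_mul, hf]
      trivial
    exact absurd h.le this
  · have hpos := pos_iff_ne_zero.2 hz
    refine ENNReal_eq_of_forall_le fun r => ?_
    have h1 : splitTime J (frag γ x f) ≤ (((x.mark i₀).pow γ)⁻¹ * r : ℝ≥0) ↔
        splitTime J (f (x.blockLabel i₀)) ≤ r := by
      rw [splitTime_le_iff, splitTime_le_iff, not_iff_not]
      constructor
      · intro ht s hs i hiJ j hj
        have := ht (((x.mark i₀).pow γ)⁻¹ * s) (by gcongr) i hiJ j hj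
        rwa [hiff _ i hiJ j hj, mul_inv_cancel_left₀ hz] at this
      · intro ht s hs i hiJ j hj
        rw [hiff _ i hiJ j hj]
        exact ht _ ((le_inv_mul_iff₀ hpos).1 hs) i hiJ j hj
    rw [← h1, h, ENNReal.coe_le_coe, ENNReal.coe_le_coe, le_inv_mul_iff₀ hpos]

end

/-! ## Fixed times of discontinuity -/

theorem measurableSet_splitTime_eq (J : Finset ℕ) (c : ℝ≥0) :
    MeasurableSet {w : Path | splitTime J w = c} :=
  measurable_splitTime J (measurableSet_singleton _)

namespace BranchLaw

variable {γ : ℝ} {R : Kernel MarkPart Path} [IsMarkovKernel R] {J : Finset ℕ} {i₀ : ℕ} {c r : ℝ≥0}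

theorem measure_splitTime_eq_le (hR : BranchLaw γ R) (hi : i₀ ∈ J) (x : MarkPart) (hc : 0 < c) :
    R x {w | splitTime J w = c} ≤
      R one {w | splitTime J w = ((x.mark i₀).pow γ * c : ℝ≥0)} :=
  hR.measure_le_of_block x (x.blockLabel i₀) (measurableSet_splitTime_eq J _)
    (measurableSet_splitTime_eq J _) fun _ hf h => splitTime_frag hi hf hc h

theorem measure_splitTime_eq_zero (hR : BranchLaw γ R) (J : Finset ℕ) :
    R one {w | splitTime J w = (0 : ℝ≥0)} = 0 := by
  refine measure_eq_zero_iff_ae_notMem.2 ?_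
  filter_upwards [hR.start one] with w hw h
  refine splitTime_le_iff.1 h.le fun s hs i _ j _ => ?_
  rw [nonpos_iff_eq_zero.1 hs, hw]
  trivial

/-- The Markov property at `r` writes the maximal mass as an average of quantities that, by scaling
and maximality, do not exceed it. They are therefore almost surely equal to it, and `J` is almost
surely not split at time `r`. -/
theorem ae_of_splitTime_max (hR : BranchLaw γ R) (hMk : MarkovLaw R) (hi : i₀ ∈ J)
    (hmax : ∀ c' : ℝ≥0, R one {w | splitTime J w = c'} ≤ R one {w | splitTime J w = c})
    (h0 : R one {w | splitTime J w = c} ≠ 0) (hr : r < c) :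
    ∀ᵐ w ∂(R one), (r : ℝ≥0∞) < splitTime J w ∧
      R one {w' | splitTime J w' = (((w.1 r).mark i₀).pow γ * (c - r) : ℝ≥0)} =
        R one {w | splitTime J w = c} := by
  set M := R one {w | splitTime J w = c}
  set A : Set Path := {w | splitTime J w ≤ r}ᶜ
  have hA : MeasurableSet A := (measurableSet_le (measurable_splitTime J) measurable_const).compl
  have hA' := measurable_stop r hA
  have hB := measurableSet_splitTime_eq J (c - r)
  have hle : ∀ y : MarkPart, R y {w | splitTime J w = (c - r : ℝ≥0)} ≤ M := fun y =>
    (hR.measure_splitTime_eq_le hi y (tsub_pos_of_lt hr)).trans (hmax _)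
  have h1 : M ≤ ∫⁻ w, (stopAt r ⁻¹' A).indicator
      (fun w => R (w.1 r) {w | splitTime J w = (c - r : ℝ≥0)}) w ∂(R one) := by
    rw [lintegral_indicator hA', ← hMk one r A _ hA hB]
    refine measure_mono fun w (hw : splitTime J w = c) => ⟨fun h => ?_, splitTime_shift hw hr⟩
    have h' : splitTime J w ≤ r := (isStopping_splitTime J r w).2 h
    rw [hw] at h'
    exact absurd hr (not_lt.2 (by exact_mod_cast h'))
  have h2 : ∀ᵐ w ∂(R one), (stopAt r ⁻¹' A).indicator
      (fun w => R (w.1 r) {w | splitTime J w = (c - r : ℝ≥0)}) w = M := by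
    refine ae_eq_of_ae_le_of_lintegral_le (Eventually.of_forall fun w => ?_) ?_
      aemeasurable_const ?_
    · exact Set.indicator_le' (fun _ _ => hle _) (fun _ _ => zero_le) w
    · refine ne_top_of_le_ne_top (measure_ne_top (R one) Set.univ) ?_
      rw [← lintegral_one]
      exact lintegral_mono fun w => Set.indicator_le' (fun _ _ => prob_le_one) (fun _ _ => zero_le) w
    · rw [lintegral_const, measure_univ, mul_one]
      exact h1
  filter_upwards [h2] with w hw
  have hwA : w ∈ stopAt r ⁻¹' A := by
    by_contra h
    rw [Set.indicator_of_notMem h] at hw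
    exact h0 hw.symm
  rw [Set.indicator_of_mem hwA] at hw
  refine ⟨not_le.1 fun h => hwA ((isStopping_splitTime J r w).1 h), ?_⟩
  refine le_antisymm (hmax _) ?_
  rw [← hw]
  exact hR.measure_splitTime_eq_le hi (w.1 r) (tsub_pos_of_lt hr)

/-- Only finitely many atoms have at least a given positive mass, so a largest one exists. -/
theorem exists_splitTime_max (h0 : R one {w | splitTime J w = c} ≠ 0) :
    ∃ c₀ : ℝ≥0, R one {w | splitTime J w = c₀} ≠ 0 ∧
      ∀ c' : ℝ≥0, R one {w | splitTime J w = c'} ≤ R one {w | splitTime J w = c₀} := by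
  have hd : Pairwise (Function.onFun Disjoint fun c : ℝ≥0 => {w : Path | splitTime J w = c}) := by
    intro a b hab
    refine Set.disjoint_left.2 fun w (h1 : _ = _) (h2 : _ = _) => hab ?_
    rw [h1] at h2
    exact_mod_cast h2
  have hfin := Measure.finite_const_le_meas_of_disjoint_iUnion (R one) (pos_iff_ne_zero.2 h0)
    (fun c => measurableSet_splitTime_eq J c) hd (measure_ne_top _ _)
  obtain ⟨c₀, hc₀, hmax⟩ := Set.exists_max_image _
    (fun c : ℝ≥0 => R one {w | splitTime J w = c}) hfin ⟨c, le_refl (R one {w | splitTime J w = c})⟩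
  have hc₀' : R one {w | splitTime J w = c} ≤ R one {w | splitTime J w = c₀} := hc₀
  refine ⟨c₀, fun h => h0 (le_antisymm (h ▸ hc₀') zero_le), fun c' => ?_⟩
  rcases le_total (R one {w | splitTime J w = c}) (R one {w | splitTime J w = c'}) with h | h
  · exact hmax c' h
  · exact h.trans hc₀'

/-- Two maximal atoms `a < b` cannot coexist: maximality of `b` forces the splitting time to exceed
`a` almost surely. Since `v ^ γ * (c - r)` is also a maximal atom, it equals `c`, and this
determines the mark at time `r`. -/
theorem ae_mark_of_splitTime_max (hR : BranchLaw γ R) (hMk : MarkovLaw R) (hi : i₀ ∈ J)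
    (hmax : ∀ c' : ℝ≥0, R one {w | splitTime J w = c'} ≤ R one {w | splitTime J w = c})
    (h0 : R one {w | splitTime J w = c} ≠ 0) (hr : r < c) :
    ∀ᵐ w ∂(R one), ((w.1 r).mark i₀).pow γ * (c - r) = c := by
  have key : ∀ a b : ℝ≥0, (∀ c' : ℝ≥0, R one {w | splitTime J w = c'} ≤
      R one {w | splitTime J w = b}) → R one {w | splitTime J w = b} ≠ 0 →
      R one {w | splitTime J w = a} = R one {w | splitTime J w = b} → ¬a < b := by
    intro a b hb hb0 hab hlt
    refine hb0 (hab ▸ measure_eq_zero_iff_ae_notMem.2 ?_)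
    filter_upwards [hR.ae_of_splitTime_max hMk hi hb hb0 hlt] with w hw h
    exact absurd hw.1 (not_lt.2 (le_of_eq h))
  filter_upwards [hR.ae_of_splitTime_max hMk hi hmax h0 hr] with w hw
  refine le_antisymm (not_lt.1 fun hlt => ?_) (not_lt.1 (key _ _ hmax h0 hw.2))
  exact key _ _ (by rw [hw.2]; exact hmax) (by rw [hw.2]; exact h0) hw.2.symm hlt

end BranchLaw

section

variable {β γ : ℝ} {J : Finset ℕ} {i₀ : ℕ} {c : ℝ≥0}

/-- A split of the time change at `c`, when the mark follows the deterministic curve `hV`, comes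
from a split of the original path exactly at the time `T` obtained by running the inverse clock, of
power `-β`, up to `c`. What matters is that `T` depends on the time-changed mark before `c` only. -/
theorem exists_splitTime_of_timeChange {w : Path} (hg : Good β w.1) (hi : i₀ ∈ J) (hc : 0 < c)
    (hS : splitTime J (timeChangePath β w) = c)
    (hV : ∀ n, grid n < c →
      (((timeChangePath β w).1 (grid n)).mark i₀).pow γ * (c - grid n) = c) :
    ∃ T : ℝ≥0, (T : ℝ≥0∞) = ⨆ (r : ℝ≥0) (_ : r < c), clock (-β) (timeChangePath β w).1 i₀ r ∧
      (∀ s < T, ∀ i ∈ J, ∀ j ∈ J, (w.1 s).part i j) ∧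
      ¬∀ i ∈ J, ∀ j ∈ J, (w.1 T).part i j := by
  have hr := hg.toRegular
  have hY : (timeChangePath β w).1 = timeChange β w.1 := funext (timeChangePath_of_good hg)
  have hYr := hr.regular_timeChange w.2 (β := β)
  have htog : ∀ r < c, Together J (timeChange β w.1) r := fun r hrc => by
    rw [← hY]
    exact together_of_lt_splitTime (by rw [hS]; exact_mod_cast hrc)
  have hno := splitTime_le_iff.1 hS.le
  rw [hY] at hV hno ⊢
  obtain ⟨j, hj, hij⟩ : ∃ j ∈ J, ¬(timeChange β w.1 c).part i₀ j := by
    by_contra h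
    push Not at h
    refine hno fun s hs i hiJ j hj => ?_
    exact hYr.mono hs (Setoid.trans' _ (Setoid.symm' _ (h i hiJ)) (h j hj))
  have hne : ∀ r < c, ((timeChange β w.1 r).mark i₀) ≠ 0 := fun r hrc => by
    obtain ⟨n, h1, h2⟩ := exists_grid_btwn hrc
    refine hYr.mark_ne_zero h1.le fun h => ?_
    have := hV n h2
    rw [h, Mark.pow_zero_left, MulZeroClass.zero_mul] at this
    exact hc.ne this
  -- Along the curve `v ^ γ * (c - r) = c`, the power `v ^ γ` is unbounded as `r` increases to `c`.
  -- A nonzero mark at `c` would bound it by `K`, and a grid time within `c / (K + 1)` of `c`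
  -- contradicts this.
  have hz : (timeChange β w.1 c).mark i₀ = 0 := by
    by_contra h
    obtain ⟨e, he, h'⟩ := hYr.away h
    set K : ℝ≥0 := e⁻¹ ^ |γ|
    have hlt : c - c / (K + 1) < c := tsub_lt_self hc (by positivity)
    obtain ⟨n, h1, h2⟩ := exists_grid_btwn hlt
    have h3 := hV n h2
    have h4 : c - grid n ≤ c / (K + 1) := tsub_le_iff_tsub_le.1 h1.le
    have h5 : c ≤ K * (c / (K + 1)) := by
      rw [← h3]
      refine mul_le_mul' (Mark.pow_le he (h' _ h2.le) γ) ?_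
      rwa [h3]
    have h6 : K * (c / (K + 1)) < c := by
      rw [mul_div_assoc', div_lt_iff₀ (by positivity), mul_comm]
      exact mul_lt_mul_of_pos_left (lt_add_one K) hc
    exact absurd h5 (not_le.2 h6)
  have hnl : ¬∃ u, Live β w.1 i₀ u c := fun ⟨u, hu⟩ =>
    hu.1 ((hr.timeChange_of_live w.2 hu).1.symm.trans hz)
  rw [(hr.timeChange_of_not_live w.2 hnl).2] at hij
  push Not at hij
  obtain ⟨s₀, hs₀⟩ := hij
  have hlive : ∀ r < c, ∃ u, Live β w.1 i₀ u r ∧ clock (-β) (timeChange β w.1) i₀ r = u ∧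
      ∀ i ∈ J, ∀ j ∈ J, (w.1 u).part i j := fun r hrc => by
    obtain ⟨u, hu⟩ := hr.timeChange_mark_ne_zero w.2 (hne r hrc)
    refine ⟨u, hu, hg.clock_timeChange w.2 hu, fun i hiJ k hk => ?_⟩
    have h1 : ∀ i ∈ J, (w.1 u).part i₀ i := fun i hiJ =>
      ((hr.timeChange_of_live w.2 hu).2 i).1 (htog r hrc r le_rfl i₀ hi i hiJ)
    exact Setoid.trans' _ (Setoid.symm' _ (h1 i hiJ)) (h1 k hk)
  -- The supremum of the live times before `c`. It is finite because `J` is still together at these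
  -- times and some of its elements are separated at `s₀`.
  set T' : ℝ≥0∞ := ⨆ (r : ℝ≥0) (_ : r < c), clock (-β) (timeChange β w.1) i₀ r
  have hT's : T' ≤ s₀ := iSup₂_le fun r hrc => by
    obtain ⟨u, -, hu, hp⟩ := hlive r hrc
    rw [hu, ENNReal.coe_le_coe]
    by_contra hlt
    exact hs₀ (hr.mono (not_le.1 hlt).le (hp i₀ hi j hj))
  obtain ⟨T, hT⟩ : ∃ T : ℝ≥0, (T : ℝ≥0∞) = T' :=
    ⟨_, ENNReal.coe_toNNReal (ne_top_of_le_ne_top ENNReal.coe_ne_top hT's)⟩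
  refine ⟨T, hT, fun s hs i hiJ k hk => ?_, fun hall => ?_⟩
  · have hs' : (s : ℝ≥0∞) < T' := by rw [← hT]; exact_mod_cast hs
    obtain ⟨r, hr'⟩ := lt_iSup_iff.1 hs'
    obtain ⟨hrc, hr''⟩ := lt_iSup_iff.1 hr'
    obtain ⟨u, -, hu, hp⟩ := hlive r hrc
    rw [hu, ENNReal.coe_lt_coe] at hr''
    exact hr.mono hr''.le (hp i hiJ k hk)
  · have hTs : T ≤ s₀ := by rw [← hT] at hT's; exact_mod_cast hT's
    -- If `J` were together at `T`, a zero mark at `T` would freeze it and prevent the separation at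
    -- `s₀`, whereas a nonzero mark would make the clock value `c` live.
    have hcl : (c : ℝ≥0∞) ≤ clock β w.1 i₀ T := by
      refine le_of_forall_lt fun a ha => ?_
      lift a to ℝ≥0 using ha.ne_top
      obtain ⟨r, har, hrc⟩ := exists_between (show a < c by exact_mod_cast ha)
      obtain ⟨u, hul, hu, hp⟩ := hlive r hrc
      have huT : u ≤ T := by
        rw [← ENNReal.coe_le_coe, hT, ← hu]
        exact le_iSup₂_of_le (f := fun (r : ℝ≥0) (_ : r < c) => clock (-β) (timeChange β w.1) i₀ r)
          r hrc le_rfl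
      refine lt_of_lt_of_le ?_ (clock_mono β w.1 i₀ huT)
      rw [hul.2]
      exact_mod_cast har
    by_cases hmT : (w.1 T).mark i₀ = 0
    · exact hs₀ (hr.frozen hTs hmT (hall i₀ hi j hj))
    · obtain ⟨v, hv, hvc⟩ := hr.exists_clock_eq hmT hcl
      exact hnl ⟨v, hr.mark_ne_zero hv hmT, hvc⟩

/-- The equation forces `γ ≠ 0`, since `c - r < c` for `r > 0`, and then determines the mark at grid
times; right-continuity extends the equality to all times before `c`. -/
theorem mark_eq_of_pow_mul_eq {w w' : Path} (hc : 0 < c)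
    (h : ∀ n, grid n < c → ((w.1 (grid n)).mark i₀).pow γ * (c - grid n) = c)
    (h' : ∀ n, grid n < c → ((w'.1 (grid n)).mark i₀).pow γ * (c - grid n) = c) {s : ℝ≥0}
    (hs : s < c) : (w.1 s).mark i₀ = (w'.1 s).mark i₀ := by
  have hne : ∀ {v : Path}, (∀ n, grid n < c → ((v.1 (grid n)).mark i₀).pow γ * (c - grid n) = c) →
      ∀ n, grid n < c → (v.1 (grid n)).mark i₀ ≠ 0 := fun hv n hn h0 => by
    have := hv n hn
    rw [h0, Mark.pow_zero_left, MulZeroClass.zero_mul] at this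
    exact hc.ne this
  have hγ : γ ≠ 0 := by
    rintro rfl
    obtain ⟨n, h1, h2⟩ := exists_grid_btwn hc
    have h3 := h n h2
    rw [Mark.pow_of_ne (hne h n h2), NNReal.rpow_zero, _root_.one_mul] at h3
    exact absurd (tsub_lt_self hc h1) (not_lt.2 h3.ge)
  by_contra hd
  obtain ⟨U, U', hU, hU', hmU, hmU', hUU⟩ := t2_separation hd
  obtain ⟨n, -, hn, h1, h2⟩ := exists_grid_right
    (((w.2.tendsto_mark s i₀).eventually (hU.mem_nhds hmU)).and
      ((w'.2.tendsto_mark s i₀).eventually (hU'.mem_nhds hmU'))) hs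
  refine Set.disjoint_left.1 hUU h1 ?_
  have e : ((w.1 (grid n)).mark i₀).pow γ = ((w'.1 (grid n)).mark i₀).pow γ :=
    mul_right_cancel₀ (tsub_pos_of_lt hn).ne' ((h n hn).trans (h' n hn).symm)
  rw [Mark.pow_of_ne (hne h n hn), Mark.pow_of_ne (hne h' n hn)] at e
  rw [Mark.ext (NNReal.rpow_left_injective hγ e)]
  exact h2

end

namespace PathLaw

variable {α : ℝ} {Q : Kernel MarkPart Path} [IsMarkovKernel Q]

/-- Being together on `J` is a clopen condition, so a split exactly at `T` is a jump of definite
size there; stochastic continuity, from the left of `T`, excludes it. -/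
theorem measure_split_at (hQ : PathLaw α Q) (x : MarkPart) (J : Finset ℕ) {T : ℝ≥0} (hT : 0 < T) :
    Q x {w | (∀ s < T, ∀ i ∈ J, ∀ j ∈ J, (w.1 s).part i j) ∧
      ¬∀ i ∈ J, ∀ j ∈ J, (w.1 T).part i j} = 0 := by
  set C : Set MarkPart := {y | ∀ i ∈ J, ∀ j ∈ J, y.part i j}
  have hC : IsClopen C := by
    have : C = ⋂ i ∈ J, ⋂ j ∈ J, {y : MarkPart | y.part i j} := by
      ext y
      simp [C]
    rw [this]
    exact isClopen_biInter_finset fun i _ => isClopen_biInter_finset fun j _ => isClopen_part i j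
  have hU : C ×ˢ C ∪ Cᶜ ×ˢ Cᶜ ∈ 𝓝ˢ (Set.diagonal MarkPart) := by
    refine IsOpen.mem_nhdsSet ?_ |>.2 ?_
    · exact (hC.isOpen.prod hC.isOpen).union (hC.compl.isOpen.prod hC.compl.isOpen)
    · rintro ⟨y, z⟩ (rfl : y = z)
      by_cases hy : y ∈ C
      · exact Or.inl ⟨hy, hy⟩
      · exact Or.inr ⟨hy, hy⟩
  have := nhdsLT_neBot_of_exists_lt ⟨_, hT⟩
  have h1 := (hQ.stochasticallyContinuous x T _ hU).mono_left (nhdsWithin_le_nhds (s := Set.Iio T))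
  refine le_antisymm (ge_of_tendsto h1 ?_) zero_le
  filter_upwards [self_mem_nhdsWithin] with s (hs : s < T)
  refine measure_mono ?_
  rintro w ⟨h2, h3⟩ (h | h)
  · exact h3 h.2
  · exact h.1 (h2 s hs)

theorem timeChange_measure_splitTime (hQ : PathLaw α Q) (β : ℝ) (J : Finset ℕ) {i₀ : ℕ}
    (hi : i₀ ∈ J) (c : ℝ≥0) : timeChangeKernel β Q one {w | splitTime J w = c} = 0 := by
  have hR := hQ.timeChange_branchLaw β
  have hMk := hQ.markovLaw β
  by_contra h0
  obtain ⟨c₀, hc₀, hmax⟩ := BranchLaw.exists_splitTime_max h0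
  have hpos : 0 < c₀ := pos_iff_ne_zero.2 fun h => hc₀ (h ▸ hR.measure_splitTime_eq_zero J)
  have hYm := measurable_timeChangePath β
  have hV : ∀ᵐ w ∂(Q one), ∀ n, grid n < c₀ →
      (((timeChangePath β w).1 (grid n)).mark i₀).pow (α - β) * (c₀ - grid n) = c₀ := by
    refine ae_all_iff.2 fun n => ?_
    by_cases hn : grid n < c₀
    · have := hR.ae_mark_of_splitTime_max hMk hi hmax hc₀ hn
      rw [timeChangeKernel_apply] at this
      filter_upwards [ae_of_ae_map hYm.aemeasurable this] with w hw _
      exact hw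
    · exact Eventually.of_forall fun w h => absurd h hn
  have hne : ¬∀ᵐ w ∂(Q one), w ∉ {w | splitTime J (timeChangePath β w) = c₀} := by
    rw [← measure_eq_zero_iff_ae_notMem]
    rw [timeChangeKernel_apply, Measure.map_apply hYm (measurableSet_splitTime_eq J c₀)] at hc₀
    exact hc₀
  refine hne ?_
  by_contra hne'
  -- One path of the event of positive probability is kept as a reference. All the others have the
  -- same mark before `c₀`, hence the same original time `T`, at which `X` would split with positive
  -- probability.
  have hex : ∃ w₀ : Path, w₀.1 0 = one ∧ Good β w₀.1 ∧ splitTime J (timeChangePath β w₀) = c₀ ∧ ∀ n, grid n < c₀ →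
      (((timeChangePath β w₀).1 (grid n)).mark i₀).pow (α - β) * (c₀ - grid n) = c₀ := by
    by_contra hno
    push Not at hno
    refine hne' ?_
    filter_upwards [hV, hQ.ae_good β one, hQ.start one] with w h1 h2 h3 h4
    obtain ⟨n, hn, hn'⟩ := hno w h3 h2 h4
    exact hn' (h1 n hn)
  obtain ⟨w₀, hs₀, hg₀, hS₀, hV₀⟩ := hex
  obtain ⟨T, hT, hT1, hT2⟩ := exists_splitTime_of_timeChange hg₀ hi hpos hS₀ hV₀
  have hTpos : 0 < T := pos_iff_ne_zero.2 fun h => by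
    rw [h, hs₀] at hT2
    exact hT2 fun _ _ _ _ => trivial
  refine hne' ?_
  filter_upwards [hV, hQ.ae_good β one,
    measure_eq_zero_iff_ae_notMem.1 (hQ.measure_split_at one J hTpos)] with w h1 h2 h3 h4
  obtain ⟨T', hT', h5, h6⟩ := exists_splitTime_of_timeChange h2 hi hpos h4 h1
  have hTT : T' = T := by
    rw [← ENNReal.coe_inj, hT, hT']
    refine iSup_congr fun r => iSup_congr fun hr => clock_congr fun s hs => ?_
    exact mark_eq_of_pow_mul_eq hpos h1 hV₀ (hs.trans hr)
  rw [hTT] at h5 h6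
  exact h3 ⟨h5, h6⟩

end PathLaw

/-! ## Stochastic continuity of the time-changed process -/

theorem ae_not_eventually_mem {S : Type*} [MeasurableSpace S] {μ : Measure S} {D : ℕ → Set S}
    (h : Tendsto (fun n => μ (D n)) atTop (𝓝 0)) : ∀ᵐ w ∂μ, ¬∀ᶠ n in atTop, w ∈ D n := by
  have h1 : ∀ N, μ (⋂ n ≥ N, D n) = 0 := fun N => by
    refine le_antisymm (ge_of_tendsto h ?_) zero_le
    filter_upwards [eventually_ge_atTop N] with n hn
    exact measure_mono (Set.biInter_subset_of_mem hn)
  filter_upwards [measure_eq_zero_iff_ae_notMem.1 (measure_iUnion_null h1)] with w hw hev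
  obtain ⟨N, hN⟩ := eventually_atTop.1 hev
  exact hw (Set.mem_iUnion.2 ⟨N, Set.mem_iInter₂.2 hN⟩)

theorem nhdsGE_zero : 𝓝[≥] (0 : ℝ≥0) = 𝓝 0 := by
  have : Set.Ici (0 : ℝ≥0) = Set.univ := Set.eq_univ_of_forall fun s => s.2
  rw [this, nhdsWithin_univ]

theorem measurable_val_mark (i : ℕ) (t : ℝ≥0) :
    Measurable fun w : Path => ((w.1 t).mark i).val :=
  Mark.measurable_val.comp ((measurable_mark i).comp (measurable_coord t))

namespace BranchLaw

variable {γ : ℝ} {R : Kernel MarkPart Path} [IsMarkovKernel R]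

theorem tendsto_measure_dist_one (hR : BranchLaw γ R) (i : ℕ) {ε : ℝ} (hε : 0 < ε) :
    Tendsto (fun r => R one {w | ε < dist ((w.1 r).mark i).val 1}) (𝓝 0) (𝓝 0) := by
  have hm : ∀ r, MeasurableSet {w : Path | ε < dist ((w.1 r).mark i).val 1} := fun r =>
    measurableSet_lt measurable_const ((measurable_val_mark i r).dist measurable_const)
  have := tendsto_measure_of_ae_tendsto_indicator_of_isFiniteMeasure (μ := R one) (𝓝 (0 : ℝ≥0))
    MeasurableSet.empty hm (by
      filter_upwards [hR.start one] with w hw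
      have h1 := w.2.tendsto_mark 0 i
      rw [hw, nhdsGE_zero] at h1
      have h2 := (Mark.tendsto_iff_of_ne Mark.one_ne_zero).1 h1
      filter_upwards [h2 (Metric.ball_mem_nhds _ hε)] with r hr
      exact iff_of_false (not_lt.2 (le_of_lt hr)) (Set.notMem_empty _))
  rwa [measure_empty] at this

/-- For a mark `v` of size at least `1 / (k + 1)` one has `v ≤ k + 1`. A change of `v * z` from `v`
by more than `1 / (k + 1)` therefore needs `z` at distance more than `1 / (k + 1) ^ 2` from `1`,
within a time at most `(k + 1) ^ |γ| * δ` for the copy. Smaller marks are excluded by the event. -/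
theorem measure_dist_le (hR : BranchLaw γ R) (i : ℕ) (k : ℕ) (y : MarkPart) (δ : ℝ≥0) {ε : ℝ≥0∞}
    (h : ∀ r ≤ ((1 / ((k : ℝ≥0) + 1))⁻¹ ^ |γ|) * δ,
      R one {w | 1 / ((k : ℝ) + 1) ^ 2 < dist ((w.1 r).mark i).val 1} ≤ ε) :
    R y {w | 1 / ((k : ℝ≥0) + 1) ≤ ((w.1 0).mark i).size ∧
      1 / ((k : ℝ) + 1) < dist ((w.1 δ).mark i).val ((w.1 0).mark i).val} ≤ ε := by
  have hm0 := (measurable_mark i).comp (measurable_coord 0)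
  have hB : MeasurableSet {w : Path | 1 / ((k : ℝ≥0) + 1) ≤ ((w.1 0).mark i).size ∧
      1 / ((k : ℝ) + 1) < dist ((w.1 δ).mark i).val ((w.1 0).mark i).val} := by
    have h1 : MeasurableSet {w : Path | 1 / ((k : ℝ≥0) + 1) ≤ ((w.1 0).mark i).size} :=
      measurableSet_le measurable_const (Mark.measurable_size.comp hm0)
    have h2 : MeasurableSet {w : Path |
        1 / ((k : ℝ) + 1) < dist ((w.1 δ).mark i).val ((w.1 0).mark i).val} :=
      measurableSet_lt measurable_const ((measurable_val_mark i δ).dist (measurable_val_mark i 0))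
    exact h1.inter h2
  have hm : ∀ r, MeasurableSet {w : Path | 1 / ((k : ℝ) + 1) ^ 2 < dist ((w.1 r).mark i).val 1} :=
    fun r => measurableSet_lt measurable_const ((measurable_val_mark i r).dist measurable_const)
  have hzero : ∀ f : ℕ → Path, (f (y.blockLabel i)).1 0 = one →
      ((frag γ y f).1 0).mark i = y.mark i := fun f hf => by
    change y.mark i * ((f (y.blockLabel i)).1 ((y.mark i).pow γ * 0)).mark i = _
    rw [MulZeroClass.mul_zero, hf]
    exact Mark.ext (mul_one _)
  have hpos : 0 < 1 / ((k : ℝ≥0) + 1) := by positivity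
  by_cases hv : 1 / ((k : ℝ≥0) + 1) ≤ (y.mark i).size
  · refine (hR.measure_le_of_block y (y.blockLabel i) hB (hm ((y.mark i).pow γ * δ))
      fun f hf ⟨_, h2⟩ => ?_).trans (h _ (mul_le_mul' (Mark.pow_le hpos hv γ) le_rfl))
    rw [hzero f hf] at h2
    change _ < dist ((y.mark i).val * (((f (y.blockLabel i)).1 ((y.mark i).pow γ * δ)).mark i).val)
      (y.mark i).val at h2
    change _ < dist (((f (y.blockLabel i)).1 ((y.mark i).pow γ * δ)).mark i).val 1
    set z := (((f (y.blockLabel i)).1 ((y.mark i).pow γ * δ)).mark i).val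
    have h3 : dist ((y.mark i).val * z) (y.mark i).val = (y.mark i).val * dist z 1 := by
      rw [NNReal.dist_eq, NNReal.dist_eq, NNReal.coe_mul, NNReal.coe_one]
      nth_rewrite 2 [← _root_.mul_one ((y.mark i).val : ℝ)]
      rw [← mul_sub, abs_mul, abs_of_nonneg (NNReal.coe_nonneg _)]
    have h4 : ((y.mark i).val : ℝ) ≤ k + 1 := by
      have h5 := (Mark.val_le_inv_size (y.mark i)).trans (inv_anti₀ hpos hv)
      rw [one_div, inv_inv] at h5
      exact_mod_cast h5
    have h6 : 1 / ((k : ℝ) + 1) < ((k : ℝ) + 1) * dist z 1 :=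
      (h2.trans_eq h3).trans_le (mul_le_mul_of_nonneg_right h4 dist_nonneg)
    rw [div_lt_iff₀ (by positivity)] at h6 ⊢
    linarith
  · have : R y {w | 1 / ((k : ℝ≥0) + 1) ≤ ((w.1 0).mark i).size ∧
        1 / ((k : ℝ) + 1) < dist ((w.1 δ).mark i).val ((w.1 0).mark i).val} ≤ R one ∅ :=
      hR.measure_le_of_block y (y.blockLabel i) hB MeasurableSet.empty
        fun f hf h => hv (hzero f hf ▸ h.1)
    rw [measure_empty] at this
    exact this.trans zero_le

/-- The left limit exists, and only its value is in question. Regularity excludes the left limit `0`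
with a nonzero mark at `t`. If the left limit is nonzero and differs from the mark at `t`, the event
of `measure_dist_le` holds, for some `k`, at all `t - δ n` with `n` large, although its probability
tends to `0`. -/
theorem ae_tendsto_mark (hR : BranchLaw γ R) (hMk : MarkovLaw R)
    (hreg : ∀ x, ∀ᵐ w ∂(R x), Regular w.1) (x : MarkPart) {t : ℝ≥0} (ht : 0 < t) (i : ℕ) :
    ∀ᵐ w ∂(R x), Tendsto (fun s => (w.1 s).mark i) (𝓝[<] t) (𝓝 ((w.1 t).mark i)) := by
  set δ : ℕ → ℝ≥0 := fun n => t / ((n : ℝ≥0) + 1)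
  have hδt : ∀ n, δ n ≤ t := fun n => div_le_self zero_le (by simp)
  have hδ : ∀ n, 0 < δ n := fun n => by positivity
  have hδ0 : Tendsto δ atTop (𝓝 0) := by
    have := tendsto_one_div_add_atTop_nhds_zero_nat (𝕜 := ℝ≥0) |>.const_mul t
    rw [MulZeroClass.mul_zero] at this
    refine this.congr fun n => ?_
    rw [mul_one_div]
  have hs : Tendsto (fun n => t - δ n) atTop (𝓝[<] t) := by
    refine tendsto_nhdsWithin_iff.2 ⟨?_, Eventually.of_forall fun n => tsub_lt_self ht (hδ n)⟩
    have : Tendsto (fun n => t - δ n) atTop (𝓝 (t - 0)) := hδ0.const_sub t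
    rwa [tsub_zero] at this
  have hD : ∀ k : ℕ, Tendsto (fun n => R x {w | 1 / ((k : ℝ≥0) + 1) ≤ ((w.1 (t - δ n)).mark i).size ∧
      1 / ((k : ℝ) + 1) < dist ((w.1 t).mark i).val ((w.1 (t - δ n)).mark i).val}) atTop (𝓝 0) := by
    intro k
    refine ENNReal.tendsto_nhds_zero.2 fun ε hε => ?_
    have h1 := ENNReal.tendsto_nhds_zero.1 (hR.tendsto_measure_dist_one i
      (ε := 1 / ((k : ℝ) + 1) ^ 2) (by positivity)) ε hε
    rw [← nhdsGE_zero] at h1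
    obtain ⟨η, hη, hball⟩ := (nhdsGE_basis (0 : ℝ≥0)).mem_iff.1 h1
    have h2 : Tendsto (fun n => ((1 / ((k : ℝ≥0) + 1))⁻¹ ^ |γ|) * δ n) atTop (𝓝 0) := by
      have := hδ0.const_mul ((1 / ((k : ℝ≥0) + 1))⁻¹ ^ |γ|)
      rwa [MulZeroClass.mul_zero] at this
    filter_upwards [h2.eventually_lt_const hη] with n hn
    have hm0 := (measurable_mark i).comp (measurable_coord 0)
    have hB : MeasurableSet {w : Path | 1 / ((k : ℝ≥0) + 1) ≤ ((w.1 0).mark i).size ∧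
        1 / ((k : ℝ) + 1) < dist ((w.1 (δ n)).mark i).val ((w.1 0).mark i).val} := by
      have h1 : MeasurableSet {w : Path | 1 / ((k : ℝ≥0) + 1) ≤ ((w.1 0).mark i).size} :=
        measurableSet_le measurable_const (Mark.measurable_size.comp hm0)
      have h2 : MeasurableSet {w : Path |
          1 / ((k : ℝ) + 1) < dist ((w.1 (δ n)).mark i).val ((w.1 0).mark i).val} :=
        measurableSet_lt measurable_const
          ((measurable_val_mark i (δ n)).dist (measurable_val_mark i 0))
      exact h1.inter h2
    have h3 := hMk x (t - δ n) Set.univ _ MeasurableSet.univ hB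
    rw [Set.preimage_univ, Measure.restrict_univ] at h3
    have h4 : ∀ w : Path, (1 / ((k : ℝ≥0) + 1) ≤ ((w.1 (t - δ n)).mark i).size ∧
        1 / ((k : ℝ) + 1) < dist ((w.1 t).mark i).val ((w.1 (t - δ n)).mark i).val) →
        1 / ((k : ℝ≥0) + 1) ≤ (((shift (t - δ n) w).1 0).mark i).size ∧
        1 / ((k : ℝ) + 1) < dist (((shift (t - δ n) w).1 (δ n)).mark i).val
          (((shift (t - δ n) w).1 0).mark i).val := fun w hw => by
      change _ ≤ ((w.1 (t - δ n + 0)).mark i).size ∧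
        _ < dist ((w.1 (t - δ n + δ n)).mark i).val ((w.1 (t - δ n + 0)).mark i).val
      rw [add_zero, tsub_add_cancel_of_le (hδt n)]
      exact hw
    calc _ ≤ _ := measure_mono fun w hw => And.intro trivial (h4 w hw)
      _ = _ := h3
      _ ≤ ∫⁻ _, ε ∂(R x) := lintegral_mono fun w => hR.measure_dist_le i k _ _ fun r hr =>
          hball ⟨zero_le, hr.trans_lt hn⟩
      _ = ε := by rw [lintegral_const, measure_univ, mul_one]
  filter_upwards [hreg x, ae_all_iff.2 fun k => ae_not_eventually_mem (hD k)] with w hw h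
  have := nhdsLT_neBot_of_exists_lt ⟨_, ht⟩
  obtain ⟨v, hv⟩ := w.2.exists_left_mark t i
  have hsz := (Mark.continuous_size.tendsto _).comp hv
  suffices hvt : v = (w.1 t).mark i by rwa [hvt] at hv
  by_contra hne
  have hv0 : v ≠ 0 := fun hv0 => by
    have ht0 : (w.1 t).mark i ≠ 0 := fun h0 => hne (hv0.trans h0.symm)
    obtain ⟨e, he, h'⟩ := hw.away ht0
    have := ge_of_tendsto hsz (b := e) (by
      filter_upwards [self_mem_nhdsWithin] with s hs
      exact h' s (le_of_lt hs))
    rw [hv0, Mark.size_zero] at this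
    exact absurd he (not_lt.2 this)
  have hd : 0 < dist ((w.1 t).mark i).val v.val := dist_pos.2 fun h => hne (Mark.ext h.symm)
  obtain ⟨k, hk⟩ := exists_nat_one_div_lt (K := ℝ)
    (lt_min hd (show (0 : ℝ) < v.size by exact_mod_cast Mark.size_pos hv0))
  refine h k (hs.eventually (p := fun s => 1 / ((k : ℝ≥0) + 1) ≤ ((w.1 s).mark i).size ∧
    1 / ((k : ℝ) + 1) < dist ((w.1 t).mark i).val ((w.1 s).mark i).val) ?_)
  have hval := (Mark.tendsto_iff_of_ne hv0).1 hv
  filter_upwards [(tendsto_const_nhds.dist hval).eventually_const_lt (hk.trans_le (min_le_left _ _)),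
    hsz.eventually_const_lt (u := 1 / ((k : ℝ≥0) + 1))
      (by exact_mod_cast hk.trans_le (min_le_right _ _))] with s h1 h2
  exact ⟨le_of_lt h2, h1⟩

end BranchLaw

namespace PathLaw

variable {α : ℝ} {Q : Kernel MarkPart Path} [IsMarkovKernel Q]

/-- The splitting time of each pair is almost surely not `t`, so a pair separated at `t` is already
separated slightly before; for marks this is `ae_tendsto_mark`. -/
theorem timeChange_ae_tendsto (hQ : PathLaw α Q) (β : ℝ) (x : MarkPart) (t : ℝ≥0) :
    ∀ᵐ w ∂(timeChangeKernel β Q x), Tendsto w.1 (𝓝 t) (𝓝 (w.1 t)) := by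
  have hR := hQ.timeChange_branchLaw β
  rcases eq_or_ne t 0 with rfl | ht
  · refine Eventually.of_forall fun w => ?_
    rw [← nhdsGE_zero]
    exact w.2.tendsto_ge 0
  have ht := pos_iff_ne_zero.2 ht
  have hS : ∀ i j, ∀ᵐ w ∂(timeChangeKernel β Q x), splitTime {i, j} w ≠ t := fun i j => by
    have h1 := hR.measure_splitTime_eq_le (J := {i, j}) (i₀ := i) (by simp) x ht
    rw [hQ.timeChange_measure_splitTime β {i, j} (i₀ := i) (by simp)] at h1
    exact measure_eq_zero_iff_ae_notMem.1 (le_antisymm h1 zero_le)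
  filter_upwards [timeChange_regular β Q x, ae_all_iff.2 fun i => ae_all_iff.2 (hS i),
    ae_all_iff.2 (hR.ae_tendsto_mark (hQ.markovLaw β) (timeChange_regular β Q) x ht)]
    with w hw h1 h2
  rw [← nhdsLT_sup_nhdsGE]
  refine Tendsto.sup (tendsto_iff.2 ⟨fun i j => ?_, h2⟩) (w.2.tendsto_ge t)
  by_cases hij : (w.1 t).part i j
  · filter_upwards [self_mem_nhdsWithin] with s hs
    exact iff_of_true (hw.mono (le_of_lt hs) hij) hij
  · have hle : splitTime {i, j} w ≤ t := by
      rw [splitTime_le_iff]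
      exact fun h => hij (h t le_rfl i (by simp) j (by simp))
    have hlt : splitTime {i, j} w < t := lt_of_le_of_ne hle (h1 i j)
    obtain ⟨_, ⟨s, rfl, hs⟩, hst⟩ := sInf_lt_iff.1 hlt
    have hst' : s < t := by exact_mod_cast hst
    have hns : ¬(w.1 s).part i j := fun h => hs fun r hr a ha b hb => by
      simp only [Finset.mem_insert, Finset.mem_singleton] at ha hb
      have h' := hw.mono hr h
      rcases ha with rfl | rfl <;> rcases hb with rfl | rfl
      · exact Setoid.refl' _ _
      · exact h'
      · exact Setoid.symm' _ h'
      · exact Setoid.refl' _ _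
    filter_upwards [mem_nhdsWithin_of_mem_nhds (Ioi_mem_nhds hst')] with r hr
    exact iff_of_false (fun h => hns (hw.mono (le_of_lt hr) h)) hij

theorem timeChange_stochasticallyContinuous (hQ : PathLaw α Q) (β : ℝ) (x : MarkPart) (t : ℝ≥0)
    (U : Set (MarkPart × MarkPart)) (hU : U ∈ 𝓝ˢ (Set.diagonal MarkPart)) :
    Tendsto (fun s => timeChangeKernel β Q x {w | (w.1 s, w.1 t) ∉ U}) (𝓝 t) (𝓝 0) := by
  obtain ⟨W, hWo, hdW, hWU⟩ := mem_nhdsSet_iff_exists.1 hU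
  have hm : ∀ s, MeasurableSet {w : Path | (w.1 s, w.1 t) ∉ W} := fun s =>
    (((measurable_coord s).prodMk (measurable_coord t)) hWo.measurableSet).compl
  have := tendsto_measure_of_ae_tendsto_indicator_of_isFiniteMeasure
    (μ := timeChangeKernel β Q x) (𝓝 t) MeasurableSet.empty hm (by
      filter_upwards [hQ.timeChange_ae_tendsto β x t] with w hw
      have h1 : Tendsto (fun s => (w.1 s, w.1 t)) (𝓝 t) (𝓝 (w.1 t, w.1 t)) :=
        hw.prodMk_nhds tendsto_const_nhds
      filter_upwards [h1 (hWo.mem_nhds (hdW (Set.mem_diagonal _)))] with s hs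
      exact iff_of_false (fun h => h hs) (Set.notMem_empty _))
  rw [measure_empty] at this
  exact tendsto_of_tendsto_of_tendsto_of_le_of_le tendsto_const_nhds this (fun _ => zero_le)
    fun s => measure_mono fun w hw h => hw (hWU h)

end PathLaw

/-! ## From the Markov property to the strong Markov property -/

namespace MarkPart

theorem blockMin_mem (y : MarkPart) (i : ℕ) : y.part i (y.blockMin i) :=
  Nat.sInf_mem (s := y.block i) ⟨i, y.part.refl' i⟩

theorem blockMin_le_of_part {y : MarkPart} {i j : ℕ} (h : y.part i j) : y.blockMin i ≤ j :=
  Nat.sInf_le (s := y.block i) h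

/-- The label of the block of `i` depends only on the partition of the integers up to `i`, hence is
eventually constant along a convergent sequence. -/
theorem blockLabel_congr {y y' : MarkPart} {i : ℕ}
    (h : ∀ a ≤ i, ∀ b ≤ i, (y'.part a b ↔ y.part a b)) : y'.blockLabel i = y.blockLabel i := by
  have hle : ∀ z : MarkPart, ∀ a, z.blockMin a ≤ a := fun z a => blockMin_le_of_part (z.part.refl' a)
  have hmin : ∀ a ≤ i, y'.blockMin a = y.blockMin a := fun a ha => by
    refine le_antisymm (blockMin_le_of_part ?_) (blockMin_le_of_part ?_)
    · exact (h a ha _ ((hle y a).trans ha)).2 (y.blockMin_mem a)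
    · exact (h a ha _ ((hle y' a).trans ha)).1 (y'.blockMin_mem a)
  have e : {m : ℕ | m < y'.blockMin i ∧ y'.blockMin m = m} =
      {m : ℕ | m < y.blockMin i ∧ y.blockMin m = m} := by
    ext m
    change m < y'.blockMin i ∧ y'.blockMin m = m ↔ m < y.blockMin i ∧ y.blockMin m = m
    rw [hmin i le_rfl]
    exact and_congr_right fun hm => by rw [hmin m (hm.le.trans (hle y i))]
  rw [blockLabel, blockLabel, e]

theorem _root_.ESSF.Mark.tendsto_pow {ι : Type*} {l : Filter ι} {u : ι → Mark} {v : Mark}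
    (hv : v ≠ 0) (hu : Tendsto u l (𝓝 v)) (a : ℝ) :
    Tendsto (fun k => (u k).pow a) l (𝓝 (v.pow a)) := by
  have h1 := (Mark.tendsto_iff_of_ne hv).1 hu
  rw [Mark.pow_of_ne hv]
  refine (h1.nnrpow tendsto_const_nhds (Or.inl (Mark.val_pos hv).ne')).congr' ?_
  filter_upwards [hu.eventually_ne hv] with k hk
  rw [Mark.pow_of_ne hk]

end MarkPart

/-- The copies are fixed and only the state varies. Nonzero limits of marks give converging inner
times, while marks merely tending to `0` could have inner times going anywhere; `h0` excludes this.
-/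
theorem tendsto_frag {γ : ℝ} {f : ℕ → Path} {u : ℕ → MarkPart} {y : MarkPart}
    (hu : Tendsto u atTop (𝓝 y)) (h0 : ∀ i, y.mark i = 0 → ∀ᶠ n in atTop, (u n).mark i = 0)
    (t : ℝ≥0) (hf : ∀ i, Tendsto (f (y.blockLabel i)).1 (𝓝 ((y.mark i).pow γ * t))
      (𝓝 ((f (y.blockLabel i)).1 ((y.mark i).pow γ * t)))) :
    Tendsto (fun n => (frag γ (u n) f).1 t) atTop (𝓝 ((frag γ y f).1 t)) := by
  obtain ⟨hp, hm⟩ := tendsto_iff.1 hu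
  have hz : ∀ i, Tendsto (fun n => (f ((u n).blockLabel i)).1 (((u n).mark i).pow γ * t)) atTop
      (𝓝 ((f (y.blockLabel i)).1 ((y.mark i).pow γ * t))) := fun i => by
    have hlab : ∀ᶠ n in atTop, (u n).blockLabel i = y.blockLabel i := by
      have : ∀ᶠ n in atTop, ∀ a ∈ Finset.range (i + 1), ∀ b ∈ Finset.range (i + 1),
          ((u n).part a b ↔ y.part a b) :=
        ((Finset.range (i + 1)).eventually_all).2 fun a _ =>
          ((Finset.range (i + 1)).eventually_all).2 fun b _ => hp a b
      filter_upwards [this] with n hn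
      exact blockLabel_congr fun a ha b hb =>
        hn a (Finset.mem_range_succ_iff.2 ha) b (Finset.mem_range_succ_iff.2 hb)
    have htime : Tendsto (fun n => ((u n).mark i).pow γ * t) atTop
        (𝓝 ((y.mark i).pow γ * t)) := by
      by_cases hy : y.mark i = 0
      · refine tendsto_const_nhds.congr' ?_
        filter_upwards [h0 i hy] with n hn
        rw [hn, hy]
      · exact (Mark.tendsto_pow hy (hm i) γ).mul_const t
    refine ((hf i).comp htime).congr' ?_
    filter_upwards [hlab] with n hn
    rw [hn]
    rfl
  refine tendsto_iff.2 ⟨fun i j => ?_, fun i => ?_⟩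
  · filter_upwards [hp i j, (tendsto_iff.1 (hz i)).1 i j] with n h1 h2
    exact and_congr h1 h2
  · change Tendsto (fun n => (u n).mark i * ((f ((u n).blockLabel i)).1
      (((u n).mark i).pow γ * t)).mark i) atTop
      (𝓝 (y.mark i * ((f (y.blockLabel i)).1 ((y.mark i).pow γ * t)).mark i))
    by_cases hy : y.mark i = 0
    · refine tendsto_const_nhds.congr' ?_
      filter_upwards [h0 i hy] with n hn
      rw [hn, hy, Mark.zero_mul, Mark.zero_mul]
    · exact Mark.tendsto_mul hy (hm i) ((tendsto_iff.1 (hz i)).2 i)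

theorem measurable_finite_coords (I : Finset ℝ≥0) :
    Measurable fun (w : Path) (s : I) => w.1 s :=
  measurable_pi_lambda _ fun s => measurable_coord s

/-- Finite measures on the path space are determined by the integrals of the bounded continuous
functions of finitely many coordinates. -/
theorem path_measure_ext {μ ν : Measure Path} [IsFiniteMeasure μ] [IsFiniteMeasure ν]
    (h : ∀ (I : Finset ℝ≥0) (G : BoundedContinuousFunction (I → MarkPart) ℝ≥0),
      ∫⁻ w, G (fun s => w.1 s) ∂μ = ∫⁻ w, G (fun s => w.1 s) ∂ν) : μ = ν := by
  have hval : Measurable (Subtype.val : Path → ℝ≥0 → MarkPart) := measurable_subtype_coe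
  have hI : ∀ I : Finset ℝ≥0, Measurable (I.restrict : (ℝ≥0 → MarkPart) → I → MarkPart) :=
    fun I => Finset.measurable_restrict I
  refine map_val_injective (IsProjectiveLimit.unique
    (P := fun I : Finset ℝ≥0 => (ν.map Subtype.val).map I.restrict) (fun I => ?_) fun I => rfl)
  let := TopologicalSpace.metrizableSpaceMetric (I → MarkPart)
  change (μ.map Subtype.val).map I.restrict = (ν.map Subtype.val).map I.restrict
  rw [Measure.map_map (hI I) hval, Measure.map_map (hI I) hval]
  refine ext_of_forall_lintegral_eq_of_IsFiniteMeasure fun G => ?_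
  have hG : Measurable fun z : I → MarkPart => (G z : ℝ≥0∞) :=
    measurable_coe_nnreal_ennreal.comp G.continuous.measurable
  rw [lintegral_map hG ((hI I).comp hval), lintegral_map hG ((hI I).comp hval)]
  exact h I G

/-- A restricted Feller property, by dominated convergence over one i.i.d. family of copies. Only
countably many inner times, fixed by `y`, `I` and `i`, are involved, so the copies are almost surely
continuous at all of them. -/
theorem BranchLaw.tendsto_lintegral {γ : ℝ} {R : Kernel MarkPart Path} [IsMarkovKernel R]
    (hR : BranchLaw γ R) (hc : ∀ t, ∀ᵐ w ∂(R one), Tendsto w.1 (𝓝 t) (𝓝 (w.1 t)))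
    {u : ℕ → MarkPart} {y : MarkPart} (hu : Tendsto u atTop (𝓝 y))
    (h0 : ∀ i, y.mark i = 0 → ∀ᶠ n in atTop, (u n).mark i = 0) (I : Finset ℝ≥0)
    (G : BoundedContinuousFunction (I → MarkPart) ℝ≥0) :
    Tendsto (fun n => ∫⁻ w, G (fun s => w.1 s) ∂(R (u n))) atTop
      (𝓝 (∫⁻ w, G (fun s => w.1 s) ∂(R y))) := by
  have hG : Measurable fun w : Path => (G (fun s => w.1 s) : ℝ≥0∞) :=
    measurable_coe_nnreal_ennreal.comp (G.continuous.measurable.comp (measurable_finite_coords I))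
  have e : ∀ z, ∫⁻ w, G (fun s => w.1 s) ∂(R z) =
      ∫⁻ f, G (fun s => (frag γ z f).1 s) ∂(Measure.infinitePi fun _ : ℕ => R one) := fun z => by
    rw [hR.branching z, lintegral_map hG (measurable_frag γ z)]
  simp only [e]
  refine tendsto_lintegral_of_dominated_convergence (fun _ => (nndist G 0 : ℝ≥0∞))
    (fun n => hG.comp (measurable_frag γ (u n))) (fun n => Eventually.of_forall fun f => ?_) ?_ ?_
  · exact ENNReal.coe_le_coe.2 (BoundedContinuousFunction.NNReal.upper_bound G _)
  · rw [lintegral_const, measure_univ, mul_one]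
    exact ENNReal.coe_ne_top
  · have hk : ∀ (k : ℕ) (r : ℝ≥0), ∀ᵐ f ∂(Measure.infinitePi fun _ : ℕ => R one),
        Tendsto (f k).1 (𝓝 r) (𝓝 ((f k).1 r)) := fun k r => by
      have e := Measure.infinitePi_map_eval (fun _ : ℕ => R one) k
      have e' : (Measure.infinitePi fun _ : ℕ => R one).map (fun f : ℕ → Path => f k) = R one := e
      refine ae_of_ae_map (f := fun f : ℕ → Path => f k) (measurable_pi_apply k).aemeasurable
        (p := fun w => Tendsto w.1 (𝓝 r) (𝓝 (w.1 r))) ?_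
      rw [e']
      exact hc r
    have hall : ∀ᵐ f ∂(Measure.infinitePi fun _ : ℕ => R one), ∀ (s : I) (i : ℕ),
        Tendsto (f (y.blockLabel i)).1 (𝓝 ((y.mark i).pow γ * s))
          (𝓝 ((f (y.blockLabel i)).1 ((y.mark i).pow γ * s))) :=
      ae_all_iff.2 fun s => ae_all_iff.2 fun i => hk _ _
    filter_upwards [hall] with f hf
    refine ENNReal.tendsto_coe.2 ((G.continuous.tendsto _).comp (tendsto_pi_nhds.2 fun s => ?_))
    exact tendsto_frag hu h0 s (hf s)

section

variable {Ω : Type*} [MeasurableSpace Ω]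

theorem map_eq_bind_iff {μ : Measure Ω} {R : Kernel MarkPart Path} {A : Set Ω} {g : Ω → Path}
    {h : Ω → MarkPart} (hg : Measurable g) (hh : Measurable h) :
    (μ.restrict A).map g = ((μ.restrict A).map h).bind R ↔
      ∀ B, MeasurableSet B → μ (A ∩ g ⁻¹' B) = ∫⁻ ω in A, R (h ω) B ∂μ := by
  have key : ∀ B, MeasurableSet B → (μ.restrict A).map g B = μ (A ∩ g ⁻¹' B) ∧
      ((μ.restrict A).map h).bind R B = ∫⁻ ω in A, R (h ω) B ∂μ := fun B hB => by
    rw [Measure.map_apply hg hB, Measure.restrict_apply (hg hB), Set.inter_comm,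
      Measure.bind_apply hB R.aemeasurable, lintegral_map (R.measurable_coe hB) hh]
    exact ⟨rfl, rfl⟩
  constructor
  · intro h B hB
    rw [← (key B hB).1, ← (key B hB).2, h]
  · intro h
    ext B hB
    rw [(key B hB).1, (key B hB).2, h B hB]

theorem history_le_comap_stop {Y : ℝ≥0 → Ω → MarkPart} (hY : ∀ t, Measurable (Y t))
    (hc : ∀ ω, IsCadlag fun t => Y t ω) (t : ℝ≥0) :
    history Y hY t ≤ MeasurableSpace.comap (fun ω => stopAt t (toPath Y hc ω)) inferInstance := by
  refine iSup₂_le fun s hs => ?_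
  rintro _ ⟨B, hB, rfl⟩
  refine ⟨_, measurable_coord s hB, ?_⟩
  ext ω
  have : coord s (stopAt t (toPath Y hc ω)) = Y s ω := stop_apply_of_le hs _
  simp only [Set.mem_preimage, this]

theorem markov_of_law {P : Kernel MarkPart Ω} {Y : ℝ≥0 → Ω → MarkPart}
    (hY : ∀ t, Measurable (Y t)) (hc : ∀ ω, IsCadlag fun t => Y t ω) {R : Kernel MarkPart Path}
    (hPR : ∀ x, (P x).map (toPath Y hc) = R x) (hMk : MarkovLaw R) (x : MarkPart) (t : ℝ≥0)
    {A : Set Ω} (hA : MeasurableSet[history Y hY t] A) {B : Set Path} (hB : MeasurableSet B) :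
    P x (A ∩ (fun ω => shift t (toPath Y hc ω)) ⁻¹' B) = ∫⁻ ω in A, R (Y t ω) B ∂(P x) := by
  obtain ⟨C, hC, rfl⟩ := history_le_comap_stop hY hc t A hA
  have hD := measurable_toPath' hY hc
  have h := hMk x t C B hC hB
  have hm : MeasurableSet {w : Path | stopAt t w ∈ C ∧ shift t w ∈ B} :=
    (measurable_stop t hC).inter (measurable_shift t hB)
  rw [← hPR x, Measure.map_apply hD hm, setLIntegral_map (measurable_stop t hC)
    (show Measurable fun w : Path => R (w.1 t) B from
      (R.measurable_coe hB).comp (measurable_coord t)) hD] at h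
  exact h

/-- The stopping time is approximated strictly from the right by times with countably many values,
for which the Markov property suffices. The left-hand sides converge by right-continuity of the
paths, the right-hand sides by `BranchLaw.tendsto_lintegral`. -/
theorem strongMarkov_of_markov {P : Kernel MarkPart Ω} [IsMarkovKernel P] {Y : ℝ≥0 → Ω → MarkPart}
    (hY : ∀ t, Measurable (Y t)) (hc : ∀ ω, IsCadlag fun t => Y t ω) {γ : ℝ}
    {R : Kernel MarkPart Path} [IsMarkovKernel R] (hPR : ∀ x, (P x).map (toPath Y hc) = R x)
    (hR : BranchLaw γ R) (hMk : MarkovLaw R) (hreg : ∀ x, ∀ᵐ w ∂(R x), Regular w.1)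
    (hcont : ∀ t, ∀ᵐ w ∂(R one), Tendsto w.1 (𝓝 t) (𝓝 (w.1 t))) : IsStrongMarkov P Y hY := by
  intro T hT x A B hA hAT hB
  have hD := measurable_toPath' hY hc
  have hAm : MeasurableSet A := hT.measurableSpace_le _ hA
  have hTm : Measurable[hT.measurableSpace] fun ω => (T ω).untopD 0 :=
    (WithTop.measurable_untopD 0).comp hT.measurable
  set τ : Ω → ℝ≥0 := fun ω => (T ω).untopD 0
  have hτ : Measurable τ := hTm.mono hT.measurableSpace_le le_rfl
  set τn : ℕ → Ω → ℝ≥0 := fun n ω => gridAbove n (τ ω)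
  have hgrid : ∀ n, Measurable (gridAbove n) := fun n => by
    unfold gridAbove
    exact ((measurable_from_nat (f := fun k : ℕ => (k : ℝ≥0))).comp
      (Nat.measurable_floor.comp (measurable_id.mul_const _)) |>.add_const _).div_const _
  have hτn : ∀ n, Measurable (τn n) := fun n => (hgrid n).comp hτ
  have hg : ∀ {σ : Ω → ℝ≥0}, Measurable σ → Measurable fun ω => shift (σ ω) (toPath Y hc ω) :=
    fun hσ => measurable_shift_uncurry.comp (hσ.prodMk hD)
  have hh : ∀ {σ : Ω → ℝ≥0}, Measurable σ → Measurable fun ω => (toPath Y hc ω).1 (σ ω) :=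
    fun hσ => measurable_eval_comp hσ hD
  -- The discrete approximations.
  have hdisc : ∀ n, ((P x).restrict A).map (fun ω => shift (τn n ω) (toPath Y hc ω)) =
      (((P x).restrict A).map fun ω => (toPath Y hc ω).1 (τn n ω)).bind R := fun n => by
    refine (map_eq_bind_iff (hg (hτn n)) (hh (hτn n))).2 fun B hB => ?_
    set K : Ω → ℕ := fun ω => ⌊τ ω * (n + 1)⌋₊
    have hK : Measurable[hT.measurableSpace] K :=
      Nat.measurable_floor.comp ((measurable_mul_const _).comp hTm)
    have hAk : ∀ k, MeasurableSet[hT.measurableSpace] (A ∩ K ⁻¹' {k}) := fun k =>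
      hA.inter (hK (measurableSet_singleton k))
    have hAkm : ∀ k, MeasurableSet (A ∩ K ⁻¹' {k}) := fun k => hT.measurableSpace_le _ (hAk k)
    set q : ℕ → ℝ≥0 := fun k => ((k : ℝ≥0) + 1) / (n + 1)
    have hq : ∀ k, ∀ ω ∈ A ∩ K ⁻¹' {k}, τn n ω = q k := fun k ω hω => by
      change ((⌊τ ω * (n + 1)⌋₊ : ℝ≥0) + 1) / (n + 1) = _
      have : ⌊τ ω * (n + 1)⌋₊ = k := hω.2
      rw [this]
    have hhist : ∀ k, MeasurableSet[history Y hY (q k)] (A ∩ K ⁻¹' {k}) := fun k => by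
      have h1 := (hAk k).2 (q k)
      rwa [Set.inter_eq_left.2] at h1
      intro ω hω
      have h2 : τ ω ≤ q k := by
        rw [← hq k ω hω]
        exact (lt_gridAbove n _).le
      obtain ⟨r, hr⟩ := WithTop.ne_top_iff_exists.1 (hAT ω hω.1)
      have h3 : τ ω = r := by
        change (T ω).untopD 0 = r
        rw [← hr]
        rfl
      change T ω ≤ _
      rw [← hr, WithTop.coe_le_coe, ← h3]
      exact h2
    have hdisj : Pairwise (Function.onFun Disjoint fun k => A ∩ K ⁻¹' {k}) := fun a b hab =>
      Set.disjoint_left.2 fun ω h1 h2 => hab (h1.2.symm.trans h2.2)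
    have hun : A = ⋃ k, A ∩ K ⁻¹' {k} := by
      rw [← Set.inter_iUnion, ← Set.preimage_iUnion, Set.iUnion_of_singleton, Set.preimage_univ,
        Set.inter_univ]
    have h1 : ∫⁻ ω in A, R ((toPath Y hc ω).1 (τn n ω)) B ∂(P x) =
        ∑' k, ∫⁻ ω in A ∩ K ⁻¹' {k}, R ((toPath Y hc ω).1 (τn n ω)) B ∂(P x) := by
      conv_lhs => rw [hun]
      exact lintegral_iUnion hAkm hdisj _
    have h2 : P x (A ∩ (fun ω => shift (τn n ω) (toPath Y hc ω)) ⁻¹' B) =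
        ∑' k, P x (A ∩ K ⁻¹' {k} ∩ (fun ω => shift (τn n ω) (toPath Y hc ω)) ⁻¹' B) := by
      conv_lhs => rw [hun, Set.iUnion_inter]
      exact measure_iUnion (fun a b hab => (hdisj hab).mono Set.inter_subset_left
        Set.inter_subset_left) fun k => (hAkm k).inter (hg (hτn n) hB)
    rw [h1, h2]
    refine tsum_congr fun k => ?_
    have h3 : A ∩ K ⁻¹' {k} ∩ (fun ω => shift (τn n ω) (toPath Y hc ω)) ⁻¹' B =
        A ∩ K ⁻¹' {k} ∩ (fun ω => shift (q k) (toPath Y hc ω)) ⁻¹' B := by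
      ext ω
      refine and_congr_right fun hω => ?_
      change shift (τn n ω) _ ∈ B ↔ shift (q k) _ ∈ B
      rw [hq k ω hω]
    rw [h3, markov_of_law hY hc hPR hMk x (q k) (hhist k) hB]
    refine setLIntegral_congr_fun (hAkm k) fun ω hω => ?_
    change R (Y (q k) ω) B = R (Y (τn n ω) ω) B
    rw [hq k ω hω]
  -- The limit.
  have hlim : ((P x).restrict A).map (fun ω => shift (τ ω) (toPath Y hc ω)) =
      (((P x).restrict A).map fun ω => (toPath Y hc ω).1 (τ ω)).bind R := by
    refine path_measure_ext fun I G => ?_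
    have hG : Measurable fun w : Path => (G (fun s => w.1 s) : ℝ≥0∞) :=
      measurable_coe_nnreal_ennreal.comp
        (G.continuous.measurable.comp (measurable_finite_coords I))
    have hbd : ∀ w : Path, (G (fun s => w.1 s) : ℝ≥0∞) ≤ nndist G 0 := fun w => by
      exact ENNReal.coe_le_coe.2 (BoundedContinuousFunction.NNReal.upper_bound G _)
    have hfin : ∫⁻ _, (nndist G 0 : ℝ≥0∞) ∂((P x).restrict A) ≠ ⊤ := by
      rw [lintegral_const]
      exact ENNReal.mul_ne_top ENNReal.coe_ne_top (measure_ne_top _ _)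
    have hGR : Measurable fun y => ∫⁻ w, G (fun s => w.1 s) ∂(R y) := hG.lintegral_kernel
    have e1 : ∀ {σ : Ω → ℝ≥0}, Measurable σ → ∫⁻ w, G (fun s => w.1 s)
        ∂(((P x).restrict A).map fun ω => shift (σ ω) (toPath Y hc ω)) =
        ∫⁻ ω in A, G (fun s => Y (σ ω + s) ω) ∂(P x) := fun hσ => lintegral_map hG (hg hσ)
    have e2 : ∀ {σ : Ω → ℝ≥0}, Measurable σ → ∫⁻ w, G (fun s => w.1 s)
        ∂((((P x).restrict A).map fun ω => (toPath Y hc ω).1 (σ ω)).bind R) =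
        ∫⁻ ω in A, ∫⁻ w, G (fun s => w.1 s) ∂(R (Y (σ ω) ω)) ∂(P x) := fun hσ => by
      rw [Measure.lintegral_bind R.aemeasurable hG.aemeasurable, lintegral_map hGR (hh hσ)]
      rfl
    rw [e1 hτ, e2 hτ]
    have htau : ∀ ω, Tendsto (fun n => τn n ω) atTop (𝓝[≥] τ ω) := fun ω =>
      (tendsto_gridAbove (τ ω)).mono_right (nhdsWithin_mono _ Set.Ioi_subset_Ici_self)
    have l1 : Tendsto (fun n => ∫⁻ ω in A, G (fun s => Y (τn n ω + s) ω) ∂(P x)) atTop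
        (𝓝 (∫⁻ ω in A, G (fun s => Y (τ ω + s) ω) ∂(P x))) := by
      refine tendsto_lintegral_of_dominated_convergence (fun _ => (nndist G 0 : ℝ≥0∞))
        (fun n => hG.comp (hg (hτn n))) (fun n => Eventually.of_forall fun ω => hbd (shift (τn n ω) (toPath Y hc ω))) hfin
        (Eventually.of_forall fun ω => ?_)
      refine ENNReal.tendsto_coe.2 ((G.continuous.tendsto _).comp (tendsto_pi_nhds.2 fun s => ?_))
      refine ((hc ω).tendsto_ge (τ ω + s)).comp (tendsto_nhdsWithin_iff.2 ⟨?_, ?_⟩)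
      · exact ((htau ω).mono_right nhdsWithin_le_nhds).add_const _
      · exact Eventually.of_forall fun n => add_le_add_left (lt_gridAbove n (τ ω)).le _
    have hreg' : ∀ᵐ ω ∂(P x), Regular fun t => Y t ω := by
      refine ae_of_ae_map (f := toPath Y hc) hD.aemeasurable (p := fun w => Regular w.1) ?_
      rw [hPR]
      exact hreg x
    have l2 : Tendsto (fun n => ∫⁻ ω in A, ∫⁻ w, G (fun s => w.1 s) ∂(R (Y (τn n ω) ω)) ∂(P x))
        atTop (𝓝 (∫⁻ ω in A, ∫⁻ w, G (fun s => w.1 s) ∂(R (Y (τ ω) ω)) ∂(P x))) := by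
      refine tendsto_lintegral_of_dominated_convergence (fun _ => (nndist G 0 : ℝ≥0∞))
        (fun n => hGR.comp (hh (hτn n))) (fun n => Eventually.of_forall fun ω => ?_) hfin ?_
      · refine (lintegral_mono hbd).trans ?_
        rw [lintegral_const, measure_univ, mul_one]
      · filter_upwards [ae_restrict_of_ae hreg'] with ω hω
        refine hR.tendsto_lintegral hcont (((hc ω).tendsto_ge (τ ω)).comp (htau ω))
          (fun i hi => Eventually.of_forall fun n => ?_) I G
        -- The approximating times come after `τ`, and a mark that is `0` at `τ` stays at `0`: this
        -- is the condition under which the law depends continuously on the state.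
        exact hω.mark_eq_zero (lt_gridAbove n (τ ω)).le hi
    refine tendsto_nhds_unique l1 (l2.congr fun n => ?_)
    rw [← e1 (hτn n), ← e2 (hτn n), hdisc n]
  have hval : Measurable (Subtype.val : Path → ℝ≥0 → MarkPart) := measurable_subtype_coe
  have h := (map_eq_bind_iff (hg hτ) (hh hτ)).1 hlim _ (hval hB)
  refine h.trans (lintegral_congr fun ω => ?_)
  rw [← hPR, Measure.map_apply hD (hval hB), pathLaw,
    Measure.map_apply (measurable_pi_lambda _ hY) hB]
  rfl

end

/-! ## Transfer between a process and its law on the path space -/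

theorem measurable_val_path : Measurable (Subtype.val : Path → ℝ≥0 → MarkPart) :=
  measurable_subtype_coe

theorem map_frag_val (γ : ℝ) (x : MarkPart) (μ : Measure Path) [IsProbabilityMeasure μ] :
    ((Measure.infinitePi fun _ : ℕ => μ).map (frag γ x)).map Subtype.val =
      (Measure.infinitePi fun _ : ℕ => μ.map Subtype.val).map (ssFrag γ x) := by
  have hs : Measurable (ssFrag γ x) := measurable_pi_lambda _ fun t =>
    measurable_ssFrag γ x (f := fun k t (f : ℕ → ℝ≥0 → MarkPart) => f k t)
      (fun k t => (measurable_pi_apply t).comp (measurable_pi_apply k)) t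
  have hv : Measurable fun (f : ℕ → Path) k => (f k).1 :=
    measurable_pi_lambda _ fun k => measurable_val_path.comp (measurable_pi_apply k)
  rw [← Measure.infinitePi_map_pi (fun _ : ℕ => μ) fun _ => measurable_val_path,
    Measure.map_map hs hv, Measure.map_map measurable_val_path (measurable_frag γ x)]
  rfl

theorem MarkPart.continuous_perm (σ : Equiv.Perm ℕ) : Continuous fun y : MarkPart => y.perm σ :=
  continuous_iff_continuousAt.2 fun y => tendsto_iff.2
    ⟨fun i j => (tendsto_iff.1 (tendsto_id (x := 𝓝 y))).1 (σ i) (σ j),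
      fun i => (tendsto_iff.1 (tendsto_id (x := 𝓝 y))).2 (σ i)⟩

theorem MarkPart.IsCadlag.perm {w : ℝ≥0 → MarkPart} (hw : IsCadlag w) (σ : Equiv.Perm ℕ) :
    IsCadlag fun t => (w t).perm σ := fun t =>
  ⟨((continuous_perm σ).tendsto _).comp (hw t).1,
    (hw t).2.elim fun l hl => ⟨_, ((continuous_perm σ).tendsto l).comp hl⟩⟩

/-- The action of a permutation on paths. -/
def permPath (σ : Equiv.Perm ℕ) (w : Path) : Path := ⟨fun t => (w.1 t).perm σ, w.2.perm σ⟩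

theorem measurable_permPath (σ : Equiv.Perm ℕ) : Measurable (permPath σ) :=
  measurable_toPath.2 fun t => (continuous_perm σ).measurable.comp (measurable_coord t)

theorem PathLaw.timeChange_perm {α : ℝ} {Q : Kernel MarkPart Path} (hQ : PathLaw α Q)
    [IsMarkovKernel Q] (β : ℝ) {σ : Equiv.Perm ℕ} {x : MarkPart}
    (h : (Q x).map (permPath σ) = Q (x.perm σ)) :
    (timeChangeKernel β Q x).map (permPath σ) = timeChangeKernel β Q (x.perm σ) := by
  have hm := measurable_timeChangePath β
  have hp := measurable_permPath σ
  rw [timeChangeKernel_apply, timeChangeKernel_apply, ← h, Measure.map_map hp hm,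
    Measure.map_map hm hp]
  have h2 : ∀ᵐ w ∂(Q x), Good β (permPath σ w).1 := by
    refine ae_of_ae_map hp.aemeasurable (p := fun w => Good β w.1) ?_
    rw [h]
    exact hQ.ae_good β _
  refine Measure.map_congr ?_
  filter_upwards [hQ.ae_good β x, h2] with w h1 h2
  refine Subtype.ext (funext fun t => ?_)
  change ((timeChangePath β w).1 t).perm σ = (timeChangePath β (permPath σ w)).1 t
  rw [timeChangePath_of_good h1, timeChangePath_of_good h2]
  exact (MarkPart.timeChange_perm β w.1 σ t).symm

section

variable {Ω : Type*} [MeasurableSpace Ω] {P : Kernel MarkPart Ω} {X : ℝ≥0 → Ω → MarkPart}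

theorem pathLaw_eq_map (hX : ∀ t, Measurable (X t)) (hc : ∀ ω, IsCadlag fun t => X t ω)
    (x : MarkPart) : pathLaw P X x = ((P x).map (toPath X hc)).map Subtype.val := by
  rw [Measure.map_map measurable_val_path (measurable_toPath' hX hc)]
  rfl

theorem measurable_toPath_history (hX : ∀ t, Measurable (X t))
    (hc : ∀ ω, IsCadlag fun t => X t ω) (t : ℝ≥0) :
    Measurable[history X hX t, history coord measurable_coord t] (toPath X hc) := by
  refine measurable_iff_le_map.2 (iSup₂_le fun s hs => ?_)
  rintro _ ⟨B, hB, rfl⟩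
  exact history_le_iSup hX hs hB

theorem strongMarkov_toPath [IsMarkovKernel P] (hX : ∀ t, Measurable (X t))
    (hc : ∀ ω, IsCadlag fun t => X t ω) (h : IsStrongMarkov P X hX) {Q : Kernel MarkPart Path}
    (hQ : ∀ x, Q x = (P x).map (toPath X hc)) (T : Path → WithTop ℝ≥0)
    (hT : IsStoppingTime (history coord measurable_coord) T) (x : MarkPart) (A B : Set Path)
    (hA : MeasurableSet[hT.measurableSpace] A) (hAT : ∀ w ∈ A, T w ≠ ⊤) (hB : MeasurableSet B) :
    Q x (A ∩ {w | shift ((T w).untopD 0) w ∈ B}) =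
      ∫⁻ w in A, Q (w.1 ((T w).untopD 0)) B ∂(Q x) := by
  obtain ⟨C, hC, rfl⟩ := hB
  have hD := measurable_toPath' hX hc
  have hT' : IsStoppingTime (history X hX) fun ω => T (toPath X hc ω) := fun t =>
    measurable_toPath_history hX hc t (hT t)
  have hAm : MeasurableSet A := hT.measurableSpace_le _ hA
  have hA' : MeasurableSet[hT'.measurableSpace] (toPath X hc ⁻¹' A) := by
    refine ⟨?_, fun t => measurable_toPath_history hX hc t (hA.2 t)⟩
    have : Measurable[⨆ t, (history X hX t : MeasurableSpace Ω)] (toPath X hc) :=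
      measurable_path_of_coord fun t => (history_le_iSup hX (le_refl t)).mono
        (le_iSup (fun t => (history X hX t : MeasurableSpace Ω)) t) le_rfl
    exact this hAm
  have hTm : Measurable fun w : Path => (T w).untopD 0 :=
    (WithTop.measurable_untopD 0).comp (hT.measurable.mono hT.measurableSpace_le le_rfl)
  have hsh : Measurable fun w : Path => shift ((T w).untopD 0) w :=
    measurable_shift_uncurry.comp (hTm.prodMk measurable_id)
  have hev : Measurable fun w : Path => w.1 ((T w).untopD 0) :=
    measurable_eval_comp hTm measurable_id
  have hCm := measurable_val_path hC
  have key := h _ hT' x _ C hA' (fun ω hω => hAT _ hω) hC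
  have hint : ∫⁻ w in A, Q (w.1 ((T w).untopD 0)) (Subtype.val ⁻¹' C) ∂(Q x) =
      ∫⁻ ω in toPath X hc ⁻¹' A, Q ((toPath X hc ω).1 ((T (toPath X hc ω)).untopD 0))
        (Subtype.val ⁻¹' C) ∂(P x) := by
    rw [hQ x, setLIntegral_map hAm
      (show Measurable fun w : Path => Q (w.1 ((T w).untopD 0)) (Subtype.val ⁻¹' C) from
        (Q.measurable_coe hCm).comp hev) hD]
  have hm : MeasurableSet (A ∩ {w | shift ((T w).untopD 0) w ∈ Subtype.val ⁻¹' C}) :=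
    hAm.inter (hsh hCm)
  rw [hint, hQ x, Measure.map_apply hD hm]
  refine Eq.trans key (lintegral_congr fun ω => ?_)
  rw [pathLaw_eq_map hX hc, Measure.map_apply measurable_val_path hC, hQ]
  rfl

theorem IsESSF.toPathLaw [IsMarkovKernel P] {α : ℝ} (hX : IsESSF α P X) :
    PathLaw α (P.map (toPath X hX.cadlag)) where
  start x := by
    have hD := measurable_toPath' hX.measurable hX.cadlag
    rw [Kernel.map_apply _ hD, ae_map_iff hD.aemeasurable
      (show MeasurableSet {w : Path | w.1 0 = x} from
        measurable_coord 0 (measurableSet_singleton x))]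
    exact hX.start x
  branching x := by
    have hD := measurable_toPath' hX.measurable hX.cadlag
    have : IsProbabilityMeasure ((P one).map (toPath X hX.cadlag)) :=
      Measure.isProbabilityMeasure_map hD.aemeasurable
    refine map_val_injective ?_
    rw [Kernel.map_apply _ hD, Kernel.map_apply _ hD, map_frag_val,
      ← pathLaw_eq_map hX.measurable, ← pathLaw_eq_map hX.measurable]
    exact hX.branching x
  strongMarkov := strongMarkov_toPath hX.measurable hX.cadlag hX.strongMarkov
    fun x => Kernel.map_apply _ (measurable_toPath' hX.measurable hX.cadlag) x
  stochasticallyContinuous x t U hU := by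
    have hD := measurable_toPath' hX.measurable hX.cadlag
    obtain ⟨W, hWo, hdW, hWU⟩ := mem_nhdsSet_iff_exists.1 hU
    refine tendsto_of_tendsto_of_tendsto_of_le_of_le tendsto_const_nhds
      (hX.stochasticallyContinuous x t W (hWo.mem_nhdsSet.2 hdW)) (fun _ => zero_le) fun s => ?_
    have hm : MeasurableSet {w : Path | (w.1 s, w.1 t) ∉ W} :=
      (((measurable_coord s).prodMk (measurable_coord t)) hWo.measurableSet).compl
    have hsub : {w : Path | (w.1 s, w.1 t) ∉ U} ⊆ {w | (w.1 s, w.1 t) ∉ W} :=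
      fun w (hw : _ ∉ U) h => hw (hWU h)
    refine (measure_mono hsub).trans ?_
    rw [Kernel.map_apply _ hD, Measure.map_apply hD hm]
    exact le_rfl

/-! ### The conclusions on the original probability space. -/

/-- The time-changed process, with càdlàg paths. -/
def timeChangeProcess (β : ℝ) (X : ℝ≥0 → Ω → MarkPart) (hc : ∀ ω, IsCadlag fun t => X t ω)
    (t : ℝ≥0) (ω : Ω) : MarkPart := (timeChangePath β (toPath X hc ω)).1 t

theorem IsESSF.timeChangeProcess [IsMarkovKernel P] {α : ℝ} (hX : IsESSF α P X) (β : ℝ) :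
    IsESSF (α - β) P (timeChangeProcess β X hX.cadlag) := by
  have hD := measurable_toPath' hX.measurable hX.cadlag
  have : IsMarkovKernel (P.map (toPath X hX.cadlag)) := Kernel.IsMarkovKernel.map P hD
  have hQ := hX.toPathLaw
  set Q := P.map (toPath X hX.cadlag)
  have hQx : ∀ x, Q x = (P x).map (toPath X hX.cadlag) := Kernel.map_apply P hD
  have hY : ∀ t, Measurable (ESSF.timeChangeProcess β X hX.cadlag t) := fun t =>
    (measurable_coord t).comp ((measurable_timeChangePath β).comp hD)
  have hc : ∀ ω, IsCadlag fun t => ESSF.timeChangeProcess β X hX.cadlag t ω := fun ω =>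
    (timeChangePath β (toPath X hX.cadlag ω)).2
  have hYD := measurable_toPath' hY hc
  have hPR : ∀ x, (P x).map (toPath (ESSF.timeChangeProcess β X hX.cadlag) hc) =
      timeChangeKernel β Q x := fun x => by
    rw [timeChangeKernel_apply, hQx, Measure.map_map (measurable_timeChangePath β) hD]
    rfl
  have hR := hQ.timeChange_branchLaw β
  have hlaw : ∀ x, pathLaw P (ESSF.timeChangeProcess β X hX.cadlag) x =
      (timeChangeKernel β Q x).map Subtype.val := fun x => by
    rw [pathLaw_eq_map hY hc, hPR]
  refine ⟨hY, hc, fun x => ?_, ?_, fun x t U hU => ?_, fun σ hσ x => ?_, fun x => ?_⟩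
  · have := hR.start x
    rw [← hPR] at this
    exact ae_of_ae_map hYD.aemeasurable this
  · exact strongMarkov_of_markov hY hc hPR hR (hQ.markovLaw β)
      (PathLaw.timeChange_regular β Q) fun t => hQ.timeChange_ae_tendsto β one t
  · refine tendsto_of_tendsto_of_tendsto_of_le_of_le tendsto_const_nhds
      (hQ.timeChange_stochasticallyContinuous β x t U hU) (fun _ => zero_le) fun s => ?_
    -- The neighbourhood `U` need not be measurable, so only an inequality is available for the
    -- image measure; it goes in the right direction.
    have := Measure.le_map_apply (μ := P x) hYD.aemeasurable {w : Path | (w.1 s, w.1 t) ∉ U}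
    rw [hPR] at this
    exact this
  · have h1 : (Q x).map (permPath σ) = Q (x.perm σ) := by
      refine map_val_injective ?_
      rw [hQx, hQx, ← pathLaw_eq_map hX.measurable, ← hX.exchangeable σ hσ x,
        Measure.map_map (measurable_permPath σ) hD,
        Measure.map_map measurable_val_path ((measurable_permPath σ).comp hD)]
      rfl
    rw [hlaw, ← hQ.timeChange_perm β h1, ← hPR, Measure.map_map (measurable_permPath σ) hYD,
      Measure.map_map measurable_val_path ((measurable_permPath σ).comp hYD)]
    rfl
  · rw [hlaw, hlaw, hR.branching x, map_frag_val]

theorem IsESSF.ae_good [IsMarkovKernel P] {α : ℝ} (hX : IsESSF α P X) (β : ℝ) (x : MarkPart) :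
    ∀ᵐ ω ∂(P x), Good β fun t => X t ω := by
  have hD := measurable_toPath' hX.measurable hX.cadlag
  have : IsMarkovKernel (P.map (toPath X hX.cadlag)) := Kernel.IsMarkovKernel.map P hD
  refine ae_of_ae_map (f := toPath X hX.cadlag) hD.aemeasurable (p := fun w => Good β w.1) ?_
  rw [← Kernel.map_apply P hD]
  exact hX.toPathLaw.ae_good β x

/-- Stopping the process at `s` does not change the clock up to `u ≤ s` and leaves only marks known
at time `s`. Joint measurability then holds for a σ-algebra that sees nothing beyond `s`, as the
history of a single block requires. -/
theorem measurable_clock_of_le {S : Type*} [MeasurableSpace S] {Z : ℝ≥0 → S → MarkPart}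
    (hc : ∀ ω, IsCadlag fun t => Z t ω) (β : ℝ) {i : ℕ} {u s : ℝ≥0} (hus : u ≤ s)
    (h : ∀ r ≤ s, Measurable fun ω => (Z r ω).mark i) :
    Measurable fun ω => clock β (fun r => Z r ω) i u := by
  have h2 : Measurable fun p : ℝ≥0 × S => (Z (min p.1 s) p.2).mark i :=
    measurable_uncurry_of_rightContinuous (fun r => h _ (min_le_right r s)) fun ω r =>
      (((hc ω).stopAt s).tendsto_mark r i).mono_left (nhdsWithin_mono _ Set.Ioi_subset_Ici_self)
  have h3 : Measurable fun ω : S => clock β (fun r => Z (min r s) ω) i u :=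
    (measurable_clock_of_mark β (V := fun r ω => (Z (min r s) ω).mark i) h2).comp
      (measurable_const.prodMk measurable_id : Measurable fun ω : S => (u, ω))
  have e : (fun ω => clock β (fun r => Z r ω) i u) = fun ω => clock β (fun r => Z (min r s) ω) i u :=
    funext fun ω => clock_congr fun r hr => by rw [min_eq_left (hr.le.trans hus)]
  rw [e]
  exact h3

theorem measurable_clock_blockHistory (hX : ∀ t, Measurable (X t))
    (hc : ∀ ω, IsCadlag fun t => X t ω) (β : ℝ) (i : ℕ) {u s : ℝ≥0} (hus : u ≤ s) :
    Measurable[blockHistory X hX i s] fun ω => clock β (fun r => X r ω) i u :=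
  @measurable_clock_of_le Ω (blockHistory X hX i s) X hc β i u s hus fun _ hr =>
    measurable_snd.comp (history_le_iSup (Z := fun t ω => ((X t ω).block i, (X t ω).mark i))
      (fun t => ((measurable_block i).comp (hX t)).prodMk ((measurable_mark i).comp (hX t))) hr)

theorem IsESSF.isStoppingLine [IsMarkovKernel P] {α : ℝ} (hX : IsESSF α P X) (β : ℝ) (t : ℝ≥0) :
    IsStoppingLine P X hX.measurable fun i ω => tau β (fun s => X s ω) t i where
  isStoppingTime i s := @measurableSet_tau_le Ω (blockHistory X hX.measurable i s) β
    (fun ω r => X r ω) i s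
    (fun _ hu => measurable_clock_blockHistory hX.measurable hX.cadlag β i hu) t
  compatible x := by
    filter_upwards [hX.ae_good β x] with ω hω i j hij
    exact hω.tau_congr (hX.cadlag ω) hij

/-- A live block of the time change is a block of `X` at its live time, with the same mark; the
other blocks have mark `0`. -/
theorem IsESSF.isNonDegenerate_timeChange [IsMarkovKernel P] {α : ℝ} (hX : IsESSF α P X) (β : ℝ)
    (h : IsNonDegenerate P X) :
    IsNonDegenerate P fun t ω => timeChange β (fun s => X s ω) t := by
  intro x hx
  filter_upwards [h x hx, hX.ae_good β x] with ω h1 h2 t i hfin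
  by_cases hl : ∃ u, Live β (fun s => X s ω) i u t
  · obtain ⟨u, hu⟩ := hl
    obtain ⟨hm, hp⟩ := h2.timeChange_of_live (hX.cadlag ω) hu
    rw [hm]
    refine h1 u i ?_
    have e : (X u ω).block i = (timeChange β (fun s => X s ω) t).block i :=
      Set.ext fun j => (hp j).symm
    rw [e]
    exact hfin
  · exact (h2.timeChange_of_not_live (hX.cadlag ω) hl).1

end

end ESSF

end

theorem mainTheorem5 {Ω : Type*} [MeasurableSpace Ω] (α β : ℝ)
    (P : ProbabilityTheory.Kernel ESSF.MarkPart Ω) [ProbabilityTheory.IsMarkovKernel P]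
    (X : ℝ≥0 → Ω → ESSF.MarkPart) (hX : ESSF.IsESSF α P X) :
    (∀ t : ℝ≥0, ESSF.IsStoppingLine P X hX.measurable
      (fun i ω => ESSF.MarkPart.tau β (fun s => X s ω) t i)) ∧
    (∃ Y : ℝ≥0 → Ω → ESSF.MarkPart, ESSF.IsESSF (α - β) P Y ∧
      ∀ x, ∀ᵐ ω ∂(P x), ∀ t, Y t ω = ESSF.MarkPart.timeChange β (fun s => X s ω) t) ∧
    (ESSF.IsNonDegenerate P X →
      ESSF.IsNonDegenerate P (fun t ω => ESSF.MarkPart.timeChange β (fun s => X s ω) t)) := by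
  refine ⟨hX.isStoppingLine β, ⟨_, hX.timeChangeProcess β, fun x => ?_⟩,
    hX.isNonDegenerate_timeChange β⟩
  filter_upwards [hX.ae_good β x] with ω hω t
  exact ESSF.timeChangePath_of_good (w := ESSF.toPath X hX.cadlag ω) hω t
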